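/- **Setting.** Let $0=t_0<t_1<\cdots$ be a partition of $[0,\infty)$ with $t_{j+l+1}-t_{j+l}=t_{j+1}-t_j$ for all $j\ge 0$ and some $l\ge1$, and put $\tau=t_l$ and $\mathfrak D_j=\bigcup_{k\ge0}[t_{j-1+kl},t_{j+kl})$, $1\le j\le l$. Let $N$ be a Poisson process with $N(0)=0$, independent increments and $N(t)-N(s)\sim\mathrm{Poisson}(\int_s^t\lambda(u)\,du)$ for $s\le t$, where $\lambda\ge0$ is locally integrable and $\tau$-periodic, and let $\Upsilon_n$ be the time of its $n$-th jump. Let $Z_n^j$ ($n\ge1$, $1\le j\le l$) be independent random variables, jointly independent of $N$, where $Z_n^j$ has a law $F_j$ with $\int z^2F_j(dz)<\infty$. Put $Z_n=\sum_{j=1}^l Z_n^j\mathbf 1_{\{\Upsilon_n\in\mathfrak D_j\}}$ and $$S_t=D_t+\sum_{n=1}^{N(t)}Z_n ,$$ where $D$ is a deterministic, continuous, $\tau$-periodic function of locally bounded variation with $D_0=0$. The quadratic variation of $S$ is $[S,S]_t=\sum_{0<s\le t}(\Delta S_s)^2$. Let $q\ge p\ge1$, $\alpha_0>0$, $\alpha_1,\dots,\alpha_p,\beta_1,\dots,\beta_q\in\mathbb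 R$, $\alpha_p\ne0$, $\beta_q\neq0$, $\alpha_{p+1}=\cdots=\alpha_q=0$. Let $\mathbf a=(\alpha_1,\dots,\alpha_q)'$, $\mathbf e=(0,\dots,0,1)'\in\mathbb R^q$, and let $B$ be the $q\times q$ companion matrix with ones on the superdiagonal, last row $(-\beta_q,\dots,-\beta_1)$ and zeros elsewhere. Let $\mathbf Y$ be a càdlàg solution of $$d\mathbf Y_t=B\mathbf Y_{t-}\,dt+\mathbf e(\alpha_0+\mathbf a'\mathbf Y_{t-})\,d[S,S]_t,$$ with $\mathbf Y_0$ independent of $S$, and let the volatility be $V_0=\alpha_0+\mathbf a'\mathbf Y_0$, $V_t=\alpha_0+\mathbf a'\mathbf Y_{t-}$ for $t>0$. For $0\le s\le t$ let $k=N(t)-N(s)$, let $u_0=s$, and let $u_i=\Upsilon_{N(s)+i}$ and $\zeta_i=Z_{N(s)+i}$ for $1\le i\le k$. With $Q_i=(I+\zeta_i^2\mathbf e\mathbf a')e^{B(u_i-u_{i-1})}$ and $R_i=\alpha_0\zeta_i^2\mathbf e$ put $$\mathfrak J_{s,t}=e^{B(t-u_k)}Q_k\cdots Q_1,\qquad \mathfrak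 K_{s,t}=e^{B(t-u_k)}\big(R_k+Q_kR_{k-1}+\cdots+Q_k\cdots Q_2R_1\big)$$ (so $\mathfrak J_{s,t}=e^{B(t-s)}$ and $\mathfrak K_{s,t}=0$ if $k=0$). For random vectors, $\operatorname{cov}(X,X')$ is the matrix with entries $\operatorname{cov}(X_i,X'_j)$. **Statement.** Assume $E\|\mathbf Y_0\|<\infty$. 1. For all $t\ge0$, $\mathbf Y_t$ and $V_t$ are integrable and $E(V_t)=\alpha_0+\mathbf a'E(\mathbf Y_t)$. 2. If moreover $E\|\mathbf Y_0\|^2<\infty$ and $E(S_t^4)<\infty$ for all $t\ge0$, then $\mathbf Y_t$ and $V_t$ are square integrable for all $t\ge0$, and for all $t,h\ge0$ $$\operatorname{cov}(V_t,V_{t+h})=\mathbf a'\operatorname{cov}(\mathbf Y_t,\mathbf Y_{t+h})\,\mathbf a .$$ 3. Suppose in addition to $E\|\mathbf Y_0\|<\infty$ that $\mathbf Y_0\overset d=\mathbf U$, where the law of $\mathbf U$ satisfies $\mathbf U\overset d=\mathfrak J_{0,\tau}\mathbf U+\mathfrak K_{0,\tau}$ with $\mathbf U$ independent of $(\mathfrak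 J_{0,\tau},\mathfrak K_{0,\tau})$ on the right. Then $\mathfrak J_{0,t}$ and $\mathfrak K_{0,t}$ are integrable for all $t\geq 0$, and if $t=t_1+m\tau$ with $m\in\mathbb N_0$ and $t_1\in[0,\tau)$, then $$E(V_t)=\alpha_0+\mathbf a'\big(E(\mathfrak J_{0,t_1})E(\mathbf U)+E(\mathfrak K_{0,t_1})\big).$$ If also $E\|\mathbf Y_0\|^2<\infty$ and $E(S_t^4)<\infty$ for all $t\ge0$, then the entries of $\mathfrak J_{0,t}$ and $\mathfrak K_{0,t}$ are square integrable for all $t\geq 0$, the matrix $E(\mathfrak J_{0,\tau})$ is invertible, and for all $t,h\ge0$, with $t=t_1+m\tau$, $t+h=t_2+n\tau$, $m,n\in\mathbb N_0$, $t_1,t_2\in[0,\tau)$, $$\operatorname{cov}(V_t,V_{t+h})=\mathbf a'\,E(\mathfrak J_{0,t_2})\big(E(\mathfrak J_{0,\tau})\big)^{n-m-1}\,C_{t_1}\,\mathbf a,$$ where the power is that of an invertible matrix (the exponent is $-1$ if $n=m$) and $$\begin{aligned}C_{t_1}={}&E\big(\mathfrak J_{0,\tau}E(\mathbf U\mathbf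 U')\mathfrak J_{0,t_1}'\big)-E(\mathfrak J_{0,\tau})E(\mathbf U)E(\mathbf U')E(\mathfrak J_{0,t_1}')\\&+E\big(\mathfrak J_{0,\tau}E(\mathbf U)\mathfrak K_{0,t_1}'\big)-E(\mathfrak J_{0,\tau})E(\mathbf U)E(\mathfrak K_{0,t_1}')\\&+E\big(\mathfrak K_{0,\tau}E(\mathbf U')\mathfrak J_{0,t_1}'\big)-E(\mathfrak K_{0,\tau})E(\mathbf U')E(\mathfrak J_{0,t_1}')\\&+E\big(\mathfrak K_{0,\tau}\mathfrak K_{0,t_1}'\big)-E(\mathfrak K_{0,\tau})E(\mathfrak K_{0,t_1}').\end{aligned}$$ -/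

import Mathlib

open MeasureTheory ProbabilityTheory Filter Topology Set Matrix
open scoped NNReal ENNReal

namespace SSCogarch

noncomputable section

/-! ### The driving process -/

/-- A simple compound Poisson process (simple semi-Lévy process) on `(Ω, P)`, given by its
ingredients. `part 0 < part 1 < …` is the partition `0 = t₀ < t₁ < …`, whose cell lengths are
periodic in the index with period `l`; the time period is `τ = t_l`. `N` is a Poisson process with
the periodic intensity `lam`. `Z k r` is the `(k+1)`-st candidate jump size for the `(r+1)`-st
cell of the period. `D` is the deterministic periodic drift; it is continuous (the process is
stochastically continuous) and of locally bounded variation (the process is a semimartingale). -/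
structure SimpleSemiLevy {Ω : Type*} [MeasurableSpace Ω] (P : Measure Ω) where
  l : ℕ
  l_pos : 0 < l
  part : ℕ → ℝ≥0
  part_zero : part 0 = 0
  part_strictMono : StrictMono part
  part_periodic : ∀ j,
    (part (j + l + 1) : ℝ) - part (j + l) = (part (j + 1) : ℝ) - part j
  lam : ℝ → ℝ
  lam_nonneg : ∀ u, 0 ≤ u → 0 ≤ lam u
  lam_periodic : ∀ u, 0 ≤ u → lam (u + part l) = lam u
  lam_integrable : ∀ T : ℝ≥0, IntervalIntegrable lam volume 0 T
  N : ℝ≥0 → Ω → ℕ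
  N_measurable : ∀ t, Measurable (N t)
  N_zero : ∀ ω, N 0 ω = 0
  N_mono : ∀ ω, Monotone fun t => N t ω
  N_rightCont : ∀ ω t, ContinuousWithinAt (fun u => N u ω) (Ici t) t
  N_indep : HasIndepIncrements N P
  N_law : ∀ s t : ℝ≥0, s ≤ t → HasLaw (fun ω => N t ω - N s ω)
    (poissonMeasure (∫ u in (s : ℝ)..t, lam u).toNNReal) P
  F : Fin l → Measure ℝ
  F_sq : ∀ r, Integrable (fun z : ℝ => z ^ 2) (F r)
  Z : ℕ → Fin l → Ω → ℝ
  Z_measurable : ∀ k r, Measurable (Z k r)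
  Z_law : ∀ k r, HasLaw (Z k r) (F r) P
  Z_indep : iIndepFun (fun (i : ℕ × Fin l) => Z i.1 i.2) P
  Z_indep_N : IndepFun (fun ω (i : ℕ × Fin l) => Z i.1 i.2 ω) (fun ω (t : ℝ≥0) => N t ω) P
  D : ℝ≥0 → ℝ
  D_zero : D 0 = 0
  D_periodic : ∀ t, D (t + part l) = D t
  D_continuous : Continuous D
  D_boundedVariation : LocallyBoundedVariationOn D univ

namespace SimpleSemiLevy

variable {Ω : Type*} [MeasurableSpace Ω] {P : Measure Ω} (S : SimpleSemiLevy P)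

/-- The period `τ`. -/
def period : ℝ≥0 := S.part S.l

/-- The set of times that lie in a translate by a multiple of the period of the `(r+1)`-st cell
`[t_r, t_{r+1})`. -/
def cell (r : Fin S.l) : Set ℝ≥0 :=
  ⋃ k : ℕ, Ico (S.part (r + k * S.l)) (S.part (r + k * S.l + 1))

/-- The time of the `n`-th jump of `N` (meaningful when `n ≤ N t ω` for some `t`). -/
def arrival (n : ℕ) (ω : Ω) : ℝ≥0 := sInf {t | n ≤ S.N t ω}

/-- The size of the `(k+1)`-st jump: its law depends on the cell in which the jump occurs. -/
def mark (k : ℕ) (ω : Ω) : ℝ := by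
  classical
  exact ∑ r : Fin S.l, if S.arrival (k + 1) ω ∈ S.cell r then S.Z k r ω else 0

/-- The simple semi-Lévy process `S_t = D_t + ∑_{n=1}^{N(t)} Z_n`. -/
def proc (t : ℝ≥0) (ω : Ω) : ℝ := S.D t + ∑ k ∈ Finset.range (S.N t ω), S.mark k ω

/-- The jump `ΔS_t = S_t - S_{t-}`. -/
def jump (t : ℝ≥0) (ω : Ω) : ℝ :=
  S.proc t ω - Function.leftLim (fun u => S.proc u ω) t

/-- The integral `∫_{(0,t]} g_s d[S,S]_s`. The paths of `S` have locally bounded variation, hence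
`[S,S]_t = ∑_{0<s≤t} (ΔS_s)²`, and the integral is the sum over the (finitely many) jumps. -/
def bracketIntegral (g : ℝ≥0 → ℝ) (t : ℝ≥0) (ω : Ω) : ℝ :=
  ∑ᶠ s ∈ Ioc (0 : ℝ≥0) t, g s * (S.jump s ω) ^ 2

end SimpleSemiLevy

/-! ### The COGARCH(p,q) parameters -/

/-- Parameters of a COGARCH(p,q) process, `q ≥ p ≥ 1`; `α i` and `β i` stand for `α_{i+1}` and
`β_{i+1}`. -/
structure Params (p q : ℕ) where
  one_le_p : 1 ≤ p
  p_le_q : p ≤ q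
  α₀ : ℝ
  α₀_pos : 0 < α₀
  α : Fin q → ℝ
  β : Fin q → ℝ
  α_p_ne : ∀ i : Fin q, (i : ℕ) + 1 = p → α i ≠ 0
  α_eq_zero : ∀ i : Fin q, p < (i : ℕ) + 1 → α i = 0
  β_q_ne : ∀ i : Fin q, (i : ℕ) + 1 = q → β i ≠ 0

namespace Params

variable {p q : ℕ} (θ : Params p q)

/-- The companion matrix `B`, with last row `(-β_q, …, -β_1)`. -/
def B : Matrix (Fin q) (Fin q) ℝ := Matrix.of fun i j =>
  if (i : ℕ) + 1 = q then -θ.β (Fin.rev j) else if (j : ℕ) = i + 1 then 1 else 0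

/-- The last standard basis vector. -/
def e (_θ : Params p q) : Fin q → ℝ := fun i => if (i : ℕ) + 1 = q then 1 else 0

end Params

/-! ### State process and volatility -/

section StateVolatility

variable {Ω : Type*} [MeasurableSpace Ω] {P : Measure Ω} (S : SimpleSemiLevy P)
  {p q : ℕ} (θ : Params p q)

/-- Right-continuous with left limits. -/
def IsCadlagPath {E : Type*} [TopologicalSpace E] (f : ℝ≥0 → E) : Prop :=
  ∀ t, ContinuousWithinAt f (Ici t) t ∧ ∃ x, Tendsto f (𝓝[<] t) (𝓝 x)

/-- The volatility `V_t = α₀ + a' Y_{t-}` for `t > 0`, `V_0 = α₀ + a' Y_0`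
(`Function.leftLim f 0 = f 0` on `ℝ≥0`, see `volatility_zero`). -/
def volatility (Y : ℝ≥0 → Ω → Fin q → ℝ) (t : ℝ≥0) (ω : Ω) : ℝ :=
  θ.α₀ + θ.α ⬝ᵥ Function.leftLim (fun u => Y u ω) t

theorem volatility_zero {Ω : Type*} {p q : ℕ} (θ : Params p q)
    (Y : ℝ≥0 → Ω → Fin q → ℝ) (ω : Ω) :
    volatility θ Y 0 ω = θ.α₀ + θ.α ⬝ᵥ Y 0 ω := by
  have h : 𝓝[<] (0 : ℝ≥0) = ⊥ := by
    have h0 : Iio (0 : ℝ≥0) = ∅ := by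
      ext x
      simp
    rw [h0, nhdsWithin_empty]
  unfold volatility
  rw [leftLim_eq_of_eq_bot _ h]

/-- `Y` is a state process: a càdlàg solution of
`dY_t = B Y_{t-} dt + e (α₀ + a' Y_{t-}) d[S,S]_t` whose initial value is independent of the
driving process. -/
structure IsStateProcess (Y : ℝ≥0 → Ω → Fin q → ℝ) : Prop where
  measurable_zero : Measurable (Y 0)
  indep_zero : IndepFun (Y 0) (fun ω (t : ℝ≥0) => S.proc t ω) P
  cadlag : ∀ᵐ ω ∂P, IsCadlagPath fun t => Y t ω
  equation : ∀ᵐ ω ∂P, ∀ t : ℝ≥0, Y t ω = Y 0 ω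
    + (∫ s in (0 : ℝ)..t, θ.B *ᵥ Function.leftLim (fun u => Y u ω) s.toNNReal)
    + (S.bracketIntegral (fun s => θ.α₀ + θ.α ⬝ᵥ Function.leftLim (fun u => Y u ω) s) t ω) • θ.e

/-! ### The coefficients of the random recurrence equation `Y_t = J_{s,t} Y_s + K_{s,t}` -/

/-- The time `s` for `k = 0`, and the time of the `k`-th jump after `s` for `k ≥ 1`. -/
def jumpTimeAfter (s : ℝ≥0) (k : ℕ) (ω : Ω) : ℝ≥0 :=
  if k = 0 then s else S.arrival (S.N s ω + k) ω

/-- The matrix `(I + Z² e a') e^{B Δ}`, where `Z` is the size of the `(k+1)`-st jump after `s` and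
`Δ` is the time between it and the preceding jump after `s` (or `s` itself if `k = 0`). -/
def stepMatrix (s : ℝ≥0) (k : ℕ) (ω : Ω) : Matrix (Fin q) (Fin q) ℝ :=
  (1 + (S.mark (S.N s ω + k) ω) ^ 2 • vecMulVec θ.e θ.α) *
    NormedSpace.exp
      (((jumpTimeAfter S s (k + 1) ω : ℝ) - jumpTimeAfter S s k ω) • θ.B)

/-- The product of the first `k` step matrices after `s`, latest factor on the left. -/
def stepProd (s : ℝ≥0) (ω : Ω) : ℕ → Matrix (Fin q) (Fin q) ℝ
  | 0 => 1
  | k + 1 => stepMatrix S θ s k ω * stepProd s ω k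

/-- The inhomogeneous part after `k` jumps:
`R_k + Q_k R_{k-1} + ⋯ + Q_k ⋯ Q_2 R_1` with `R_i = α₀ Z_i² e`. -/
def stepSum (s : ℝ≥0) (ω : Ω) : ℕ → Fin q → ℝ
  | 0 => 0
  | k + 1 => (θ.α₀ * (S.mark (S.N s ω + k) ω) ^ 2) • θ.e
      + stepMatrix S θ s k ω *ᵥ stepSum s ω k

/-- `e^{B (t - u)}` with `u` the last jump time in `(s, t]`, or `u = s` if there is none. -/
def lastFlow (s t : ℝ≥0) (ω : Ω) : Matrix (Fin q) (Fin q) ℝ :=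
  NormedSpace.exp
    (((t : ℝ) - jumpTimeAfter S s (S.N t ω - S.N s ω) ω) • θ.B)

/-- The random matrix `J_{s,t}`, `s ≤ t`. -/
def coefJ (s t : ℝ≥0) (ω : Ω) : Matrix (Fin q) (Fin q) ℝ :=
  lastFlow S θ s t ω * stepProd S θ s ω (S.N t ω - S.N s ω)

/-- The random vector `K_{s,t}`, `s ≤ t`. -/
def coefK (s t : ℝ≥0) (ω : Ω) : Fin q → ℝ :=
  lastFlow S θ s t ω *ᵥ stepSum S θ s ω (S.N t ω - S.N s ω)

/-- `μ` is the law of a random vector `U` with `U =ᵈ J_{0,τ} U + K_{0,τ}`, where on the right `U`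
is independent of `(J_{0,τ}, K_{0,τ})`. -/
def IsRecurrenceLaw (μ : Measure (Fin q → ℝ)) : Prop :=
  HasLaw (fun x : (Fin q → ℝ) × Ω => coefJ S θ 0 S.period x.2 *ᵥ x.1 + coefK S θ 0 S.period x.2) μ
    (μ.prod P)

end StateVolatility

/-! ### Moments of random vectors and matrices -/

section Moments

variable {Ω : Type*} [MeasurableSpace Ω] (P : Measure Ω) {q : ℕ}

/-- The mean vector `E(X)`. -/
def meanVec (X : Ω → Fin q → ℝ) : Fin q → ℝ := fun i => ∫ ω, X ω i ∂P

/-- The mean matrix `E(M)`. -/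
def meanMat (M : Ω → Matrix (Fin q) (Fin q) ℝ) : Matrix (Fin q) (Fin q) ℝ :=
  Matrix.of fun i j => ∫ ω, M ω i j ∂P

/-- The covariance matrix `cov(X, X')` of two random vectors. -/
def covMat (X X' : Ω → Fin q → ℝ) : Matrix (Fin q) (Fin q) ℝ :=
  Matrix.of fun i j => covariance (fun ω => X ω i) (fun ω => X' ω j) P

end Moments

section Explicit

variable {Ω : Type*} [MeasurableSpace Ω] {P : Measure Ω} (S : SimpleSemiLevy P)
  {p q : ℕ} (θ : Params p q)

/-- The matrix
`E(J_τ E(UU') J_s') - E(J_τ) E(U) E(U') E(J_s') + E(J_τ E(U) K_s') - E(J_τ) E(U) E(K_s')`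
`+ E(K_τ E(U') J_s') - E(K_τ) E(U') E(J_s') + E(K_τ K_s') - E(K_τ) E(K_s')`,
where `J_s = J_{0,s}`, `K_s = K_{0,s}` and `U` has law `μ`. -/
def oneperiodCov (μ : Measure (Fin q → ℝ)) (s : ℝ≥0) : Matrix (Fin q) (Fin q) ℝ :=
  let τ := S.period
  let EU : Fin q → ℝ := meanVec μ id
  let EUU : Matrix (Fin q) (Fin q) ℝ := meanMat μ fun u => vecMulVec u u
  let EJτ := meanMat P (coefJ S θ 0 τ)
  let EJs := meanMat P (coefJ S θ 0 s)
  let EKτ := meanVec P (coefK S θ 0 τ)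
  let EKs := meanVec P (coefK S θ 0 s)
  meanMat P (fun ω => coefJ S θ 0 τ ω * EUU * (coefJ S θ 0 s ω)ᵀ)
    - EJτ * vecMulVec EU EU * EJsᵀ
    + meanMat P (fun ω => coefJ S θ 0 τ ω * vecMulVec EU (coefK S θ 0 s ω))
    - EJτ * vecMulVec EU EKs
    + meanMat P (fun ω => vecMulVec (coefK S θ 0 τ ω) EU * (coefJ S θ 0 s ω)ᵀ)
    - vecMulVec EKτ EU * EJsᵀ
    + meanMat P (fun ω => vecMulVec (coefK S θ 0 τ ω) (coefK S θ 0 s ω))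
    - vecMulVec EKτ EKs

end Explicit

end

end SSCogarch

open SSCogarch

namespace SSCogarch

noncomputable section

/-! ### Arrival times -/

section Arrival

variable {Ω : Type*} [MeasurableSpace Ω] {P : Measure Ω} (S : SimpleSemiLevy P)

namespace SimpleSemiLevy

theorem arrival_le_of_le {n : ℕ} {t : ℝ≥0} {ω : Ω} (h : n ≤ S.N t ω) : S.arrival n ω ≤ t :=
  csInf_le (OrderBot.bddBelow _) h

theorem N_lt_of_lt_arrival {n : ℕ} {t : ℝ≥0} {ω : Ω} (h : t < S.arrival n ω) : S.N t ω < n := by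
  by_contra hc
  exact absurd (S.arrival_le_of_le (not_lt.1 hc)) (not_le.2 h)

theorem eventually_N_eq (t : ℝ≥0) (ω : Ω) : ∀ᶠ u in 𝓝[≥] t, S.N u ω = S.N t ω := by
  have h := S.N_rightCont ω t
  have := h.eventually (IsOpen.mem_nhds (isOpen_discrete {S.N t ω}) rfl)
  exact this

theorem le_N_arrival {n : ℕ} {t : ℝ≥0} {ω : Ω} (h : n ≤ S.N t ω) :
    n ≤ S.N (S.arrival n ω) ω := by
  set a := S.arrival n ω with ha
  have hev := S.eventually_N_eq a ω
  obtain ⟨b, hab, hb⟩ := (mem_nhdsGE_iff_exists_Ico_subset).1 hev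
  have hne : {t | n ≤ S.N t ω}.Nonempty := ⟨t, h⟩
  obtain ⟨u, hu, hub⟩ := exists_lt_of_csInf_lt hne (show sInf {t | n ≤ S.N t ω} < b from hab)
  have hau : a ≤ u := S.arrival_le_of_le hu
  have : S.N u ω = S.N a ω := hb ⟨hau, hub⟩
  rw [← this]
  exact hu

theorem arrival_le_iff {n : ℕ} {t T : ℝ≥0} {ω : Ω} (h : n ≤ S.N T ω) :
    S.arrival n ω ≤ t ↔ n ≤ S.N t ω :=
  ⟨fun ht => (S.le_N_arrival h).trans (S.N_mono ω ht), S.arrival_le_of_le⟩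

theorem arrival_zero (ω : Ω) : S.arrival 0 ω = 0 :=
  le_antisymm (S.arrival_le_of_le (by simp)) zero_le

theorem arrival_mono {m n : ℕ} {t : ℝ≥0} {ω : Ω} (hmn : m ≤ n) (h : n ≤ S.N t ω) :
    S.arrival m ω ≤ S.arrival n ω :=
  (S.arrival_le_iff (hmn.trans h)).2 (hmn.trans (S.le_N_arrival h))

theorem arrival_pos {n : ℕ} {t : ℝ≥0} {ω : Ω} (hn : 0 < n) (h : n ≤ S.N t ω) :
    0 < S.arrival n ω := by
  by_contra hc
  have h0 : S.arrival n ω = 0 := le_antisymm (not_lt.1 hc) zero_le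
  have := S.le_N_arrival h
  rw [h0, S.N_zero] at this
  omega

/-- All jumps of the counting process have size one. -/
def SimpleJumps (ω : Ω) : Prop :=
  ∀ (n : ℕ) (t : ℝ≥0), n + 2 ≤ S.N t ω → S.arrival (n + 1) ω < S.arrival (n + 2) ω

variable {S}

theorem SimpleJumps.N_arrival {n : ℕ} {t : ℝ≥0} {ω : Ω} (hω : S.SimpleJumps ω)
    (h : n ≤ S.N t ω) : S.N (S.arrival n ω) ω = n := by
  refine le_antisymm ?_ (S.le_N_arrival h)
  rcases n with _ | n
  · rw [S.arrival_zero, S.N_zero]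
  · by_contra hc
    have h2 : n + 2 ≤ S.N (S.arrival (n + 1) ω) ω := by omega
    exact absurd (hω n _ h2) (not_lt.2 (S.arrival_le_of_le h2))

end SimpleSemiLevy

end Arrival

/-! ### The affine flow -/

section Flow

variable {Ω : Type*} [MeasurableSpace Ω] {P : Measure Ω} (S : SimpleSemiLevy P)
  {p q : ℕ} (θ : Params p q)

/-- The effect of a jump of size `z` of the driving process on the state `y`. -/
def jumpMap (z : ℝ) (y : Fin q → ℝ) : Fin q → ℝ :=
  y + (z ^ 2 * (θ.α₀ + θ.α ⬝ᵥ y)) • θ.e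

/-- The state after `k` jumps after time `s`, started in `y` at time `s`. -/
def stateAfter (s : ℝ≥0) (ω : Ω) (k : ℕ) (y : Fin q → ℝ) : Fin q → ℝ :=
  stepProd S θ s ω k *ᵥ y + stepSum S θ s ω k

/-- The solution at time `t` of the state equation started in `y` at time `s`. -/
def flow (s t : ℝ≥0) (ω : Ω) (y : Fin q → ℝ) : Fin q → ℝ :=
  coefJ S θ s t ω *ᵥ y + coefK S θ s t ω

theorem stateAfter_zero (s : ℝ≥0) (ω : Ω) (y : Fin q → ℝ) : stateAfter S θ s ω 0 y = y := by
  simp [stateAfter, stepProd, stepSum]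

theorem stepMatrix_mulVec (s : ℝ≥0) (k : ℕ) (ω : Ω) (y : Fin q → ℝ) :
    (θ.α₀ * (S.mark (S.N s ω + k) ω) ^ 2) • θ.e + stepMatrix S θ s k ω *ᵥ y =
      jumpMap θ (S.mark (S.N s ω + k) ω) (NormedSpace.exp
      (((jumpTimeAfter S s (k + 1) ω : ℝ) - jumpTimeAfter S s k ω) • θ.B) *ᵥ y) := by
  rw [stepMatrix, ← mulVec_mulVec, add_mulVec, one_mulVec, smul_mulVec, vecMulVec_mulVec, jumpMap]
  ext i
  simp
  ring

theorem stateAfter_succ (s : ℝ≥0) (ω : Ω) (k : ℕ) (y : Fin q → ℝ) :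
    stateAfter S θ s ω (k + 1) y = jumpMap θ (S.mark (S.N s ω + k) ω) (NormedSpace.exp
      (((jumpTimeAfter S s (k + 1) ω : ℝ) - jumpTimeAfter S s k ω) • θ.B) *ᵥ
        stateAfter S θ s ω k y) := by
  rw [← stepMatrix_mulVec, stateAfter, stateAfter, stepProd, stepSum, mulVec_add, mulVec_mulVec]
  abel

theorem flow_eq (s t : ℝ≥0) (ω : Ω) (y : Fin q → ℝ) :
    flow S θ s t ω y = NormedSpace.exp
      (((t : ℝ) - jumpTimeAfter S s (S.N t ω - S.N s ω) ω) • θ.B) *ᵥ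
        stateAfter S θ s ω (S.N t ω - S.N s ω) y := by
  rw [flow, coefJ, coefK, stateAfter, mulVec_add, mulVec_mulVec, lastFlow]

theorem exp_smul_mul_exp_smul (B : Matrix (Fin q) (Fin q) ℝ) (a b : ℝ) :
    NormedSpace.exp (a • B) * NormedSpace.exp (b • B) = NormedSpace.exp ((a + b) • B) := by
  rw [add_smul, Matrix.exp_add_of_commute]
  exact ((Commute.refl B).smul_left a).smul_right b

theorem exp_smul_mulVec_exp_smul_mulVec (B : Matrix (Fin q) (Fin q) ℝ) (a b : ℝ)
    (y : Fin q → ℝ) :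
    NormedSpace.exp (a • B) *ᵥ (NormedSpace.exp (b • B) *ᵥ y) =
      NormedSpace.exp ((a + b) • B) *ᵥ y := by
  rw [mulVec_mulVec, exp_smul_mul_exp_smul]

theorem flow_of_N_eq {s t : ℝ≥0} {ω : Ω} (h : S.N t ω = S.N s ω) (y : Fin q → ℝ) :
    flow S θ s t ω y = NormedSpace.exp (((t : ℝ) - s) • θ.B) *ᵥ y := by
  rw [flow_eq, h, Nat.sub_self, stateAfter_zero]
  simp [jumpTimeAfter]

theorem exp_mulVec_stateAfter_flow {s t : ℝ≥0} (hst : s ≤ t) (ω : Ω) (y : Fin q → ℝ) (k : ℕ) :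
    ∀ x : ℝ, NormedSpace.exp ((x - jumpTimeAfter S t k ω) • θ.B) *ᵥ
      stateAfter S θ t ω k (flow S θ s t ω y) =
      NormedSpace.exp ((x - jumpTimeAfter S s (S.N t ω - S.N s ω + k) ω) • θ.B) *ᵥ
        stateAfter S θ s ω (S.N t ω - S.N s ω + k) y := by
  have hN : S.N s ω ≤ S.N t ω := S.N_mono ω hst
  induction k with
  | zero =>
    intro x
    rw [stateAfter_zero, flow_eq, exp_smul_mulVec_exp_smul_mulVec]
    simp [jumpTimeAfter]
  | succ k ih =>
    intro x
    have hT : jumpTimeAfter S s (S.N t ω - S.N s ω + (k + 1)) ω = jumpTimeAfter S t (k + 1) ω := by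
      simp only [jumpTimeAfter]
      rw [if_neg (by omega), if_neg (by omega)]
      congr 1
      omega
    have hm : S.N s ω + (S.N t ω - S.N s ω + k) = S.N t ω + k := by omega
    rw [stateAfter_succ, ih, ← hT, ← add_assoc, stateAfter_succ, hm]

theorem flow_flow {s t u : ℝ≥0} (hst : s ≤ t) (htu : t ≤ u) (ω : Ω) (y : Fin q → ℝ) :
    flow S θ t u ω (flow S θ s t ω y) = flow S θ s u ω y := by
  have h1 : S.N s ω ≤ S.N t ω := S.N_mono ω hst
  have h2 : S.N t ω ≤ S.N u ω := S.N_mono ω htu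
  have hm : S.N t ω - S.N s ω + (S.N u ω - S.N t ω) = S.N u ω - S.N s ω := by omega
  rw [flow_eq S θ t u, exp_mulVec_stateAfter_flow S θ hst, flow_eq S θ s u, hm]

theorem flow_arrival {s a : ℝ≥0} {ω : Ω} (ha : a = S.arrival (S.N s ω + 1) ω)
    (h : S.N a ω = S.N s ω + 1) (y : Fin q → ℝ) :
    flow S θ s a ω y =
      jumpMap θ (S.mark (S.N s ω) ω) (NormedSpace.exp (((a : ℝ) - s) • θ.B) *ᵥ y) := by
  rw [flow_eq, h, Nat.add_sub_cancel_left, stateAfter_succ, stateAfter_zero]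
  simp [jumpTimeAfter, ← ha]

end Flow

/-! ### Càdlàg paths -/

section Cadlag

variable {E : Type*} [NormedAddCommGroup E]

theorem IsCadlagPath.tendsto_leftLim {f : ℝ≥0 → E} (hf : IsCadlagPath f) (t : ℝ≥0) :
    Tendsto f (𝓝[<] t) (𝓝 (Function.leftLim f t)) :=
  tendsto_leftLim_of_tendsto (hf t).2

theorem IsCadlagPath.exists_bound {f : ℝ≥0 → E} (hf : IsCadlagPath f) (T : ℝ≥0) :
    ∃ C, ∀ t ≤ T, ‖f t‖ ≤ C := by
  have h : ∃ C, ∀ t ∈ Icc 0 T, ‖f t‖ ≤ C := by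
    refine isCompact_Icc.induction_on (p := fun s => ∃ C, ∀ t ∈ s, ‖f t‖ ≤ C) ⟨0, by simp⟩
      ?_ ?_ ?_
    · rintro s t hst ⟨C, hC⟩
      exact ⟨C, fun u hu => hC u (hst hu)⟩
    · rintro s t ⟨C, hC⟩ ⟨C', hC'⟩
      refine ⟨max C C', fun u hu => ?_⟩
      rcases hu with hu | hu
      · exact (hC u hu).trans (le_max_left _ _)
      · exact (hC' u hu).trans (le_max_right _ _)
    · intro t _
      have h1 : ∀ᶠ u in 𝓝[≥] t, ‖f u‖ < ‖f t‖ + 1 :=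
        (hf t).1.norm.eventually (Iio_mem_nhds (by linarith))
      have h2 : ∀ᶠ u in 𝓝[<] t, ‖f u‖ < ‖Function.leftLim f t‖ + 1 :=
        (hf.tendsto_leftLim t).norm.eventually (Iio_mem_nhds (by linarith))
      refine ⟨{u | ‖f u‖ ≤ max (‖f t‖ + 1) (‖Function.leftLim f t‖ + 1)}, ?_,
        _, fun u hu => hu⟩
      refine mem_nhdsWithin_of_mem_nhds ?_
      rw [← nhdsLT_sup_nhdsGE, mem_sup]
      constructor
      · filter_upwards [h2] with u hu using hu.le.trans (le_max_right _ _)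
      · filter_upwards [h1] with u hu using hu.le.trans (le_max_left _ _)
  obtain ⟨C, hC⟩ := h
  exact ⟨C, fun t ht => hC t ⟨zero_le, ht⟩⟩

theorem norm_leftLim_le {f : ℝ≥0 → E} (hf : IsCadlagPath f) {T : ℝ≥0} {C : ℝ}
    (hC : ∀ t ≤ T, ‖f t‖ ≤ C) {t : ℝ≥0} (ht : t ≤ T) : ‖Function.leftLim f t‖ ≤ C := by
  rcases eq_or_neBot (𝓝[<] t) with h | h
  · rw [leftLim_eq_of_eq_bot f h]
    exact hC t ht
  · refine le_of_tendsto (hf.tendsto_leftLim t).norm ?_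
    filter_upwards [self_mem_nhdsWithin] with u hu
    exact hC u (le_of_lt (lt_of_lt_of_le hu ht))

variable [MeasurableSpace E] [BorelSpace E]

theorem measurable_of_continuousWithinAt_Iic {g : ℝ≥0 → E}
    (hg : ∀ t, ContinuousWithinAt g (Iic t) t) : Measurable g := by
  let a : ℕ → ℝ≥0 → ℝ≥0 := fun n t => ((⌈t * (n + 1)⌉₊ - 1 : ℕ) : ℝ≥0) / (n + 1)
  have ha : ∀ n, Measurable fun t => g (a n t) := by
    intro n
    have : (fun t => g (a n t)) = (fun m : ℕ => g (((m - 1 : ℕ) : ℝ≥0) / (n + 1))) ∘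
        fun t : ℝ≥0 => ⌈t * (n + 1)⌉₊ := rfl
    rw [this]
    exact (measurable_of_countable _).comp (Nat.measurable_ceil.comp (by fun_prop))
  refine measurable_of_tendsto_metrizable ha (tendsto_pi_nhds.2 fun t => ?_)
  have hle : ∀ n, a n t ≤ t := by
    intro n
    have hpos : (0 : ℝ≥0) < n + 1 := by positivity
    rw [div_le_iff₀ hpos]
    rcases Nat.eq_zero_or_pos ⌈t * ((n : ℝ≥0) + 1)⌉₊ with h | h
    · rw [h]
      simp
    · have := Nat.ceil_lt_add_one (a := t * ((n : ℝ≥0) + 1)) zero_le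
      have h1 : ((⌈t * ((n : ℝ≥0) + 1)⌉₊ - 1 : ℕ) : ℝ≥0) + 1 = (⌈t * ((n : ℝ≥0) + 1)⌉₊ : ℝ≥0) := by
        exact_mod_cast Nat.sub_add_cancel h
      rw [← h1] at this
      exact le_of_lt (lt_of_add_lt_add_right this)
  have hlim : Tendsto (fun n => a n t) atTop (𝓝 t) := by
    rw [← NNReal.tendsto_coe]
    have hl : Tendsto (fun n : ℕ => (t : ℝ) - 1 / ((n : ℝ) + 1)) atTop (𝓝 (t : ℝ)) := by
      simpa using (tendsto_const_nhds (x := (t : ℝ))).sub tendsto_one_div_add_atTop_nhds_zero_nat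
    refine tendsto_of_tendsto_of_tendsto_of_le_of_le hl tendsto_const_nhds ?_ ?_
    · intro n
      have hpos : (0 : ℝ) < n + 1 := by positivity
      have h1 : (t : ℝ) * (n + 1) ≤ (⌈t * ((n : ℝ≥0) + 1)⌉₊ : ℝ) := by
        have := Nat.le_ceil (t * ((n : ℝ≥0) + 1))
        exact_mod_cast this
      have h2 : (⌈t * ((n : ℝ≥0) + 1)⌉₊ : ℝ) - 1 ≤ ((⌈t * ((n : ℝ≥0) + 1)⌉₊ - 1 : ℕ) : ℝ) := by
        rw [sub_le_iff_le_add]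
        exact_mod_cast Nat.le_add_of_sub_le le_rfl
      simp only [a, NNReal.coe_div, NNReal.coe_add, NNReal.coe_natCast, NNReal.coe_one]
      rw [sub_le_iff_le_add, ← add_div, le_div_iff₀ hpos]
      linarith
    · intro n
      exact_mod_cast hle n
  exact (hg t).tendsto.comp (tendsto_nhdsWithin_iff.2 ⟨hlim, Eventually.of_forall hle⟩)

theorem IsCadlagPath.measurable_leftLim {f : ℝ≥0 → E} (hf : IsCadlagPath f) :
    Measurable (Function.leftLim f) :=
  measurable_of_continuousWithinAt_Iic fun t =>
    continuousWithinAt_leftLim_Iic (hf.tendsto_leftLim t)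

end Cadlag

section Ode

attribute [local instance] Matrix.linftyOpNormedRing Matrix.linftyOpNormedAlgebra

variable {q : ℕ} (B : Matrix (Fin q) (Fin q) ℝ)

theorem continuous_mulVec_const : Continuous fun y : Fin q → ℝ => B *ᵥ y := by fun_prop

theorem IsCadlagPath.intervalIntegrable_mulVec_leftLim {f : ℝ≥0 → Fin q → ℝ}
    (hf : IsCadlagPath f) (a b : ℝ) :
    IntervalIntegrable (fun s : ℝ => B *ᵥ Function.leftLim f s.toNNReal) volume a b := by
  obtain ⟨C, hC⟩ := hf.exists_bound (max a b).toNNReal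
  have hm : Measurable fun s : ℝ => B *ᵥ Function.leftLim f s.toNNReal :=
    (continuous_mulVec_const B).measurable.comp (hf.measurable_leftLim.comp measurable_real_toNNReal)
  rw [intervalIntegrable_iff]
  refine Measure.integrableOn_of_bounded (M := ‖B‖ * C) (by simp) hm.aestronglyMeasurable ?_
  rw [ae_restrict_iff' measurableSet_uIoc]
  refine Eventually.of_forall fun s hs => ?_
  have hs' : s.toNNReal ≤ (max a b).toNNReal := Real.toNNReal_le_toNNReal hs.2
  exact (Matrix.linfty_opNorm_mulVec _ _).trans
    (mul_le_mul_of_nonneg_left (norm_leftLim_le hf hC hs') (norm_nonneg _))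

theorem hasDerivAt_exp_smul_mulVec (y₀ : Fin q → ℝ) (a t : ℝ) :
    HasDerivAt (fun t : ℝ => NormedSpace.exp ((t - a) • B) *ᵥ y₀)
      (B *ᵥ (NormedSpace.exp ((t - a) • B) *ᵥ y₀)) t := by
  have h := (hasDerivAt_exp_smul_const' (𝕂 := ℝ) B (t - a)).comp_sub_const t a
  let L : Matrix (Fin q) (Fin q) ℝ →ₗ[ℝ] (Fin q → ℝ) :=
    { toFun := fun M => M *ᵥ y₀
      map_add' := fun M N => add_mulVec M N y₀
      map_smul' := fun c M => smul_mulVec c M y₀ }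
  have := (LinearMap.toContinuousLinearMap L).hasFDerivAt.comp_hasDerivAt t h
  rw [mulVec_mulVec]
  exact this

theorem eq_exp_mulVec_of_integral_eq {y : ℝ → Fin q → ℝ} (hy : Continuous y) {a b : ℝ}
    (y₀ : Fin q → ℝ) (h : ∀ t ∈ Icc a b, y t = y₀ + ∫ s in a..t, B *ᵥ y s) {t : ℝ}
    (ht : t ∈ Icc a b) : y t = NormedSpace.exp ((t - a) • B) *ᵥ y₀ := by
  have hcont : Continuous fun s => B *ᵥ y s := (continuous_mulVec_const B).comp hy
  have hLip : LipschitzWith ‖B‖₊ fun z : Fin q → ℝ => B *ᵥ z := by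
    refine LipschitzWith.of_dist_le_mul fun z w => ?_
    rw [dist_eq_norm, dist_eq_norm, ← mulVec_sub]
    exact Matrix.linfty_opNorm_mulVec _ _
  refine ODE_solution_unique_of_mem_Icc_right (v := fun _ z => B *ᵥ z) (s := fun _ => univ)
    (K := ‖B‖₊) (fun _ _ => hLip.lipschitzOnWith) hy.continuousOn ?_ (fun _ _ => mem_univ _) ?_
    (fun t _ => (hasDerivAt_exp_smul_mulVec B y₀ a t).hasDerivWithinAt) (fun _ _ => mem_univ _) ?_ ht
  · intro t ht
    have hd : HasDerivAt (fun u => y₀ + ∫ s in a..u, B *ᵥ y s) (B *ᵥ y t) t :=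
      (intervalIntegral.integral_hasDerivAt_right (hcont.intervalIntegrable _ _)
        (hcont.stronglyMeasurableAtFilter _ _) hcont.continuousAt).const_add y₀
    refine hd.hasDerivWithinAt.congr_of_eventuallyEq ?_ (h t ⟨ht.1, ht.2.le⟩)
    filter_upwards [Ico_mem_nhdsGE ht.2] with u hu
    exact h u ⟨ht.1.trans hu.1, hu.2.le⟩
  · exact fun t _ => (hasDerivAt_exp_smul_mulVec B y₀ a t).continuousAt.continuousWithinAt
  · rw [h a ⟨le_rfl, ht.1.trans ht.2⟩]
    simp

variable {B}

theorem IsCadlagPath.eq_exp_of_integral_eq {f : ℝ≥0 → Fin q → ℝ} (hf : IsCadlagPath f)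
    {u v : ℝ≥0} (huv : u < v)
    (h : ∀ t ∈ Ico u v, f t = f u + ∫ s in (u : ℝ)..t, B *ᵥ Function.leftLim f s.toNNReal) :
    (∀ t ∈ Ico u v, f t = NormedSpace.exp (((t : ℝ) - u) • B) *ᵥ f u) ∧
      Function.leftLim f v = NormedSpace.exp (((v : ℝ) - u) • B) *ᵥ f u := by
  let y : ℝ → Fin q → ℝ := fun t => f u + ∫ s in (u : ℝ)..t, B *ᵥ Function.leftLim f s.toNNReal
  have hyc : Continuous y := continuous_const.add
    (intervalIntegral.continuous_primitive (hf.intervalIntegrable_mulVec_leftLim B) _)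
  have hleft : ∀ s ∈ Ioc u v, Function.leftLim f s = y s := by
    intro s hs
    have hne : (𝓝[<] s).NeBot := mem_closure_iff_nhdsWithin_neBot.1
      (by rw [closure_Iio' ⟨u, hs.1⟩]; exact mem_Iic.2 le_rfl)
    refine leftLim_eq_of_tendsto ?_
    have h1 : Tendsto (fun r : ℝ≥0 => y r) (𝓝[<] s) (𝓝 (y s)) :=
      ((hyc.comp NNReal.continuous_coe).tendsto s).mono_left nhdsWithin_le_nhds
    refine h1.congr' ?_
    filter_upwards [Ioo_mem_nhdsLT hs.1] with r hr
    exact (h r ⟨hr.1.le, hr.2.trans_le hs.2⟩).symm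
  have hy : ∀ t ∈ Icc (u : ℝ) v, y t = f u + ∫ s in (u : ℝ)..t, B *ᵥ y s := by
    intro t ht
    simp only [y]
    congr 1
    refine intervalIntegral.integral_congr_ae (Eventually.of_forall fun s hs => ?_)
    rw [uIoc_of_le ht.1] at hs
    have hs0 : 0 ≤ s := u.2.trans hs.1.le
    have hs' : s.toNNReal ∈ Ioc u v := by
      constructor
      · rw [← NNReal.coe_lt_coe, Real.coe_toNNReal _ hs0]; exact hs.1
      · rw [← NNReal.coe_le_coe, Real.coe_toNNReal _ hs0]; exact hs.2.trans ht.2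
    rw [hleft _ hs', Real.coe_toNNReal _ hs0]
  have key : ∀ t : ℝ≥0, t ∈ Icc u v → y t = NormedSpace.exp (((t : ℝ) - u) • B) *ᵥ f u :=
    fun t ht => eq_exp_mulVec_of_integral_eq B hyc (f u) hy ⟨ht.1, ht.2⟩
  refine ⟨fun t ht => ?_, ?_⟩
  · rw [h t ht]
    exact key t ⟨ht.1, ht.2.le⟩
  · rw [hleft v ⟨huv, le_rfl⟩]
    exact key v ⟨huv.le, le_rfl⟩

end Ode

/-! ### The jumps of the driving process -/

section Jumps

variable {Ω : Type*} [MeasurableSpace Ω] {P : Measure Ω} {S : SimpleSemiLevy P}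
  {p q : ℕ} {θ : Params p q}

namespace SimpleSemiLevy

theorem nhdsLT_neBot {s : ℝ≥0} (hs : 0 < s) : (𝓝[<] s).NeBot :=
  mem_closure_iff_nhdsWithin_neBot.1
    (by rw [closure_Iio' (⟨0, hs⟩ : (Iio s).Nonempty)]; exact mem_Iic.2 le_rfl)

theorem leftLim_proc {s : ℝ≥0} (hs : 0 < s) {ω : Ω} {m : ℕ}
    (h : ∀ᶠ u in 𝓝[<] s, S.N u ω = m) :
    Function.leftLim (fun u => S.proc u ω) s = S.D s + ∑ k ∈ Finset.range m, S.mark k ω := by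
  have := nhdsLT_neBot hs
  refine leftLim_eq_of_tendsto ?_
  have h1 : Tendsto (fun u => S.D u + ∑ k ∈ Finset.range m, S.mark k ω) (𝓝[<] s)
      (𝓝 (S.D s + ∑ k ∈ Finset.range m, S.mark k ω)) :=
    ((S.D_continuous.tendsto s).mono_left nhdsWithin_le_nhds).add_const _
  refine h1.congr' ?_
  filter_upwards [h] with u hu
  rw [proc, hu]

theorem SimpleJumps.eventually_N_eq_of_arrival {ω : Ω} (hω : S.SimpleJumps ω) {k : ℕ} {t : ℝ≥0}
    (h : k + 1 ≤ S.N t ω) : ∀ᶠ u in 𝓝[<] (S.arrival (k + 1) ω), S.N u ω = k := by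
  have hlt : S.arrival k ω < S.arrival (k + 1) ω := by
    rcases k with _ | k
    · rw [S.arrival_zero]
      exact S.arrival_pos (by omega) h
    · exact hω k t h
  filter_upwards [Ioo_mem_nhdsLT hlt] with u hu
  have h1 := S.N_lt_of_lt_arrival hu.2
  have h2 : k ≤ S.N u ω := (S.arrival_le_iff (by omega : k ≤ S.N t ω)).1 hu.1.le
  omega

theorem SimpleJumps.jump_arrival {ω : Ω} (hω : S.SimpleJumps ω) {k : ℕ} {t : ℝ≥0}
    (h : k + 1 ≤ S.N t ω) : S.jump (S.arrival (k + 1) ω) ω = S.mark k ω := by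
  rw [jump, leftLim_proc (S.arrival_pos (by omega) h) (hω.eventually_N_eq_of_arrival h), proc,
    hω.N_arrival h, Finset.sum_range_succ]
  ring

theorem eventually_N_eq_of_not_arrival {ω : Ω} {s : ℝ≥0}
    (hs : S.arrival (S.N s ω) ω ≠ s) : ∀ᶠ u in 𝓝[<] s, S.N u ω = S.N s ω := by
  have hlt : S.arrival (S.N s ω) ω < s := lt_of_le_of_ne (S.arrival_le_of_le le_rfl) hs
  filter_upwards [Ioo_mem_nhdsLT hlt] with u hu
  exact le_antisymm (S.N_mono ω hu.2.le) ((S.arrival_le_iff le_rfl).1 hu.1.le)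

theorem jump_eq_zero_of_not_arrival {ω : Ω} {s : ℝ≥0} (hs0 : 0 < s)
    (hs : S.arrival (S.N s ω) ω ≠ s) : S.jump s ω = 0 := by
  rw [jump, leftLim_proc hs0 (eventually_N_eq_of_not_arrival hs), proc]
  ring

theorem SimpleJumps.arrival_injOn {ω : Ω} (hω : S.SimpleJumps ω) (t : ℝ≥0) :
    InjOn (fun k => S.arrival (k + 1) ω) (Finset.range (S.N t ω) : Set ℕ) := by
  intro i hi j hj hij
  have hi' : i + 1 ≤ S.N t ω := by simpa using hi
  have hj' : j + 1 ≤ S.N t ω := by simpa using hj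
  have h1 := hω.N_arrival hi'
  have h2 := hω.N_arrival hj'
  simp only at hij
  rw [hij] at h1
  omega

theorem SimpleJumps.bracketIntegral_eq {ω : Ω} (hω : S.SimpleJumps ω) (g : ℝ≥0 → ℝ) (t : ℝ≥0) :
    S.bracketIntegral g t ω =
      ∑ k ∈ Finset.range (S.N t ω), g (S.arrival (k + 1) ω) * (S.mark k ω) ^ 2 := by
  classical
  rw [bracketIntegral]
  rw [finsum_mem_eq_sum_of_inter_support_eq (t := (Finset.range (S.N t ω)).image
    fun k => S.arrival (k + 1) ω), Finset.sum_image (by exact_mod_cast hω.arrival_injOn t)]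
  · refine Finset.sum_congr rfl fun k hk => ?_
    rw [hω.jump_arrival (Finset.mem_range.1 hk)]
  · ext s
    simp only [mem_inter_iff, mem_Ioc, Function.mem_support, Finset.coe_image, mem_image,
      Finset.mem_coe, Finset.mem_range, and_congr_left_iff]
    intro hne
    constructor
    · rintro ⟨hs0, hst⟩
      have harr : S.arrival (S.N s ω) ω = s := by
        by_contra hc
        exact hne (by rw [jump_eq_zero_of_not_arrival hs0 hc]; simp)
      have hpos : 0 < S.N s ω := by
        rcases Nat.eq_zero_or_pos (S.N s ω) with h | h
        · rw [h, S.arrival_zero] at harr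
          exact absurd harr hs0.ne
        · exact h
      have hmono := S.N_mono ω hst
      refine ⟨S.N s ω - 1, ?_, ?_⟩
      · simp only at hmono
        omega
      · rw [Nat.sub_add_cancel hpos, harr]
    · rintro ⟨k, hk, rfl⟩
      exact ⟨S.arrival_pos (by omega) hk, S.arrival_le_of_le hk⟩

end SimpleSemiLevy

/-- A càdlàg path solves the state equation only if it is transported by the flow. -/
theorem eq_flow_of_equation {ω : Ω} (hω : S.SimpleJumps ω) {f : ℝ≥0 → Fin q → ℝ}
    (hf : IsCadlagPath f)
    (heq : ∀ t : ℝ≥0, f t = f 0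
      + (∫ s in (0 : ℝ)..t, θ.B *ᵥ Function.leftLim f s.toNNReal)
      + (S.bracketIntegral (fun s => θ.α₀ + θ.α ⬝ᵥ Function.leftLim f s) t ω) • θ.e)
    (t : ℝ≥0) : f t = flow S θ 0 t ω (f 0) := by
  simp only [hω.bracketIntegral_eq] at heq
  have hint := hf.intervalIntegrable_mulVec_leftLim θ.B
  -- on an interval without jumps
  have hconst : ∀ {u t : ℝ≥0}, u ≤ t → S.N t ω = S.N u ω →
      f t = f u + ∫ s in (u : ℝ)..t, θ.B *ᵥ Function.leftLim f s.toNNReal := by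
    intro u t hut hN
    rw [heq t, heq u, hN, ← intervalIntegral.integral_add_adjacent_intervals (hint 0 u) (hint u t)]
    abel
  have hcont : ∀ {u t : ℝ≥0}, u ≤ t → S.N t ω = S.N u ω → f t = flow S θ u t ω (f u) := by
    intro u t hut hN
    rw [flow_of_N_eq S θ hN]
    have hev := S.eventually_N_eq t ω
    obtain ⟨b, hb, hbs⟩ := mem_nhdsGE_iff_exists_Ico_subset.1 hev
    have hb : t < b := hb
    refine (hf.eq_exp_of_integral_eq (hut.trans_lt hb) ?_).1 t ⟨hut, hb⟩
    intro r hr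
    refine hconst hr.1 (le_antisymm ?_ (S.N_mono ω hr.1))
    rcases le_total r t with h | h
    · exact (S.N_mono ω h).trans hN.le
    · exact (hbs ⟨h, hr.2⟩ : S.N r ω = S.N t ω).trans hN |>.le
  -- over a jump
  have hjump : ∀ k, k + 1 ≤ S.N t ω →
      f (S.arrival k ω) = flow S θ 0 (S.arrival k ω) ω (f 0) →
      f (S.arrival (k + 1) ω) = flow S θ 0 (S.arrival (k + 1) ω) ω (f 0) := by
    intro k hk ih
    set u := S.arrival k ω with hu
    set v := S.arrival (k + 1) ω with hv
    have hNu : S.N u ω = k := hω.N_arrival (by omega : k ≤ S.N t ω)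
    have hNv : S.N v ω = k + 1 := hω.N_arrival hk
    have huv : u < v := by
      by_contra hc
      have := S.N_mono ω (not_lt.1 hc)
      simp only at this
      omega
    have hin : ∀ r ∈ Ico u v, S.N r ω = S.N u ω := by
      intro r hr
      have h1 := S.N_mono ω hr.1
      have h2 := S.N_lt_of_lt_arrival hr.2
      simp only at h1
      omega
    have hlim := (hf.eq_exp_of_integral_eq huv fun r hr => hconst hr.1 (hin r hr)).2
    rw [← flow_flow S θ zero_le huv.le ω (f 0), ← ih,
      flow_arrival S θ (by rw [hNu]) (by rw [hNv, hNu]), ← hlim, hNu]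
    -- the value at the jump
    have hleft : Function.leftLim f v = f u +
        ∫ s in (u : ℝ)..v, θ.B *ᵥ Function.leftLim f s.toNNReal := by
      have := SimpleSemiLevy.nhdsLT_neBot (lt_of_le_of_lt zero_le huv)
      refine leftLim_eq_of_tendsto ?_
      have h1 : Tendsto (fun r : ℝ≥0 =>
          f u + ∫ s in (u : ℝ)..r, θ.B *ᵥ Function.leftLim f s.toNNReal) (𝓝[<] v)
          (𝓝 (f u + ∫ s in (u : ℝ)..v, θ.B *ᵥ Function.leftLim f s.toNNReal)) :=
        (((continuous_const.add (intervalIntegral.continuous_primitive hint _)).comp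
          NNReal.continuous_coe).tendsto v).mono_left nhdsWithin_le_nhds
      refine h1.congr' ?_
      filter_upwards [Ioo_mem_nhdsLT huv] with r hr
      exact (hconst hr.1.le (hin r ⟨hr.1.le, hr.2⟩)).symm
    have hfv : f v = f u + (∫ s in (u : ℝ)..v, θ.B *ᵥ Function.leftLim f s.toNNReal)
        + ((θ.α₀ + θ.α ⬝ᵥ Function.leftLim f v) * (S.mark k ω) ^ 2) • θ.e := by
      rw [heq v, heq u, hNv, hNu, Finset.sum_range_succ, ← hv, add_smul,
        ← intervalIntegral.integral_add_adjacent_intervals (hint 0 u) (hint u v)]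
      abel
    rw [hfv, ← hleft, jumpMap, mul_comm]
  have hall : ∀ k, k ≤ S.N t ω → f (S.arrival k ω) = flow S θ 0 (S.arrival k ω) ω (f 0) := by
    intro k
    induction k with
    | zero =>
      intro _
      rw [S.arrival_zero]
      exact hcont le_rfl rfl
    | succ k ih => exact fun hk => hjump k hk (ih (by omega))
  have h0 : S.arrival (S.N t ω) ω ≤ t := S.arrival_le_of_le le_rfl
  rw [hcont h0 (hω.N_arrival le_rfl).symm, hall _ le_rfl, flow_flow S θ zero_le h0]

end Jumps

/-! ### Almost sure properties of the counting process -/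

theorem poissonMeasure_one_le (r : ℝ≥0) :
    poissonMeasure r {n | 1 ≤ n} ≤ ENNReal.ofReal r := by
  have h : {n : ℕ | 1 ≤ n} = {0}ᶜ := by
    ext n
    simp [Nat.one_le_iff_ne_zero]
  rw [h, prob_compl_eq_one_sub (measurableSet_singleton 0), poissonMeasure_singleton,
    ← ENNReal.ofReal_one, ← ENNReal.ofReal_sub _ (by positivity)]
  refine ENNReal.ofReal_le_ofReal ?_
  have := Real.add_one_le_exp (-(r : ℝ))
  simp
  linarith

theorem poissonMeasure_two_le (r : ℝ≥0) :
    poissonMeasure r {n | 2 ≤ n} ≤ ENNReal.ofReal ((r : ℝ) ^ 2) := by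
  have h : {n : ℕ | 2 ≤ n} = ({0} ∪ {1})ᶜ := by
    ext n
    simp
    omega
  rw [h, prob_compl_eq_one_sub ((measurableSet_singleton 0).union (measurableSet_singleton 1)),
    measure_union (by simp) (measurableSet_singleton 1), poissonMeasure_singleton,
    poissonMeasure_singleton, ← ENNReal.ofReal_add (by positivity) (by positivity),
    ← ENNReal.ofReal_one, ← ENNReal.ofReal_sub _ (by positivity)]
  refine ENNReal.ofReal_le_ofReal ?_
  have := Real.add_one_le_exp (-(r : ℝ))
  have hr : (0 : ℝ) ≤ r := r.2
  simp
  nlinarith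

/-- A continuous function has small increments over a sufficiently fine equidistant grid. -/
theorem exists_grid {g : ℝ≥0 → ℝ} (hg : Continuous g) (T : ℝ≥0) {ε : ℝ} (hε : 0 < ε) :
    ∃ n : ℕ, 0 < n ∧ ∀ i < n, g (((i + 1 : ℕ) : ℝ≥0) * T / n) - g ((i : ℝ≥0) * T / n) < ε := by
  have huc := (isCompact_Icc (a := (0 : ℝ≥0)) (b := T)).uniformContinuousOn_of_continuous
    hg.continuousOn
  rw [Metric.uniformContinuousOn_iff] at huc
  obtain ⟨δ, hδ, h⟩ := huc ε hε
  obtain ⟨n, hn⟩ := exists_nat_gt ((T : ℝ) / δ)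
  have hn0 : 0 < n := by
    have : (0 : ℝ) < n := lt_of_le_of_lt (by positivity) hn
    exact_mod_cast this
  have hnR : (0 : ℝ) < n := by exact_mod_cast hn0
  have hmem : ∀ i ≤ n, (i : ℝ≥0) * T / n ∈ Icc 0 T := by
    intro i hi
    refine ⟨zero_le, ?_⟩
    rw [div_le_iff₀ (by exact_mod_cast hn0), mul_comm]
    gcongr
  refine ⟨n, hn0, fun i hi => ?_⟩
  have := h _ (hmem (i + 1) hi) _ (hmem i hi.le) ?_
  · rw [Real.dist_eq] at this
    exact (le_abs_self _).trans_lt this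
  · rw [NNReal.dist_eq]
    have h1 : (((((i + 1 : ℕ) : ℝ≥0) * T / n : ℝ≥0) : ℝ) - (((i : ℝ≥0) * T / n : ℝ≥0) : ℝ))
        = T / n := by
      push_cast
      field_simp
      ring
    rw [h1, abs_of_nonneg (by positivity), div_lt_comm₀ hnR hδ]
    exact hn

section Poisson

variable {Ω : Type*} [MeasurableSpace Ω] {P : Measure Ω} (S : SimpleSemiLevy P)

namespace SimpleSemiLevy

/-- The cumulative intensity. -/
def cum (t : ℝ≥0) : ℝ := ∫ u in (0 : ℝ)..t, S.lam u

theorem cum_zero : S.cum 0 = 0 := by simp [cum]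

theorem intervalIntegrable_lam (s t : ℝ≥0) : IntervalIntegrable S.lam volume s t :=
  (S.lam_integrable s).symm.trans (S.lam_integrable t)

theorem integral_lam (s t : ℝ≥0) : ∫ u in (s : ℝ)..t, S.lam u = S.cum t - S.cum s := by
  rw [cum, cum, eq_sub_iff_add_eq, add_comm,
    intervalIntegral.integral_add_adjacent_intervals (S.lam_integrable s)
      (S.intervalIntegrable_lam s t)]

theorem cum_mono : Monotone S.cum := by
  intro s t hst
  have h : 0 ≤ ∫ u in (s : ℝ)..t, S.lam u :=
    intervalIntegral.integral_nonneg (by exact_mod_cast hst)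
      fun u hu => S.lam_nonneg u (s.2.trans hu.1)
  rw [S.integral_lam] at h
  linarith

theorem cum_continuous : Continuous S.cum := by
  rw [continuous_iff_continuousAt]
  intro t
  have h : ContinuousOn (fun x : ℝ => ∫ u in (0 : ℝ)..x, S.lam u) (Icc 0 (t + 1 : ℝ≥0)) := by
    have := intervalIntegral.continuousOn_primitive_interval
      (μ := volume) (f := S.lam) (a := 0) (b := ((t + 1 : ℝ≥0) : ℝ)) ?_
    · rwa [uIcc_of_le (NNReal.coe_nonneg _)] at this
    · rw [uIcc_of_le (NNReal.coe_nonneg _)]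
      exact (intervalIntegrable_iff_integrableOn_Icc_of_le (NNReal.coe_nonneg _)).1
        (S.lam_integrable (t + 1))
  have h2 : ContinuousOn S.cum (Iic (t + 1)) :=
    h.comp NNReal.continuous_coe.continuousOn fun x hx => ⟨x.2, by exact_mod_cast hx⟩
  exact h2.continuousAt (Iic_mem_nhds (by simp))

theorem hasLaw_increment {s t : ℝ≥0} (hst : s ≤ t) :
    HasLaw (fun ω => S.N t ω - S.N s ω) (poissonMeasure (S.cum t - S.cum s).toNNReal) P := by
  rw [← S.integral_lam]
  exact S.N_law s t hst

theorem measure_one_le {s t : ℝ≥0} (hst : s ≤ t) :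
    P {ω | S.N s ω + 1 ≤ S.N t ω} ≤ ENNReal.ofReal (S.cum t - S.cum s) := by
  have h := (S.hasLaw_increment hst).measure_eq (p := fun n => 1 ≤ n) (by measurability)
  have h2 : {ω | S.N s ω + 1 ≤ S.N t ω} = {ω | 1 ≤ S.N t ω - S.N s ω} := by
    ext ω
    simp only [mem_ofPred_eq]
    omega
  rw [h2, h]
  refine (poissonMeasure_one_le _).trans_eq ?_
  rw [Real.coe_toNNReal _ (sub_nonneg.2 (S.cum_mono hst))]

theorem measure_two_le {s t : ℝ≥0} (hst : s ≤ t) :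
    P {ω | S.N s ω + 2 ≤ S.N t ω} ≤ ENNReal.ofReal ((S.cum t - S.cum s) ^ 2) := by
  have h := (S.hasLaw_increment hst).measure_eq (p := fun n => 2 ≤ n) (by measurability)
  have h2 : {ω | S.N s ω + 2 ≤ S.N t ω} = {ω | 2 ≤ S.N t ω - S.N s ω} := by
    ext ω
    simp only [mem_ofPred_eq]
    omega
  rw [h2, h]
  refine (poissonMeasure_two_le _).trans_eq ?_
  rw [Real.coe_toNNReal _ (sub_nonneg.2 (S.cum_mono hst))]

theorem ae_N_eq {s t : ℝ≥0} (hst : s ≤ t) (h : S.cum t = S.cum s) :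
    ∀ᵐ ω ∂P, S.N t ω = S.N s ω := by
  rw [ae_iff]
  refine measure_mono_null (t := {ω | S.N s ω + 1 ≤ S.N t ω}) ?_ ?_
  · intro ω hω
    have h1 := S.N_mono ω hst
    have h2 : S.N t ω ≠ S.N s ω := hω
    simp only [mem_ofPred_eq]
    simp only at h1
    omega
  · have := S.measure_one_le hst
    rw [h, sub_self, ENNReal.ofReal_zero] at this
    exact le_antisymm this zero_le

theorem ae_arrival_lt {t : ℝ≥0} (ht : 0 < t) : ∀ᵐ ω ∂P, S.arrival (S.N t ω) ω < t := by
  rw [ae_iff]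
  have hle : ∀ u < t, P {ω | ¬ S.arrival (S.N t ω) ω < t} ≤ ENNReal.ofReal (S.cum t - S.cum u) := by
    intro u hu
    refine (measure_mono ?_).trans (S.measure_one_le hu.le)
    intro ω hω
    have h1 : t ≤ S.arrival (S.N t ω) ω := not_lt.1 hω
    exact S.N_lt_of_lt_arrival (hu.trans_le h1)
  have hne : (𝓝[<] t).NeBot := nhdsLT_neBot ht
  have hlim : Tendsto (fun u => ENNReal.ofReal (S.cum t - S.cum u)) (𝓝[<] t) (𝓝 0) := by
    have : Tendsto (fun u => S.cum t - S.cum u) (𝓝[<] t) (𝓝 (S.cum t - S.cum t)) :=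
      ((S.cum_continuous.tendsto t).mono_left nhdsWithin_le_nhds).const_sub _
    rw [sub_self] at this
    simpa using ENNReal.tendsto_ofReal this
  refine le_antisymm (ge_of_tendsto hlim ?_) zero_le
  filter_upwards [self_mem_nhdsWithin] with u hu using hle u hu

theorem measure_double_jump_le (T : ℝ≥0) {ε : ℝ} (hε : 0 < ε) :
    P {ω | ∃ k, k + 2 ≤ S.N T ω ∧ S.arrival (k + 2) ω ≤ S.arrival (k + 1) ω} ≤
      ENNReal.ofReal (ε * S.cum T) := by
  obtain ⟨n, hn0, hn⟩ := exists_grid S.cum_continuous T hε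
  have hnR : (0 : ℝ≥0) < n := by exact_mod_cast hn0
  set t : ℕ → ℝ≥0 := fun i => (i : ℝ≥0) * T / n with ht
  have htm : Monotone t := by
    intro i j hij
    simp only [t]
    gcongr
  have htn : t n = T := by
    simp only [t]
    field_simp
  have ht0 : t 0 = 0 := by simp [t]
  have hsub : {ω | ∃ k, k + 2 ≤ S.N T ω ∧ S.arrival (k + 2) ω ≤ S.arrival (k + 1) ω} ⊆
      ⋃ i ∈ Finset.range n, {ω | S.N (t i) ω + 2 ≤ S.N (t (i + 1)) ω} := by
    rintro ω ⟨k, hk, hka⟩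
    have hex : ∃ i, k + 2 ≤ S.N (t i) ω := ⟨n, by rwa [htn]⟩
    classical
    have hspec := Nat.find_spec hex
    have hi0 : Nat.find hex ≠ 0 := by
      intro h0
      rw [h0, ht0, S.N_zero] at hspec
      omega
    obtain ⟨i, hi⟩ := Nat.exists_eq_succ_of_ne_zero hi0
    have hin : Nat.find hex ≤ n := Nat.find_min' hex (by rwa [htn])
    simp only [mem_iUnion, Finset.mem_range, mem_ofPred_eq]
    refine ⟨i, by omega, ?_⟩
    rw [hi] at hspec
    have hlt : ¬ k + 2 ≤ S.N (t i) ω := Nat.find_min hex (by omega)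
    have hlt2 : ¬ k + 1 ≤ S.N (t i) ω := by
      intro hc
      exact hlt ((S.arrival_le_iff hk).1 (hka.trans (S.arrival_le_of_le hc)))
    have : k + 2 ≤ S.N (t (i + 1)) ω := hspec
    omega
  calc _ ≤ P (⋃ i ∈ Finset.range n, {ω | S.N (t i) ω + 2 ≤ S.N (t (i + 1)) ω}) := measure_mono hsub
    _ ≤ ∑ i ∈ Finset.range n, P {ω | S.N (t i) ω + 2 ≤ S.N (t (i + 1)) ω} :=
      measure_biUnion_finset_le _ _
    _ ≤ ∑ i ∈ Finset.range n, ENNReal.ofReal (ε * (S.cum (t (i + 1)) - S.cum (t i))) := by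
      refine Finset.sum_le_sum fun i hi => ?_
      refine (S.measure_two_le (htm (Nat.le_succ i))).trans (ENNReal.ofReal_le_ofReal ?_)
      have h1 : 0 ≤ S.cum (t (i + 1)) - S.cum (t i) := sub_nonneg.2 (S.cum_mono (htm (Nat.le_succ i)))
      rw [sq]
      exact mul_le_mul_of_nonneg_right (hn i (Finset.mem_range.1 hi)).le h1
    _ = ENNReal.ofReal (ε * S.cum T) := by
      rw [← ENNReal.ofReal_sum_of_nonneg, ← Finset.mul_sum,
        Finset.sum_range_sub (fun i => S.cum (t i)), htn, ht0, S.cum_zero, sub_zero]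
      intro i _
      exact mul_nonneg hε.le (sub_nonneg.2 (S.cum_mono (htm (Nat.le_succ i))))

theorem ae_simpleJumps : ∀ᵐ ω ∂P, S.SimpleJumps ω := by
  have h : ∀ T : ℕ, ∀ᵐ ω ∂P,
      ¬ ∃ k, k + 2 ≤ S.N T ω ∧ S.arrival (k + 2) ω ≤ S.arrival (k + 1) ω := by
    intro T
    rw [ae_iff]
    simp only [not_not]
    have hlim : Tendsto (fun ε : ℝ => ENNReal.ofReal (ε * S.cum T)) (𝓝[>] 0) (𝓝 0) := by
      have : Tendsto (fun ε : ℝ => ε * S.cum T) (𝓝[>] 0) (𝓝 (0 * S.cum T)) :=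
        (tendsto_id.mono_left nhdsWithin_le_nhds).mul_const _
      rw [zero_mul] at this
      simpa using ENNReal.tendsto_ofReal this
    refine le_antisymm (ge_of_tendsto hlim ?_) zero_le
    filter_upwards [self_mem_nhdsWithin] with ε hε using S.measure_double_jump_le T hε
  filter_upwards [ae_all_iff.2 h] with ω hω n t hn
  by_contra hc
  obtain ⟨T, hT⟩ := exists_nat_ge t
  exact hω T ⟨n, hn.trans (S.N_mono ω hT), not_lt.1 hc⟩

end SimpleSemiLevy

end Poisson

/-- The state process is transported by the flow. -/
theorem IsStateProcess.ae_eq_flow {Ω : Type*} [MeasurableSpace Ω] {P : Measure Ω}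
    {S : SimpleSemiLevy P} {p q : ℕ} {θ : Params p q} {Y : ℝ≥0 → Ω → Fin q → ℝ}
    (hY : IsStateProcess S θ Y) :
    ∀ᵐ ω ∂P, ∀ s t : ℝ≥0, s ≤ t → Y t ω = flow S θ s t ω (Y s ω) := by
  filter_upwards [S.ae_simpleJumps, hY.cadlag, hY.equation] with ω h1 h2 h3 s t hst
  rw [eq_flow_of_equation h1 h2 h3 t, eq_flow_of_equation h1 h2 h3 s,
    flow_flow S θ zero_le hst]

/-- The state process has almost surely no jump at a fixed time. -/
theorem IsStateProcess.ae_leftLim_eq {Ω : Type*} [MeasurableSpace Ω] {P : Measure Ω}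
    {S : SimpleSemiLevy P} {p q : ℕ} {θ : Params p q} {Y : ℝ≥0 → Ω → Fin q → ℝ}
    (hY : IsStateProcess S θ Y) (t : ℝ≥0) :
    ∀ᵐ ω ∂P, Function.leftLim (fun u => Y u ω) t = Y t ω := by
  rcases eq_or_lt_of_le (zero_le (a := t)) with h0 | h0
  · refine Eventually.of_forall fun ω => leftLim_eq_of_isBot fun x => ?_
    rw [← h0]
    exact zero_le
  filter_upwards [hY.ae_eq_flow, S.ae_arrival_lt h0] with ω h1 h2
  have := SimpleSemiLevy.nhdsLT_neBot h0
  have hev := SimpleSemiLevy.eventually_N_eq_of_not_arrival h2.ne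
  have hN : ∀ᶠ u : ℝ≥0 in 𝓝[<] t, Y t ω = NormedSpace.exp (((t : ℝ) - u) • θ.B) *ᵥ Y u ω := by
    filter_upwards [hev, self_mem_nhdsWithin] with u hu hut
    rw [h1 u t (le_of_lt hut), flow_of_N_eq S θ hu.symm]
  refine leftLim_eq_of_tendsto ?_
  have h3 : Tendsto (fun u : ℝ≥0 => NormedSpace.exp (((u : ℝ) - t) • θ.B) *ᵥ Y t ω) (𝓝[<] t)
      (𝓝 (NormedSpace.exp (((t : ℝ) - t) • θ.B) *ᵥ Y t ω)) := by
    have hc : Continuous fun u : ℝ => NormedSpace.exp ((u - t) • θ.B) *ᵥ Y t ω :=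
      continuous_iff_continuousAt.2 fun u => (hasDerivAt_exp_smul_mulVec θ.B (Y t ω) t u).continuousAt
    exact ((hc.comp NNReal.continuous_coe).tendsto t).mono_left nhdsWithin_le_nhds
  have h4 : NormedSpace.exp (((t : ℝ) - t) • θ.B) *ᵥ Y t ω = Y t ω := by simp
  rw [h4] at h3
  refine h3.congr' ?_
  filter_upwards [hN] with u hu
  rw [hu, exp_smul_mulVec_exp_smul_mulVec]
  simp

/-! ### Independence of the past and the future at a random index -/

theorem comap_le_of_measurable_apply {Ω κ : Type*} [MeasurableSpace Ω] {f : Ω → κ → ℝ}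
    (hf : ∀ i, Measurable fun ω => f ω i) :
    MeasurableSpace.comap f inferInstance ≤ ‹MeasurableSpace Ω› :=
  (measurable_pi_lambda _ hf).comap_le

section Abstract

variable {Ω : Type*} [MeasurableSpace Ω] {P : Measure Ω} [IsProbabilityMeasure P]

theorem indepFun_prodMk_of_indepFun {α β γ : Type*} [MeasurableSpace α] [MeasurableSpace β]
    [MeasurableSpace γ] {A : Ω → α} {B : Ω → β} {C : Ω → γ} (hA : AEMeasurable A P)
    (hB : AEMeasurable B P) (hC : AEMeasurable C P) (h1 : IndepFun A (fun ω => (B ω, C ω)) P)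
    (h2 : IndepFun B C P) : IndepFun (fun ω => (A ω, B ω)) C P := by
  have hAB : IndepFun A B P := h1.comp measurable_id measurable_fst
  have := Measure.isProbabilityMeasure_map (μ := P) hA
  have := Measure.isProbabilityMeasure_map (μ := P) hB
  have := Measure.isProbabilityMeasure_map (μ := P) hC
  rw [indepFun_iff_map_prod_eq_prod_map_map (by fun_prop) (by fun_prop)] at *
  have e1 : Measure.map (fun ω => ((A ω, B ω), C ω)) P =
      Measure.map MeasurableEquiv.prodAssoc.symm (Measure.map (fun ω => (A ω, B ω, C ω)) P) := by
    rw [AEMeasurable.map_map_of_aemeasurable (MeasurableEquiv.measurable _).aemeasurable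
      (by fun_prop)]
    rfl
  rw [e1, h1, h2, hAB, ← Measure.prodAssoc_prod, Measure.map_map (MeasurableEquiv.measurable _)
    (MeasurableEquiv.measurable _)]
  simp

variable {ι : Type*}

/-- The marks with index below `m`. -/
def truncMarks (m : ℕ) (z : ℕ × ι → ℝ) : ℕ × ι → ℝ := fun i => if i.1 < m then z i else 0

/-- The marks with index from `m` on. -/
def shiftMarks (m : ℕ) (z : ℕ × ι → ℝ) : ℕ × ι → ℝ := fun i => z (m + i.1, i.2)

theorem measurable_truncMarks (m : ℕ) : Measurable (truncMarks (ι := ι) m) := by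
  refine measurable_pi_lambda _ fun i => ?_
  by_cases h : i.1 < m
  · simp only [truncMarks, h, if_true]
    exact measurable_pi_apply i
  · simp only [truncMarks, h, if_false]
    exact measurable_const

theorem measurable_shiftMarks (m : ℕ) : Measurable (shiftMarks (ι := ι) m) :=
  measurable_pi_lambda _ fun _ => measurable_pi_apply _

variable {Z : Ω → ℕ × ι → ℝ}

theorem indepFun_truncMarks_shiftMarks (hZ : Measurable Z)
    (hind : iIndepFun (fun i ω => Z ω i) P) (m : ℕ) :
    IndepFun (fun ω => truncMarks m (Z ω)) (fun ω => shiftMarks m (Z ω)) P := by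
  have hZi : ∀ i, Measurable fun ω => Z ω i := fun i => (measurable_pi_apply i).comp hZ
  have hdis : Disjoint {i : ℕ × ι | i.1 < m} {i : ℕ × ι | m ≤ i.1} := by
    rw [Set.disjoint_left]
    intro i hi hi'
    exact absurd (show i.1 < m from hi) (not_lt.2 hi')
  have h := indep_iSup_of_disjoint (fun i => (hZi i).comap_le) hind.iIndep hdis
  have key : ∀ i, ∀ T : Set (ℕ × ι), i ∈ T →
      Measurable[⨆ j ∈ T, MeasurableSpace.comap (fun ω => Z ω j) inferInstance]
        fun ω => Z ω i := by
    intro i T hi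
    have hle : MeasurableSpace.comap (fun ω => Z ω i) inferInstance ≤
        ⨆ j ∈ T, MeasurableSpace.comap (fun ω => Z ω j) inferInstance :=
      le_iSup₂_of_le i hi le_rfl
    exact Measurable.mono (comap_measurable _) hle le_rfl
  refine indep_of_indep_of_le_left (indep_of_indep_of_le_right h ?_) ?_
  · exact @comap_le_of_measurable_apply _ _ (_) _ fun i => key _ _ (Nat.le_add_right m i.1)
  · refine @comap_le_of_measurable_apply _ _ (_) _ fun i => ?_
    by_cases hi : i.1 < m
    · simp only [truncMarks, hi, if_true]
      exact key _ _ hi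
    · simp only [truncMarks, hi, if_false]
      exact @measurable_const _ _ _ _ _

theorem identDistrib_shiftMarks [Countable ι] (hind : iIndepFun (fun i ω => Z ω i) P)
    (hlaw : ∀ m i, IdentDistrib (fun ω => Z ω (m + i.1, i.2)) (fun ω => Z ω i) P P) (m : ℕ) :
    IdentDistrib (fun ω => shiftMarks m (Z ω)) Z P P := by
  have hinj : Function.Injective fun i : ℕ × ι => (m + i.1, i.2) := by
    rintro ⟨a, b⟩ ⟨c, d⟩ h
    simp only [Prod.mk.injEq] at h ⊢
    exact ⟨by omega, h.2⟩
  exact IdentDistrib.pi (fun i => hlaw m i) (hind.precomp hinj) hind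

variable {α γ : Type*} [MeasurableSpace α] [MeasurableSpace γ] {A : Ω → α} {C : Ω → γ}

theorem indepFun_past_future_fixed (hA : Measurable A) (hC : Measurable C) (hZ : Measurable Z)
    (hAC : IndepFun A C P) (hACZ : IndepFun (fun ω => (A ω, C ω)) Z P)
    (hind : iIndepFun (fun i ω => Z ω i) P) (m : ℕ) :
    IndepFun (fun ω => (A ω, truncMarks m (Z ω))) (fun ω => (C ω, shiftMarks m (Z ω))) P := by
  have hT : Measurable fun ω => truncMarks m (Z ω) := (measurable_truncMarks m).comp hZ
  have hS : Measurable fun ω => shiftMarks m (Z ω) := (measurable_shiftMarks m).comp hZ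
  have hACT : IndepFun (fun ω => truncMarks m (Z ω)) (fun ω => (A ω, C ω)) P :=
    (hACZ.comp measurable_id (measurable_truncMarks m)).symm
  have h1 : IndepFun (fun ω => (truncMarks m (Z ω), A ω)) C P :=
    indepFun_prodMk_of_indepFun hT.aemeasurable hA.aemeasurable hC.aemeasurable hACT hAC
  have hACTS : IndepFun (fun ω => (A ω, C ω))
      (fun ω => (truncMarks m (Z ω), shiftMarks m (Z ω))) P :=
    hACZ.comp measurable_id ((measurable_truncMarks m).prodMk (measurable_shiftMarks m))
  have h2 : IndepFun (fun ω => ((A ω, C ω), truncMarks m (Z ω))) (fun ω => shiftMarks m (Z ω)) P :=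
    indepFun_prodMk_of_indepFun (hA.prodMk hC).aemeasurable hT.aemeasurable hS.aemeasurable
      hACTS (indepFun_truncMarks_shiftMarks hZ hind m)
  have h3 : IndepFun (fun ω => shiftMarks m (Z ω)) (fun ω => (C ω, (truncMarks m (Z ω), A ω))) P :=
    h2.symm.comp measurable_id (φ := id)
      (ψ := fun x : (α × γ) × (ℕ × ι → ℝ) => (x.1.2, (x.2, x.1.1))) (by fun_prop)
  have h4 := indepFun_prodMk_of_indepFun hS.aemeasurable hC.aemeasurable
    (hT.prodMk hA).aemeasurable h3 h1.symm
  exact h4.symm.comp (φ := Prod.swap) (ψ := Prod.swap) measurable_swap measurable_swap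

theorem measure_past_inter_future [Countable ι] {ν : α → ℕ} (hν : Measurable ν) (hA : Measurable A)
    (hC : Measurable C) (hZ : Measurable Z)
    (hAC : IndepFun A C P) (hACZ : IndepFun (fun ω => (A ω, C ω)) Z P)
    (hind : iIndepFun (fun i ω => Z ω i) P)
    (hlaw : ∀ m i, IdentDistrib (fun ω => Z ω (m + i.1, i.2)) (fun ω => Z ω i) P P)
    {s : Set (α × (ℕ × ι → ℝ))} {t : Set (γ × (ℕ × ι → ℝ))} (hs : MeasurableSet s)
    (ht : MeasurableSet t) :
    P ((fun ω => (A ω, truncMarks (ν (A ω)) (Z ω))) ⁻¹' s ∩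
        (fun ω => (C ω, shiftMarks (ν (A ω)) (Z ω))) ⁻¹' t) =
      P ((fun ω => (A ω, truncMarks (ν (A ω)) (Z ω))) ⁻¹' s) *
        P ((fun ω => (C ω, Z ω)) ⁻¹' t) := by
  have hνA : Measurable fun ω => ν (A ω) := hν.comp hA
  have hsplit : ∀ E : Set Ω, P E = ∑' m, P (E ∩ (fun ω => ν (A ω)) ⁻¹' {m}) := by
    intro E
    have h := tsum_measure_preimage_singleton (μ := P.restrict E) (s := univ)
      (Set.to_countable _) (f := fun ω => ν (A ω)) (fun y _ => hνA (measurableSet_singleton y))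
    rw [tsum_univ (fun m => P.restrict E ((fun ω => ν (A ω)) ⁻¹' {m}))] at h
    rw [preimage_univ, Measure.restrict_apply_univ] at h
    rw [← h]
    refine tsum_congr fun m => ?_
    rw [Measure.restrict_apply (hνA (measurableSet_singleton m)), inter_comm]
  rw [hsplit, hsplit ((fun ω => (A ω, truncMarks (ν (A ω)) (Z ω))) ⁻¹' s), ← ENNReal.tsum_mul_right]
  refine tsum_congr fun m => ?_
  have hs' : MeasurableSet (s ∩ {x | ν x.1 = m}) :=
    hs.inter ((hν.comp measurable_fst) (measurableSet_singleton m))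
  have h1 := (indepFun_past_future_fixed hA hC hZ hAC hACZ hind m).measure_inter_preimage_eq_mul
    _ _ hs' ht
  have hCS : IndepFun C (fun ω => shiftMarks m (Z ω)) P :=
    hACZ.comp measurable_snd (measurable_shiftMarks m)
  have hCZ : IndepFun C Z P := hACZ.comp measurable_snd measurable_id
  have h2 : P ((fun ω => (C ω, shiftMarks m (Z ω))) ⁻¹' t) = P ((fun ω => (C ω, Z ω)) ⁻¹' t) :=
    ((IdentDistrib.refl hC.aemeasurable).prodMk (identDistrib_shiftMarks hind hlaw m)
      hCS hCZ).measure_mem_eq ht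
  rw [h2] at h1
  have e1 : (fun ω => (A ω, truncMarks (ν (A ω)) (Z ω))) ⁻¹' s ∩ (fun ω => ν (A ω)) ⁻¹' {m} =
      (fun ω => (A ω, truncMarks m (Z ω))) ⁻¹' (s ∩ {x | ν x.1 = m}) := by
    ext ω
    simp only [mem_inter_iff, mem_preimage, mem_singleton_iff, mem_ofPred_eq]
    constructor <;> rintro ⟨h, rfl⟩ <;> exact ⟨h, rfl⟩
  have e2 : (fun ω => (A ω, truncMarks (ν (A ω)) (Z ω))) ⁻¹' s ∩
        (fun ω => (C ω, shiftMarks (ν (A ω)) (Z ω))) ⁻¹' t ∩ (fun ω => ν (A ω)) ⁻¹' {m} =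
      (fun ω => (A ω, truncMarks m (Z ω))) ⁻¹' (s ∩ {x | ν x.1 = m}) ∩
        (fun ω => (C ω, shiftMarks m (Z ω))) ⁻¹' t := by
    ext ω
    simp only [mem_inter_iff, mem_preimage, mem_singleton_iff, mem_ofPred_eq]
    constructor
    · rintro ⟨⟨h, h'⟩, rfl⟩
      exact ⟨⟨h, rfl⟩, h'⟩
    · rintro ⟨⟨h, rfl⟩, h'⟩
      exact ⟨⟨h, h'⟩, rfl⟩
  rw [e1, e2, h1]

theorem measurable_apply_nat_of_measurable {β δ : Type*} [MeasurableSpace β] [MeasurableSpace δ]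
    {f : ℕ → β → δ} (hf : ∀ m, Measurable (f m)) {n : Ω → ℕ} (hn : Measurable n) {g : Ω → β}
    (hg : Measurable g) : Measurable fun ω => f (n ω) (g ω) :=
  (measurable_from_prod_countable_right (f := fun x : ℕ × β => f x.1 x.2) hf).comp (hn.prodMk hg)

theorem identDistrib_future [Countable ι] {ν : α → ℕ} (hν : Measurable ν) (hA : Measurable A)
    (hC : Measurable C) (hZ : Measurable Z)
    (hAC : IndepFun A C P) (hACZ : IndepFun (fun ω => (A ω, C ω)) Z P)
    (hind : iIndepFun (fun i ω => Z ω i) P)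
    (hlaw : ∀ m i, IdentDistrib (fun ω => Z ω (m + i.1, i.2)) (fun ω => Z ω i) P P) :
    IdentDistrib (fun ω => (C ω, shiftMarks (ν (A ω)) (Z ω))) (fun ω => (C ω, Z ω)) P P := by
  have hm : Measurable fun ω => shiftMarks (ν (A ω)) (Z ω) :=
    measurable_apply_nat_of_measurable measurable_shiftMarks (hν.comp hA) hZ
  refine ⟨(hC.prodMk hm).aemeasurable, (hC.prodMk hZ).aemeasurable, ?_⟩
  ext t ht
  rw [Measure.map_apply (hC.prodMk hm) ht, Measure.map_apply (hC.prodMk hZ) ht]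
  have := measure_past_inter_future hν hA hC hZ hAC hACZ hind hlaw MeasurableSet.univ ht
  simpa using this

theorem indepFun_past_future [Countable ι] {ν : α → ℕ} (hν : Measurable ν) (hA : Measurable A)
    (hC : Measurable C) (hZ : Measurable Z)
    (hAC : IndepFun A C P) (hACZ : IndepFun (fun ω => (A ω, C ω)) Z P)
    (hind : iIndepFun (fun i ω => Z ω i) P)
    (hlaw : ∀ m i, IdentDistrib (fun ω => Z ω (m + i.1, i.2)) (fun ω => Z ω i) P P) :
    IndepFun (fun ω => (A ω, truncMarks (ν (A ω)) (Z ω)))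
      (fun ω => (C ω, shiftMarks (ν (A ω)) (Z ω))) P := by
  rw [indepFun_iff_measure_inter_preimage_eq_mul]
  intro s t hs ht
  rw [measure_past_inter_future hν hA hC hZ hAC hACZ hind hlaw hs ht,
    (identDistrib_future hν hA hC hZ hAC hACZ hind hlaw).measure_mem_eq ht]

end Abstract

/-! ### The counting process: past, future and periodicity -/

theorem exists_monotone_through (F : Finset ℝ≥0) (s : ℝ≥0) :
    ∃ (t : ℕ → ℝ≥0) (K : ℕ), Monotone t ∧ t 0 = 0 ∧ t K = s ∧ ∀ u ∈ F, ∃ i, t i = u := by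
  classical
  set G : Finset ℝ≥0 := insert 0 (insert s F) with hG
  have hpos : 0 < G.card := Finset.card_pos.2 ⟨0, by simp [hG]⟩
  let f := G.orderEmbOfFin rfl
  let t : ℕ → ℝ≥0 := fun i => f ⟨min i (G.card - 1), by omega⟩
  have hmem : ∀ u ∈ G, ∃ i, t i = u := by
    intro u hu
    have : u ∈ Set.range f := by
      rw [Finset.range_orderEmbOfFin]
      exact hu
    obtain ⟨i, hi⟩ := this
    refine ⟨i, ?_⟩
    have h2 : (⟨min (i : ℕ) (G.card - 1), by omega⟩ : Fin G.card) = i := by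
      ext
      have := i.2
      simp only
      omega
    simp only [t, h2, hi]
  have hmono : Monotone t := by
    intro i j hij
    refine f.monotone ?_
    simp only [Fin.mk_le_mk]
    omega
  obtain ⟨i, hi⟩ := hmem 0 (by simp [hG])
  obtain ⟨K, hK⟩ := hmem s (by simp [hG])
  refine ⟨t, K, hmono, le_antisymm ?_ zero_le, hK, fun u hu => hmem u (by simp [hG, hu])⟩
  rw [← hi]
  exact hmono (Nat.zero_le i)

section Counting

variable {Ω : Type*} [MeasurableSpace Ω] {P : Measure Ω} (S : SimpleSemiLevy P)

namespace SimpleSemiLevy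

theorem sum_increments (t : ℕ → ℝ≥0) (ht : Monotone t) (ω : Ω) {a b : ℕ} (hab : a ≤ b) :
    ∑ i ∈ Finset.Ico a b, (S.N (t (i + 1)) ω - S.N (t i) ω) = S.N (t b) ω - S.N (t a) ω := by
  induction b, hab using Nat.le_induction with
  | base => simp
  | succ b hab ih =>
    rw [Finset.sum_Ico_succ_top hab, ih]
    have h1 := S.N_mono ω (ht hab)
    have h2 := S.N_mono ω (ht (Nat.le_succ b))
    simp only [Nat.succ_eq_add_one] at h1 h2
    omega

theorem indepFun_N_past_future [IsProbabilityMeasure P] (s : ℝ≥0) :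
    IndepFun (fun ω (u : ℝ≥0) => S.N (u ⊓ s) ω) (fun ω (v : ℝ≥0) => S.N (s + v) ω - S.N s ω) P := by
  classical
  refine IndepFun.process_indepFun_process (fun u => S.N_measurable _)
    (fun v => (S.N_measurable _).sub (S.N_measurable _)) fun I J => ?_
  obtain ⟨t, K, htm, ht0, htK, htF⟩ :=
    exists_monotone_through (I.image (fun u => u ⊓ s) ∪ J.image (fun v => s + v)) s
  have hI : ∀ u : I, ∃ i ≤ K, t i = u.1 ⊓ s := by
    intro u
    obtain ⟨i, hi⟩ := htF (u.1 ⊓ s)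
      (Finset.mem_union_left _ (Finset.mem_image_of_mem (fun u => u ⊓ s) u.2))
    rcases le_total i K with h | h
    · exact ⟨i, h, hi⟩
    · refine ⟨K, le_rfl, le_antisymm ((htm h).trans_eq hi) ?_⟩
      rw [htK]
      exact inf_le_right
  have hJ : ∀ v : J, ∃ i, K ≤ i ∧ t i = s + v.1 := by
    intro v
    obtain ⟨i, hi⟩ := htF (s + v.1)
      (Finset.mem_union_right _ (Finset.mem_image_of_mem (fun v => s + v) v.2))
    rcases le_total K i with h | h
    · exact ⟨i, h, hi⟩
    · refine ⟨K, le_rfl, le_antisymm ?_ (hi.symm.trans_le (htm h))⟩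
      rw [htK]
      exact le_self_add
  choose a haK ha using hI
  choose b hbK hb using hJ
  let M := Finset.univ.sup b
  have hbM : ∀ v, b v ≤ M := fun v => Finset.le_sup (f := b) (Finset.mem_univ v)
  have hind := S.N_indep.nat htm
  have h := hind.indepFun_finset (Finset.range K) (Finset.Ico K M)
    (by
      rw [Finset.disjoint_left]
      intro i hi hi'
      simp only [Finset.mem_range, Finset.mem_Ico] at hi hi'
      omega)
    (fun i => (S.N_measurable _).sub (S.N_measurable _))
  let φ : (Finset.range K → ℕ) → I → ℕ := fun x u =>
    ∑ i : Finset.range K, if (i : ℕ) < a u then x i else 0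
  let ψ : (Finset.Ico K M → ℕ) → J → ℕ := fun x v =>
    ∑ i : Finset.Ico K M, if (i : ℕ) < b v then x i else 0
  have hφ : Measurable φ := measurable_of_countable _
  have hψ : Measurable ψ := measurable_of_countable _
  convert! h.comp hφ hψ using 1
  · funext ω u
    simp only [φ, Function.comp]
    rw [Finset.sum_coe_sort (Finset.range K)
      (fun i => if i < a u then S.N (t (i + 1)) ω - S.N (t i) ω else 0), ← Finset.sum_filter]
    have : (Finset.range K).filter (fun i => i < a u) = Finset.Ico 0 (a u) := by
      ext i
      have := haK u
      simp only [Finset.mem_filter, Finset.mem_range, Finset.mem_Ico]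
      omega
    rw [this, S.sum_increments t htm ω (Nat.zero_le _), ht0, S.N_zero, Nat.sub_zero, ha]
  · funext ω v
    simp only [ψ, Function.comp]
    rw [Finset.sum_coe_sort (Finset.Ico K M)
      (fun i => if i < b v then S.N (t (i + 1)) ω - S.N (t i) ω else 0), ← Finset.sum_filter]
    have : (Finset.Ico K M).filter (fun i => i < b v) = Finset.Ico K (b v) := by
      ext i
      have := hbM v
      simp only [Finset.mem_filter, Finset.mem_Ico]
      omega
    rw [this, S.sum_increments t htm ω (hbK v), hb, htK]

theorem lam_periodic_mul (m : ℕ) {u : ℝ} (hu : 0 ≤ u) :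
    S.lam (u + (m * S.period : ℝ≥0)) = S.lam u := by
  induction m with
  | zero => simp
  | succ m ih =>
    have h : u + ((m + 1 : ℕ) * S.period : ℝ≥0) = (u + (m * S.period : ℝ≥0)) + S.part S.l := by
      push_cast [period]
      ring
    rw [h, S.lam_periodic _ (add_nonneg hu (NNReal.coe_nonneg _)), ih]

theorem cum_periodic (m : ℕ) {s t : ℝ≥0} (hst : s ≤ t) :
    S.cum (m * S.period + t) - S.cum (m * S.period + s) = S.cum t - S.cum s := by
  rw [← S.integral_lam, ← S.integral_lam]
  have h := intervalIntegral.integral_comp_add_right (a := (s : ℝ)) (b := (t : ℝ)) S.lam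
    ((m * S.period : ℝ≥0) : ℝ)
  rw [NNReal.coe_add, NNReal.coe_add, add_comm _ (t : ℝ), add_comm _ (s : ℝ), ← h]
  refine intervalIntegral.integral_congr fun u hu => ?_
  rw [uIcc_of_le (by exact_mod_cast hst)] at hu
  exact S.lam_periodic_mul m (s.2.trans hu.1)

theorem identDistrib_N_shift [IsProbabilityMeasure P] (m : ℕ) :
    IdentDistrib (fun ω (v : ℝ≥0) => S.N (m * S.period + v) ω - S.N (m * S.period) ω)
      (fun ω (v : ℝ≥0) => S.N v ω) P P := by
  classical
  set τ : ℝ≥0 := m * S.period with hτ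
  rw [identDistrib_iff_forall_finset_identDistrib
    (X := fun (v : ℝ≥0) ω => S.N (τ + v) ω - S.N τ ω) (Y := fun (v : ℝ≥0) ω => S.N v ω)
    (measurable_pi_lambda _ fun v => (S.N_measurable _).sub (S.N_measurable _)).aemeasurable
    (measurable_pi_lambda _ fun v => S.N_measurable _).aemeasurable]
  intro J
  obtain ⟨t, _, htm, ht0, _, htF⟩ := exists_monotone_through J 0
  choose b hb using fun v : J => htF v v.2
  have htm' : Monotone fun i => τ + t i := fun i j hij => add_le_add_right (htm hij) τ
  have h1 := S.N_indep.nat htm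
  have h2 := S.N_indep.nat htm'
  have hd : ∀ i, IdentDistrib (fun ω => S.N (τ + t (i + 1)) ω - S.N (τ + t i) ω)
      (fun ω => S.N (t (i + 1)) ω - S.N (t i) ω) P P := by
    intro i
    have e1 := S.hasLaw_increment (htm' (Nat.le_succ i))
    have e2 := S.hasLaw_increment (htm (Nat.le_succ i))
    simp only at e1
    rw [hτ, S.cum_periodic m (htm (Nat.le_succ i)), ← e2.map_eq] at e1
    exact ⟨e1.aemeasurable, e2.aemeasurable, e1.map_eq⟩
  have h := IdentDistrib.pi hd h2 h1
  let φ : (ℕ → ℕ) → J → ℕ := fun x v => ∑ i ∈ Finset.Ico 0 (b v), x i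
  have hφ : Measurable φ := measurable_pi_lambda _ fun v => by fun_prop
  convert! h.comp hφ using 1
  · funext ω v
    simp only [φ, Function.comp, Finset.restrict]
    rw [S.sum_increments _ htm' ω (Nat.zero_le _), ht0, hb, add_zero]
  · funext ω v
    simp only [φ, Function.comp, Finset.restrict]
    rw [S.sum_increments _ htm ω (Nat.zero_le _), ht0, hb, S.N_zero, Nat.sub_zero]

end SimpleSemiLevy

end Counting

/-! ### The compound Poisson process as a functional of the counts and the marks -/

section Compound

variable {Ω : Type*} [MeasurableSpace Ω] {P : Measure Ω} (S : SimpleSemiLevy P)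

namespace SimpleSemiLevy

theorem part_add (j : ℕ) : S.part (j + S.l) = S.part j + S.period := by
  rw [← NNReal.coe_inj, NNReal.coe_add]
  induction j with
  | zero => simp [S.part_zero, period]
  | succ j ih =>
    have h := S.part_periodic j
    have e : j + 1 + S.l = j + S.l + 1 := by omega
    rw [e]
    linarith

theorem part_add_mul (j m : ℕ) : S.part (j + m * S.l) = S.part j + m * S.period := by
  induction m with
  | zero => simp
  | succ m ih =>
    rw [Nat.succ_mul, ← add_assoc, S.part_add, ih]
    push_cast
    ring

theorem period_pos : 0 < S.period := by
  rw [period, ← S.part_zero]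
  exact S.part_strictMono S.l_pos

theorem exists_le_part (t : ℝ≥0) : ∃ j, t ≤ S.part j := by
  obtain ⟨m, hm⟩ := exists_nat_gt ((t : ℝ) / S.period)
  refine ⟨0 + m * S.l, ?_⟩
  rw [S.part_add_mul, S.part_zero, zero_add, ← NNReal.coe_le_coe]
  rw [div_lt_iff₀ (by exact_mod_cast S.period_pos)] at hm
  push_cast
  exact hm.le

/-- The index within the period of the `(j+1)`-st cell of the partition. -/
def cellIndex (j : ℕ) : Fin S.l := ⟨j % S.l, Nat.mod_lt _ S.l_pos⟩

theorem cellIndex_add_mul (j m : ℕ) : S.cellIndex (j + m * S.l) = S.cellIndex j := by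
  simp [cellIndex]

theorem mem_cell_iff {j : ℕ} {t : ℝ≥0} (ht : t ∈ Ico (S.part j) (S.part (j + 1)))
    (r : Fin S.l) : t ∈ S.cell r ↔ r = S.cellIndex j := by
  simp only [cell, mem_iUnion]
  constructor
  · rintro ⟨k, hk⟩
    have h1 : S.part j < S.part (r + k * S.l + 1) := ht.1.trans_lt hk.2
    have h2 : S.part (r + k * S.l) < S.part (j + 1) := hk.1.trans_lt ht.2
    have h1' := S.part_strictMono.lt_iff_lt.1 h1
    have h2' := S.part_strictMono.lt_iff_lt.1 h2
    have hj : j = r + k * S.l := by omega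
    ext
    rw [hj]
    simp [cellIndex, Nat.mod_eq_of_lt r.2]
  · rintro rfl
    refine ⟨j / S.l, ?_⟩
    have hj : ((S.cellIndex j : Fin S.l) : ℕ) + j / S.l * S.l = j := by
      rw [mul_comm]
      exact Nat.mod_add_div j S.l
    rw [hj]
    exact ht

theorem mark_eq {j k : ℕ} {ω : Ω} (h : S.arrival (k + 1) ω ∈ Ico (S.part j) (S.part (j + 1))) :
    S.mark k ω = S.Z k (S.cellIndex j) ω := by
  simp [mark, S.mem_cell_iff h]

/-- The sum of the marks `z` over the points of the counting path `n` up to `v`, where the clock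
starts at time `s` and the first `J` cells of the partition are taken into account. -/
def markedSum (J : ℕ) (s v : ℝ≥0) (n : ℝ≥0 → ℕ) (z : ℕ × Fin S.l → ℝ) : ℝ :=
  ∑ j ∈ Finset.range J,
    ∑ k ∈ Finset.Ico (n ((S.part j - s) ⊓ v)) (n ((S.part (j + 1) - s) ⊓ v)), z (k, S.cellIndex j)

theorem markedSum_eq_of_le {J J' : ℕ} {s v : ℝ≥0} (hJ : s + v ≤ S.part J) (hJJ' : J ≤ J')
    (n : ℝ≥0 → ℕ) (z : ℕ × Fin S.l → ℝ) : S.markedSum J s v n z = S.markedSum J' s v n z := by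
  refine Finset.sum_subset (Finset.range_mono hJJ') fun j _ hj => ?_
  have hj' : J ≤ j := by simpa using hj
  have h1 : ∀ i, J ≤ i → (S.part i - s) ⊓ v = v := fun i hi =>
    inf_eq_right.2 (le_tsub_of_add_le_left (hJ.trans (S.part_strictMono.monotone hi)))
  rw [h1 j hj', h1 (j + 1) (by omega), Finset.Ico_self, Finset.sum_empty]

theorem markedSum_period (m J : ℕ) (v : ℝ≥0) (n : ℝ≥0 → ℕ) (z : ℕ × Fin S.l → ℝ) :
    S.markedSum (m * S.l + J) (m * S.period) v n z = S.markedSum J 0 v n z := by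
  have h0 : ∀ j ≤ m * S.l, S.part j - m * S.period = 0 := by
    intro j hj
    rw [tsub_eq_zero_iff_le]
    have := S.part_add_mul 0 m
    rw [zero_add, S.part_zero, zero_add] at this
    rw [← this]
    exact S.part_strictMono.monotone hj
  have h1 : ∀ j, S.part (m * S.l + j) - m * S.period = S.part j := by
    intro j
    rw [add_comm, S.part_add_mul, add_tsub_cancel_right]
  rw [markedSum, Finset.sum_range_add, Finset.sum_eq_zero, zero_add, markedSum]
  · refine Finset.sum_congr rfl fun j _ => ?_
    rw [h1, add_assoc, h1, tsub_zero, tsub_zero, add_comm (m * S.l) j, S.cellIndex_add_mul]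
  · intro j hj
    have hj' : j < m * S.l := Finset.mem_range.1 hj
    rw [h0 j hj'.le, h0 (j + 1) hj', Finset.Ico_self, Finset.sum_empty]

theorem measurable_markedSum (J : ℕ) (s v : ℝ≥0) :
    Measurable fun x : (ℝ≥0 → ℕ) × (ℕ × Fin S.l → ℝ) => S.markedSum J s v x.1 x.2 := by
  refine Finset.measurable_fun_sum _ fun j _ => ?_
  have h := measurable_apply_nat_of_measurable (Ω := (ℝ≥0 → ℕ) × (ℕ × Fin S.l → ℝ))
    (f := fun a (x : (ℝ≥0 → ℕ) × (ℕ × Fin S.l → ℝ)) =>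
      ∑ k ∈ Finset.Ico a (x.1 ((S.part (j + 1) - s) ⊓ v)), x.2 (k, S.cellIndex j))
    (fun a => ?_) (n := fun x => x.1 ((S.part j - s) ⊓ v)) (by fun_prop) measurable_id
  · exact h
  · exact measurable_apply_nat_of_measurable
      (f := fun b (x : (ℝ≥0 → ℕ) × (ℕ × Fin S.l → ℝ)) =>
        ∑ k ∈ Finset.Ico a b, x.2 (k, S.cellIndex j))
      (fun b => by fun_prop) (n := fun x => x.1 ((S.part (j + 1) - s) ⊓ v)) (by fun_prop)
      measurable_id

/-- The jump part of the driving process. -/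
def pureJump (t : ℝ≥0) (ω : Ω) : ℝ := ∑ k ∈ Finset.range (S.N t ω), S.mark k ω

theorem pureJump_add_sub (s v : ℝ≥0) (ω : Ω) : S.pureJump (s + v) ω - S.pureJump s ω =
    ∑ k ∈ Finset.Ico (S.N s ω) (S.N (s + v) ω), S.mark k ω := by
  rw [pureJump, pureJump, Finset.sum_Ico_eq_sub _ (S.N_mono ω le_self_add)]

theorem ae_mark_eq : ∀ᵐ ω ∂P, ∀ j k, S.N (S.part j) ω ≤ k → k < S.N (S.part (j + 1)) ω →
    S.mark k ω = S.Z k (S.cellIndex j) ω := by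
  have h : ∀ᵐ ω ∂P, ∀ j, S.arrival (S.N (S.part (j + 1)) ω) ω < S.part (j + 1) :=
    ae_all_iff.2 fun j => S.ae_arrival_lt
      (lt_of_le_of_lt zero_le (S.part_strictMono (Nat.lt_succ_self j)))
  filter_upwards [h] with ω hω j k h1 h2
  refine S.mark_eq ⟨?_, ?_⟩
  · by_contra hc
    have := (S.arrival_le_iff h2).1 (not_le.1 hc).le
    omega
  · exact (S.arrival_mono h2 le_rfl).trans_lt (hω j)

theorem ae_pureJump_increment : ∀ᵐ ω ∂P, ∀ (s v : ℝ≥0) (J : ℕ), s + v ≤ S.part J →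
    S.pureJump (s + v) ω - S.pureJump s ω = S.markedSum J s v
      (fun u => S.N (s + u) ω - S.N s ω) (shiftMarks (S.N s ω) fun i => S.Z i.1 i.2 ω) := by
  filter_upwards [S.ae_mark_eq] with ω hω s v J hJ
  set a : ℕ → ℝ≥0 := fun j => s + (S.part j - s) ⊓ v with ha
  have hN : ∀ {x y : ℝ≥0}, x ≤ y → S.N x ω ≤ S.N y ω := fun h => S.N_mono ω h
  have ham : Monotone a := fun i j hij => by
    simp only [a]
    gcongr
    exact S.part_strictMono.monotone hij
  have ha0 : a 0 = s := by simp [a, S.part_zero]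
  have haJ : a J = s + v := by
    simp only [a]
    rw [inf_eq_right.2 (le_tsub_of_add_le_left hJ)]
  have hsum : ∀ J, ∑ j ∈ Finset.range J, ∑ k ∈ Finset.Ico (S.N (a j) ω) (S.N (a (j + 1)) ω),
      S.mark k ω = ∑ k ∈ Finset.Ico (S.N s ω) (S.N (a J) ω), S.mark k ω := by
    intro J
    induction J with
    | zero => simp [ha0]
    | succ J ih =>
      rw [Finset.sum_range_succ, ih, Finset.sum_Ico_consecutive]
      · exact hN (by rw [← ha0]; exact ham (Nat.zero_le J))
      · exact hN (ham (Nat.le_succ J))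
  rw [S.pureJump_add_sub, ← haJ, ← hsum, markedSum]
  refine Finset.sum_congr rfl fun j _ => ?_
  have hsa : ∀ j, S.N s ω ≤ S.N (a j) ω := fun j => hN (by
    simp only [a]
    exact le_self_add)
  have e := Finset.sum_Ico_add (fun k => S.Z k (S.cellIndex j) ω) (S.N (a j) ω - S.N s ω)
    (S.N (a (j + 1)) ω - S.N s ω) (S.N s ω)
  rw [Nat.sub_add_cancel (hsa j), Nat.sub_add_cancel (hsa (j + 1))] at e
  simp only [shiftMarks]
  rw [e]
  refine Finset.sum_congr rfl fun k hk => ?_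
  obtain ⟨hk1, hk2⟩ := Finset.mem_Ico.1 hk
  have hlt : a j < a (j + 1) := by
    by_contra hc
    have := hN (not_lt.1 hc)
    omega
  have hja : S.part j ≤ a j := by
    simp only [a] at hlt ⊢
    have h1 : S.part j - s < v := by
      by_contra hc
      rw [inf_eq_right.2 (not_lt.1 hc)] at hlt
      exact absurd hlt (not_lt.2 (by gcongr; exact inf_le_right))
    rw [inf_eq_left.2 h1.le]
    exact le_add_tsub
  have hja' : a (j + 1) ≤ S.part (j + 1) := by
    simp only [a] at hlt ⊢
    have h1 : s ≤ S.part (j + 1) := by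
      by_contra hc
      rw [tsub_eq_zero_of_le (not_le.1 hc).le] at hlt
      refine absurd hlt (not_lt.2 ?_)
      gcongr
      exact zero_le
    calc s + (S.part (j + 1) - s) ⊓ v ≤ s + (S.part (j + 1) - s) := by
          gcongr
          exact inf_le_left
      _ = S.part (j + 1) := add_tsub_cancel_of_le h1
  exact hω j k ((hN hja).trans hk1) (hk2.trans_le (hN hja'))

/-- The path of marked sums, with the clock started at time `s`. -/
def markedPath (s : ℝ≥0) (x : (ℝ≥0 → ℕ) × (ℕ × Fin S.l → ℝ)) (v : ℝ≥0) : ℝ :=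
  S.markedSum (S.exists_le_part (s + v)).choose s v x.1 x.2

theorem measurable_markedPath (s : ℝ≥0) : Measurable (S.markedPath s) :=
  measurable_pi_lambda _ fun _ => S.measurable_markedSum _ _ _

theorem ae_pureJump_eq_markedPath (s : ℝ≥0) :
    (fun ω v => S.pureJump (s + v) ω - S.pureJump s ω) =ᵐ[P] fun ω => S.markedPath s
      ((fun u => S.N (s + u) ω - S.N s ω), shiftMarks (S.N s ω) fun i => S.Z i.1 i.2 ω) := by
  filter_upwards [S.ae_pureJump_increment] with ω hω
  funext v
  exact hω s v _ (S.exists_le_part (s + v)).choose_spec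

theorem markedPath_period (m : ℕ) : S.markedPath (m * S.period) = S.markedPath 0 := by
  funext x v
  have h1 := (S.exists_le_part (m * S.period + v)).choose_spec
  have h2 := (S.exists_le_part (0 + v)).choose_spec
  rw [markedPath, markedPath]
  set J := (S.exists_le_part (m * S.period + v)).choose
  set J' := (S.exists_le_part (0 + v)).choose
  rw [S.markedSum_eq_of_le h1 (show J ≤ m * S.l + (J + J') by omega),
    S.markedSum_eq_of_le h2 (show J' ≤ J + J' by omega), S.markedSum_period]

theorem pureJump_zero (ω : Ω) : S.pureJump 0 ω = 0 := by simp [pureJump, S.N_zero]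

theorem ae_pureJump_eq_zero_start :
    (fun ω v => S.pureJump v ω) =ᵐ[P] fun ω => S.markedPath 0
      ((fun u => S.N u ω), fun i => S.Z i.1 i.2 ω) := by
  filter_upwards [S.ae_pureJump_eq_markedPath 0] with ω hω
  have h2 : shiftMarks (S.N 0 ω) (fun i => S.Z i.1 i.2 ω) = fun i => S.Z i.1 i.2 ω := by
    funext i
    simp [shiftMarks, S.N_zero]
  rw [h2] at hω
  simpa [S.pureJump_zero, S.N_zero] using hω

theorem markedPath_truncate {s u : ℝ≥0} (hus : u ≤ s) (n : ℝ≥0 → ℕ) (hn : Monotone n)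
    (z : ℕ × Fin S.l → ℝ) : S.markedPath 0 ((fun x => n (x ⊓ s)), truncMarks (n s) z) u =
      S.markedPath 0 (n, z) u := by
  rw [markedPath, markedPath, markedSum, markedSum]
  refine Finset.sum_congr rfl fun j _ => ?_
  have h : ∀ x : ℝ≥0, x ⊓ u ⊓ s = x ⊓ u := fun x => inf_eq_left.2 (inf_le_right.trans hus)
  simp only [h]
  refine Finset.sum_congr rfl fun k hk => ?_
  have hk' := (Finset.mem_Ico.1 hk).2.trans_le (hn (inf_le_right.trans hus))
  simp [truncMarks, hk']

theorem measurable_marks : Measurable fun ω (i : ℕ × Fin S.l) => S.Z i.1 i.2 ω :=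
  measurable_pi_lambda _ fun i => S.Z_measurable i.1 i.2

section Laws

variable [IsProbabilityMeasure P]

theorem indepFun_past_future_marks (s : ℝ≥0) :
    IndepFun (fun ω => ((fun u : ℝ≥0 => S.N (u ⊓ s) ω),
        truncMarks (S.N s ω) fun i => S.Z i.1 i.2 ω))
      (fun ω => ((fun v : ℝ≥0 => S.N (s + v) ω - S.N s ω),
        shiftMarks (S.N s ω) fun i => S.Z i.1 i.2 ω)) P ∧
    IdentDistrib (fun ω => ((fun v : ℝ≥0 => S.N (s + v) ω - S.N s ω),
        shiftMarks (S.N s ω) fun i => S.Z i.1 i.2 ω))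
      (fun ω => ((fun v : ℝ≥0 => S.N (s + v) ω - S.N s ω), fun i => S.Z i.1 i.2 ω)) P P := by
  have hA : Measurable fun ω (u : ℝ≥0) => S.N (u ⊓ s) ω :=
    measurable_pi_lambda _ fun u => S.N_measurable _
  have hC : Measurable fun ω (v : ℝ≥0) => S.N (s + v) ω - S.N s ω :=
    measurable_pi_lambda _ fun v => (S.N_measurable _).sub (S.N_measurable _)
  have hg : Measurable fun n : ℝ≥0 → ℕ =>
      ((fun u : ℝ≥0 => n (u ⊓ s)), fun v : ℝ≥0 => n (s + v) - n s) := by fun_prop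
  have hACZ := (S.Z_indep_N.comp measurable_id hg).symm
  have hlaw : ∀ m (i : ℕ × Fin S.l),
      IdentDistrib (fun ω => S.Z (m + i.1) i.2 ω) (fun ω => S.Z i.1 i.2 ω) P P := fun m i =>
    ⟨(S.Z_measurable _ _).aemeasurable, (S.Z_measurable _ _).aemeasurable,
      (S.Z_law _ _).map_eq.trans (S.Z_law _ _).map_eq.symm⟩
  have h1 := indepFun_past_future (ν := fun n : ℝ≥0 → ℕ => n s) (measurable_pi_apply s) hA hC
    S.measurable_marks (S.indepFun_N_past_future s) hACZ S.Z_indep hlaw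
  have h2 := identDistrib_future (ν := fun n : ℝ≥0 → ℕ => n s) (measurable_pi_apply s) hA hC
    S.measurable_marks (S.indepFun_N_past_future s) hACZ S.Z_indep hlaw
  simp only [inf_idem] at h1 h2
  exact ⟨h1, h2⟩

/-- The jump part up to time `s` is independent of its increments after `s`. -/
theorem indepFun_pureJump (s : ℝ≥0) :
    IndepFun (fun ω (u : ℝ≥0) => S.pureJump (u ⊓ s) ω)
      (fun ω (v : ℝ≥0) => S.pureJump (s + v) ω - S.pureJump s ω) P := by
  have h := (S.indepFun_past_future_marks s).1.comp
    (φ := fun x u => S.markedPath 0 x (u ⊓ s)) (ψ := S.markedPath s)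
    (measurable_pi_lambda _ fun u => (measurable_pi_apply _).comp (S.measurable_markedPath 0))
    (S.measurable_markedPath s)
  refine h.congr ?_ ?_
  · filter_upwards [S.ae_pureJump_eq_zero_start] with ω hω
    funext u
    simp only [Function.comp]
    rw [S.markedPath_truncate inf_le_right (fun u => S.N u ω) (S.N_mono ω)]
    exact (congrFun hω (u ⊓ s)).symm
  · exact (S.ae_pureJump_eq_markedPath s).symm

/-- The increments of the jump part after a multiple of the period. -/
theorem identDistrib_pureJump (m : ℕ) :
    IdentDistrib (fun ω (v : ℝ≥0) => S.pureJump (m * S.period + v) ω - S.pureJump (m * S.period) ω)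
      (fun ω (v : ℝ≥0) => S.pureJump v ω) P P := by
  have h1 := (S.indepFun_past_future_marks (m * S.period)).2
  have hNZ : IndepFun (fun ω (t : ℝ≥0) => S.N t ω) (fun ω (i : ℕ × Fin S.l) => S.Z i.1 i.2 ω) P :=
    S.Z_indep_N.symm
  have hg : Measurable fun n : ℝ≥0 → ℕ =>
      fun v : ℝ≥0 => n (m * S.period + v) - n (m * S.period) := by fun_prop
  have h2 := (S.identDistrib_N_shift m).prodMk
    (IdentDistrib.refl S.measurable_marks.aemeasurable) (hNZ.comp hg measurable_id) hNZ
  have h := (h1.trans h2).comp (S.measurable_markedPath 0)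
  have hm := S.ae_pureJump_eq_markedPath (m * S.period)
  rw [S.markedPath_period] at hm
  have e1 : AEMeasurable (fun ω (v : ℝ≥0) =>
      S.pureJump (m * S.period + v) ω - S.pureJump (m * S.period) ω) P :=
    h.aemeasurable_fst.congr hm.symm
  have e2 : AEMeasurable (fun ω (v : ℝ≥0) => S.pureJump v ω) P :=
    h.aemeasurable_snd.congr S.ae_pureJump_eq_zero_start.symm
  refine ⟨e1, e2, ?_⟩
  rw [Measure.map_congr hm, Measure.map_congr S.ae_pureJump_eq_zero_start]
  exact h.map_eq

end Laws

end SimpleSemiLevy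

end Compound

/-! ### Norm bounds -/

section Bounds

attribute [local instance] Matrix.linftyOpNormedRing Matrix.linftyOpNormedAlgebra

theorem norm_exp_sub_one_le {q : ℕ} (M : Matrix (Fin q) (Fin q) ℝ) :
    ‖NormedSpace.exp M - 1‖ ≤ Real.exp ‖M‖ - 1 := by
  have h1 := NormedSpace.exp_series_hasSum_exp' (𝕂 := ℝ) M
  have h2 := NormedSpace.exp_series_hasSum_exp' (𝕂 := ℝ) ‖M‖
  rw [← Real.exp_eq_exp_ℝ] at h2
  rw [← hasSum_nat_add_iff' 1] at h1 h2
  simp only [Finset.sum_range_one, Nat.factorial_zero, Nat.cast_one, inv_one, pow_zero,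
    one_smul] at h1 h2
  refine (congrArg norm h1.tsum_eq).symm.le.trans ?_
  refine tsum_of_norm_bounded h2 fun n => ?_
  rw [norm_smul, norm_inv, smul_eq_mul, Real.norm_natCast]
  exact mul_le_mul_of_nonneg_left (norm_pow_le' M (Nat.succ_pos n)) (by positivity)

theorem norm_exp_smul_sub_one_add_one_le {q : ℕ} (B : Matrix (Fin q) (Fin q) ℝ) {a : ℝ}
    (ha : 0 ≤ a) : ‖NormedSpace.exp (a • B) - 1‖ + 1 ≤ Real.exp (‖B‖ * a) := by
  have h := norm_exp_sub_one_le (a • B)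
  rw [norm_smul, Real.norm_of_nonneg ha, mul_comm] at h
  linarith

theorem norm_mul_sub_one_add_one_le {q : ℕ} (A B : Matrix (Fin q) (Fin q) ℝ) :
    ‖A * B - 1‖ + 1 ≤ (‖A - 1‖ + 1) * (‖B - 1‖ + 1) := by
  have e : A * B - 1 = (A - 1) * (B - 1) + (A - 1) + (B - 1) := by noncomm_ring
  rw [e]
  have h1 := norm_add_le ((A - 1) * (B - 1) + (A - 1)) (B - 1)
  have h2 := norm_add_le ((A - 1) * (B - 1)) (A - 1)
  have h3 := norm_mul_le (A - 1) (B - 1)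
  nlinarith

theorem norm_mulVec_le_sub_one {q : ℕ} (A : Matrix (Fin q) (Fin q) ℝ) (y : Fin q → ℝ) :
    ‖A *ᵥ y‖ ≤ (‖A - 1‖ + 1) * ‖y‖ := by
  have e : A *ᵥ y = (A - 1) *ᵥ y + y := by rw [sub_mulVec, one_mulVec]; abel
  rw [e, add_mul, one_mul]
  exact (norm_add_le _ _).trans (by gcongr; exact Matrix.linfty_opNorm_mulVec _ _)

theorem norm_exp_smul_mulVec_le {q : ℕ} (B : Matrix (Fin q) (Fin q) ℝ) {a : ℝ}
    (ha : 0 ≤ a) (y : Fin q → ℝ) :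
    ‖NormedSpace.exp (a • B) *ᵥ y‖ ≤ Real.exp (‖B‖ * a) * ‖y‖ :=
  (norm_mulVec_le_sub_one _ _).trans
    (mul_le_mul_of_nonneg_right (norm_exp_smul_sub_one_add_one_le B ha) (norm_nonneg _))

section Params

variable {p q : ℕ} (θ : Params p q)

/-- A bound for the relative growth of the state at a jump, per unit of squared jump size. -/
def Params.growth : ℝ := θ.α₀ + ∑ i, |θ.α i|

theorem Params.sum_abs_le_growth : ∑ i, |θ.α i| ≤ θ.growth := by
  have := θ.α₀_pos
  rw [Params.growth]
  linarith

theorem Params.growth_pos : 0 < θ.growth :=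
  add_pos_of_pos_of_nonneg θ.α₀_pos (Finset.sum_nonneg fun _ _ => abs_nonneg _)

theorem Params.norm_e_le : ‖θ.e‖ ≤ 1 := by
  rw [pi_norm_le_iff_of_nonneg zero_le_one]
  intro i
  rw [Params.e]
  split_ifs <;> simp

theorem Params.abs_dotProduct_le (y : Fin q → ℝ) : |θ.α ⬝ᵥ y| ≤ (∑ i, |θ.α i|) * ‖y‖ := by
  rw [dotProduct, Finset.sum_mul]
  refine (Finset.abs_sum_le_sum_abs _ _).trans (Finset.sum_le_sum fun i _ => ?_)
  rw [abs_mul]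
  exact mul_le_mul_of_nonneg_left (norm_le_pi_norm y i) (abs_nonneg _)

theorem norm_jumpMap_add_one_le (z : ℝ) (y : Fin q → ℝ) :
    ‖jumpMap θ z y‖ + 1 ≤ (1 + θ.growth * z ^ 2) * (‖y‖ + 1) := by
  have h1 := norm_add_le y ((z ^ 2 * (θ.α₀ + θ.α ⬝ᵥ y)) • θ.e)
  have h2 : ‖(z ^ 2 * (θ.α₀ + θ.α ⬝ᵥ y)) • θ.e‖ ≤ z ^ 2 * (θ.growth * (‖y‖ + 1)) := by
    rw [norm_smul, Real.norm_eq_abs, abs_mul, abs_of_nonneg (sq_nonneg z)]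
    have h3 : |θ.α₀ + θ.α ⬝ᵥ y| ≤ θ.growth * (‖y‖ + 1) := by
      refine (abs_add_le _ _).trans ?_
      rw [abs_of_pos θ.α₀_pos]
      have := θ.abs_dotProduct_le y
      have h4 := θ.α₀_pos
      have h5 : 0 ≤ ∑ i, |θ.α i| := Finset.sum_nonneg fun _ _ => abs_nonneg _
      have h6 := norm_nonneg y
      rw [Params.growth]
      nlinarith
    calc z ^ 2 * |θ.α₀ + θ.α ⬝ᵥ y| * ‖θ.e‖ ≤ z ^ 2 * |θ.α₀ + θ.α ⬝ᵥ y| * 1 := by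
          gcongr
          exact θ.norm_e_le
      _ ≤ z ^ 2 * (θ.growth * (‖y‖ + 1)) := by
          rw [mul_one]
          gcongr
  rw [jumpMap]
  linarith

theorem norm_jumpMap_sub_le (z : ℝ) (y y' : Fin q → ℝ) :
    ‖jumpMap θ z y - jumpMap θ z y'‖ ≤ (1 + θ.growth * z ^ 2) * ‖y - y'‖ := by
  have e : jumpMap θ z y - jumpMap θ z y' =
      (y - y') + (z ^ 2 * (θ.α ⬝ᵥ (y - y'))) • θ.e := by
    rw [jumpMap, jumpMap, dotProduct_sub]
    ext i
    simp
    ring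
  rw [e, add_mul, one_mul]
  refine (norm_add_le _ _).trans (add_le_add le_rfl ?_)
  rw [norm_smul, Real.norm_eq_abs, abs_mul, abs_of_nonneg (sq_nonneg z)]
  calc z ^ 2 * |θ.α ⬝ᵥ (y - y')| * ‖θ.e‖ ≤ z ^ 2 * (θ.growth * ‖y - y'‖) * 1 := by
        have h := (θ.abs_dotProduct_le (y - y')).trans
          (mul_le_mul_of_nonneg_right θ.sum_abs_le_growth (norm_nonneg _))
        have h0 : 0 ≤ θ.growth * ‖y - y'‖ := (abs_nonneg _).trans h
        gcongr
        exact θ.norm_e_le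
    _ = θ.growth * z ^ 2 * ‖y - y'‖ := by ring

theorem norm_mulVec_jumpMap_sub_le (z : ℝ) (E : Matrix (Fin q) (Fin q) ℝ) (w : Fin q → ℝ) :
    ‖E *ᵥ jumpMap θ z w - jumpMap θ z (E *ᵥ w)‖ ≤
      z ^ 2 * (2 * θ.growth * ‖E - 1‖ * (‖w‖ + 1)) := by
  have e : E *ᵥ jumpMap θ z w - jumpMap θ z (E *ᵥ w) =
      z ^ 2 • ((θ.α₀ + θ.α ⬝ᵥ w) • ((E - 1) *ᵥ θ.e) - (θ.α ⬝ᵥ ((E - 1) *ᵥ w)) • θ.e) := by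
    rw [jumpMap, jumpMap, mulVec_add, mulVec_smul, sub_mulVec, sub_mulVec, one_mulVec, one_mulVec,
      dotProduct_sub]
    ext i
    simp
    ring
  rw [e, norm_smul, Real.norm_of_nonneg (sq_nonneg z)]
  refine mul_le_mul_of_nonneg_left ?_ (sq_nonneg z)
  have hw := norm_nonneg w
  have hE := norm_nonneg (E - 1)
  have hA : 0 ≤ ∑ i, |θ.α i| := Finset.sum_nonneg fun _ _ => abs_nonneg _
  have h1 : ‖(θ.α₀ + θ.α ⬝ᵥ w) • ((E - 1) *ᵥ θ.e)‖ ≤ θ.growth * (‖w‖ + 1) * ‖E - 1‖ := by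
    rw [norm_smul]
    have h3 : ‖θ.α₀ + θ.α ⬝ᵥ w‖ ≤ θ.growth * (‖w‖ + 1) := by
      refine (norm_add_le _ _).trans ?_
      rw [Real.norm_of_nonneg θ.α₀_pos.le]
      have h3 := θ.abs_dotProduct_le w
      have h4 := θ.α₀_pos
      rw [Params.growth, Real.norm_eq_abs]
      nlinarith
    refine mul_le_mul h3 ?_ (norm_nonneg _) (mul_nonneg θ.growth_pos.le (by linarith))
    refine (Matrix.linfty_opNorm_mulVec _ _).trans ?_
    exact mul_le_of_le_one_right hE θ.norm_e_le
  have h2 : ‖(θ.α ⬝ᵥ ((E - 1) *ᵥ w)) • θ.e‖ ≤ θ.growth * (‖E - 1‖ * ‖w‖) := by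
    rw [norm_smul]
    refine (mul_le_of_le_one_right (norm_nonneg _) θ.norm_e_le).trans ?_
    refine (θ.abs_dotProduct_le _).trans ?_
    exact mul_le_mul θ.sum_abs_le_growth (Matrix.linfty_opNorm_mulVec _ _) (norm_nonneg _)
      θ.growth_pos.le
  refine (norm_sub_le _ _).trans ((add_le_add h1 h2).trans ?_)
  have := mul_nonneg θ.growth_pos.le hE
  nlinarith

theorem norm_one_add_smul_vecMulVec_sub_one_le (z : ℝ) :
    ‖(1 + z ^ 2 • vecMulVec θ.e θ.α : Matrix (Fin q) (Fin q) ℝ) - 1‖ + 1 ≤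
      1 + θ.growth * z ^ 2 := by
  have h : ‖vecMulVec θ.e θ.α‖ ≤ θ.growth := by
    refine le_trans ?_ θ.sum_abs_le_growth
    rw [Matrix.linfty_opNorm_def]
    have hs : (∑ i, |θ.α i|) = ((∑ i, ‖θ.α i‖₊ : ℝ≥0) : ℝ) := by simp
    rw [hs, NNReal.coe_le_coe]
    refine Finset.sup_le fun i _ => Finset.sum_le_sum fun j _ => ?_
    rw [vecMulVec_apply, nnnorm_mul]
    refine mul_le_of_le_one_left zero_le ?_
    exact_mod_cast (norm_le_pi_norm θ.e i).trans θ.norm_e_le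
  rw [add_sub_cancel_left, norm_smul, Real.norm_of_nonneg (sq_nonneg z)]
  nlinarith [sq_nonneg z]

end Params

section FlowBounds

variable {Ω : Type*} [MeasurableSpace Ω] {P : Measure Ω} (S : SimpleSemiLevy P)
  {p q : ℕ} (θ : Params p q)

theorem jumpTimeAfter_zero (s : ℝ≥0) (ω : Ω) : jumpTimeAfter S s 0 ω = s := by
  simp [jumpTimeAfter]

theorem jumpTimeAfter_succ (s : ℝ≥0) (k : ℕ) (ω : Ω) :
    jumpTimeAfter S s (k + 1) ω = S.arrival (S.N s ω + (k + 1)) ω := by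
  simp [jumpTimeAfter]

theorem jumpTimeAfter_le_succ {s t : ℝ≥0} {k : ℕ} {ω : Ω} (h : S.N s ω + (k + 1) ≤ S.N t ω) :
    jumpTimeAfter S s k ω ≤ jumpTimeAfter S s (k + 1) ω := by
  rw [jumpTimeAfter_succ]
  rcases k with _ | k
  · rw [jumpTimeAfter_zero]
    by_contra hc
    have := (S.arrival_le_iff h).1 (not_le.1 hc).le
    omega
  · rw [jumpTimeAfter_succ]
    exact S.arrival_mono (by omega) h

theorem jumpTimeAfter_le {s t : ℝ≥0} (hst : s ≤ t) {k : ℕ} {ω : Ω}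
    (h : S.N s ω + k ≤ S.N t ω) : jumpTimeAfter S s k ω ≤ t := by
  rcases k with _ | k
  · rwa [jumpTimeAfter_zero]
  · rw [jumpTimeAfter_succ]
    exact S.arrival_le_of_le h

/-- The growth factor of the `k`-th jump. -/
def jumpWeight (k : ℕ) (ω : Ω) : ℝ := 1 + θ.growth * S.mark k ω ^ 2

theorem one_le_jumpWeight (k : ℕ) (ω : Ω) : 1 ≤ jumpWeight S θ k ω := by
  have := mul_nonneg θ.growth_pos.le (sq_nonneg (S.mark k ω))
  rw [jumpWeight]
  linarith

/-- A bound for the growth of the flow from time `s` to time `t`. -/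
def flowBound (s t : ℝ≥0) (ω : Ω) : ℝ :=
  Real.exp (‖θ.B‖ * ((t : ℝ) - s)) * ∏ k ∈ Finset.Ico (S.N s ω) (S.N t ω), jumpWeight S θ k ω

theorem prod_jumpWeight_Ico (s t : ℝ≥0) (ω : Ω) :
    ∏ k ∈ Finset.range (S.N t ω - S.N s ω), jumpWeight S θ (S.N s ω + k) ω =
      ∏ k ∈ Finset.Ico (S.N s ω) (S.N t ω), jumpWeight S θ k ω :=
  (Finset.prod_Ico_eq_prod_range (fun k => jumpWeight S θ k ω) _ _).symm

theorem norm_flow_add_one_le {s t : ℝ≥0} (hst : s ≤ t) (ω : Ω) (y : Fin q → ℝ) :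
    ‖flow S θ s t ω y‖ + 1 ≤ flowBound S θ s t ω * (‖y‖ + 1) := by
  have hexp : ∀ (a : ℝ) (ha : 0 ≤ a) (v : Fin q → ℝ),
      ‖NormedSpace.exp (a • θ.B) *ᵥ v‖ + 1 ≤ Real.exp (‖θ.B‖ * a) * (‖v‖ + 1) := by
    intro a ha v
    have h1 := norm_exp_smul_mulVec_le θ.B ha v
    have h2 := Real.one_le_exp (mul_nonneg (norm_nonneg θ.B) ha)
    linarith
  have hst' := S.N_mono ω hst
  simp only at hst'
  have key : ∀ k, S.N s ω + k ≤ S.N t ω → ‖stateAfter S θ s ω k y‖ + 1 ≤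
      Real.exp (‖θ.B‖ * ((jumpTimeAfter S s k ω : ℝ) - s)) *
        (∏ i ∈ Finset.range k, jumpWeight S θ (S.N s ω + i) ω) * (‖y‖ + 1) := by
    intro k
    induction k with
    | zero =>
      intro _
      simp [stateAfter_zero, jumpTimeAfter_zero]
    | succ k ih =>
      intro hk
      have hT : (0 : ℝ) ≤ (jumpTimeAfter S s (k + 1) ω : ℝ) - jumpTimeAfter S s k ω :=
        sub_nonneg.2 (by exact_mod_cast jumpTimeAfter_le_succ S hk)
      have h1 := ih (by omega)
      have hw := one_le_jumpWeight S θ (S.N s ω + k) ω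
      rw [stateAfter_succ]
      refine (norm_jumpMap_add_one_le θ _ _).trans ?_
      have e : Real.exp (‖θ.B‖ * ((jumpTimeAfter S s (k + 1) ω : ℝ) - s)) =
          Real.exp (‖θ.B‖ * ((jumpTimeAfter S s (k + 1) ω : ℝ) - jumpTimeAfter S s k ω)) *
          Real.exp (‖θ.B‖ * ((jumpTimeAfter S s k ω : ℝ) - s)) := by
        rw [← Real.exp_add]
        ring_nf
      rw [Finset.prod_range_succ, e]
      change jumpWeight S θ (S.N s ω + k) ω * _ ≤ _
      calc _ ≤ jumpWeight S θ (S.N s ω + k) ω *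
            (Real.exp (‖θ.B‖ * ((jumpTimeAfter S s (k + 1) ω : ℝ) - jumpTimeAfter S s k ω)) *
              (‖stateAfter S θ s ω k y‖ + 1)) := by
            gcongr
            exact hexp _ hT _
        _ ≤ jumpWeight S θ (S.N s ω + k) ω *
            (Real.exp (‖θ.B‖ * ((jumpTimeAfter S s (k + 1) ω : ℝ) - jumpTimeAfter S s k ω)) *
              (Real.exp (‖θ.B‖ * ((jumpTimeAfter S s k ω : ℝ) - s)) *
        (∏ i ∈ Finset.range k, jumpWeight S θ (S.N s ω + i) ω) * (‖y‖ + 1))) := by gcongr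
        _ = _ := by ring
  have hN : S.N s ω + (S.N t ω - S.N s ω) ≤ S.N t ω := by omega
  have hT : (0 : ℝ) ≤ (t : ℝ) - jumpTimeAfter S s (S.N t ω - S.N s ω) ω :=
    sub_nonneg.2 (by exact_mod_cast jumpTimeAfter_le S hst hN)
  rw [flow_eq]
  refine (hexp _ hT _).trans ?_
  refine (mul_le_mul_of_nonneg_left (key _ hN) (Real.exp_pos _).le).trans_eq ?_
  rw [prod_jumpWeight_Ico, flowBound, ← mul_assoc, ← mul_assoc, ← Real.exp_add]
  ring_nf

theorem norm_coefJ_sub_one_add_one_le {s t : ℝ≥0} (hst : s ≤ t) (ω : Ω) :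
    ‖coefJ S θ s t ω - 1‖ + 1 ≤ flowBound S θ s t ω := by
  have hst' := S.N_mono ω hst
  simp only at hst'
  have key : ∀ k, S.N s ω + k ≤ S.N t ω → ‖stepProd S θ s ω k - 1‖ + 1 ≤
      Real.exp (‖θ.B‖ * ((jumpTimeAfter S s k ω : ℝ) - s)) *
        (∏ i ∈ Finset.range k, jumpWeight S θ (S.N s ω + i) ω) := by
    intro k
    induction k with
    | zero =>
      intro _
      simp [stepProd, jumpTimeAfter_zero]
    | succ k ih =>
      intro hk
      have hT : (0 : ℝ) ≤ (jumpTimeAfter S s (k + 1) ω : ℝ) - jumpTimeAfter S s k ω :=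
        sub_nonneg.2 (by exact_mod_cast jumpTimeAfter_le_succ S hk)
      have h1 := ih (by omega)
      have e : Real.exp (‖θ.B‖ * ((jumpTimeAfter S s (k + 1) ω : ℝ) - s)) =
          Real.exp (‖θ.B‖ * ((jumpTimeAfter S s (k + 1) ω : ℝ) - jumpTimeAfter S s k ω)) *
          Real.exp (‖θ.B‖ * ((jumpTimeAfter S s k ω : ℝ) - s)) := by
        rw [← Real.exp_add]
        ring_nf
      have h2 : ‖stepMatrix S θ s k ω - 1‖ + 1 ≤ jumpWeight S θ (S.N s ω + k) ω *
          Real.exp (‖θ.B‖ * ((jumpTimeAfter S s (k + 1) ω : ℝ) - jumpTimeAfter S s k ω)) := by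
        rw [stepMatrix]
        refine (norm_mul_sub_one_add_one_le _ _).trans ?_
        exact mul_le_mul (norm_one_add_smul_vecMulVec_sub_one_le θ _)
          (norm_exp_smul_sub_one_add_one_le _ hT) (by positivity)
          (zero_le_one.trans (one_le_jumpWeight S θ _ _))
      rw [stepProd, Finset.prod_range_succ, e]
      refine (norm_mul_sub_one_add_one_le _ _).trans ?_
      refine (mul_le_mul h2 h1 (by positivity) (mul_nonneg
        (zero_le_one.trans (one_le_jumpWeight S θ _ _)) (Real.exp_pos _).le)).trans_eq ?_
      ring
  have hN : S.N s ω + (S.N t ω - S.N s ω) ≤ S.N t ω := by omega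
  have hT : (0 : ℝ) ≤ (t : ℝ) - jumpTimeAfter S s (S.N t ω - S.N s ω) ω :=
    sub_nonneg.2 (by exact_mod_cast jumpTimeAfter_le S hst hN)
  rw [coefJ, lastFlow]
  refine (norm_mul_sub_one_add_one_le _ _).trans ?_
  refine (mul_le_mul (norm_exp_smul_sub_one_add_one_le θ.B hT) (key _ hN) (by positivity)
    (Real.exp_pos _).le).trans_eq ?_
  rw [prod_jumpWeight_Ico, flowBound, ← mul_assoc, ← Real.exp_add]
  ring_nf

theorem one_le_prod_jumpWeight (a b : ℕ) (ω : Ω) :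
    1 ≤ ∏ k ∈ Finset.Ico a b, jumpWeight S θ k ω := by
  refine Finset.prod_induction _ (fun x => 1 ≤ x) (fun x y hx hy => ?_) le_rfl
    fun k _ => one_le_jumpWeight S θ k ω
  nlinarith

theorem flowBound_mono {s t u : ℝ≥0} (hst : s ≤ t) (htu : t ≤ u) (ω : Ω) :
    flowBound S θ s t ω ≤ flowBound S θ s u ω := by
  have htu' : (t : ℝ) ≤ u := htu
  have h0 : 0 ≤ ∏ k ∈ Finset.Ico (S.N s ω) (S.N t ω), jumpWeight S θ k ω :=
    zero_le_one.trans (one_le_prod_jumpWeight S θ _ _ ω)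
  rw [flowBound, flowBound]
  refine mul_le_mul ?_ ?_ h0 (Real.exp_pos _).le
  · gcongr
  · rw [← Finset.prod_Ico_consecutive _ (S.N_mono ω hst) (S.N_mono ω htu)]
    exact le_mul_of_one_le_right h0 (one_le_prod_jumpWeight S θ _ _ ω)

end FlowBounds

end Bounds

/-! ### The flow as a limit of functionals of the increments of the driving process -/

section Grid

variable {p q : ℕ} (θ : Params p q)

/-- The state after `i` steps of the time discretisation with mesh `δ` along the path `x`. -/
def gridState (δ : ℝ≥0) (x : ℝ≥0 → ℝ) (y : Fin q → ℝ) : ℕ → Fin q → ℝ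
  | 0 => y
  | i + 1 => jumpMap θ (x ((i + 1 : ℕ) * δ) - x (i * δ))
      (NormedSpace.exp ((δ : ℝ) • θ.B) *ᵥ gridState δ x y i)

theorem continuous_jumpMap : Continuous fun w : ℝ × (Fin q → ℝ) => jumpMap θ w.1 w.2 := by
  unfold jumpMap
  fun_prop

theorem measurable_gridState (δ : ℝ≥0) (y : Fin q → ℝ) (n : ℕ) :
    Measurable fun x : ℝ≥0 → ℝ => gridState θ δ x y n := by
  induction n with
  | zero => exact measurable_const
  | succ n ih =>
    refine (continuous_jumpMap θ).measurable.comp (Measurable.prodMk (by fun_prop) ?_)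
    exact (continuous_mulVec_const _).measurable.comp ih

/-- The limit of the time discretisations over the interval of length `u`. -/
def gridLimit (u : ℝ≥0) (y : Fin q → ℝ) (x : ℝ≥0 → ℝ) (i : Fin q) : ℝ :=
  limsup (fun n : ℕ => gridState θ (u / (n + 1 : ℕ)) x y (n + 1) i) atTop

theorem measurable_gridLimit (u : ℝ≥0) (y : Fin q → ℝ) : Measurable (gridLimit θ u y) :=
  measurable_pi_lambda _ fun i => Measurable.limsup fun n =>
    (measurable_pi_apply i).comp (measurable_gridState θ (u / (n + 1 : ℕ)) y (n + 1))

/-- The coefficients of the flow over an interval of length `u` as a functional of the increments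
of the driving process. -/
def gridCoef (u : ℝ≥0) (x : ℝ≥0 → ℝ) : (Fin q → Fin q → ℝ) × (Fin q → ℝ) :=
  (fun i j => gridLimit θ u (Pi.single j 1) x i - gridLimit θ u 0 x i, gridLimit θ u 0 x)

theorem measurable_gridCoef (u : ℝ≥0) : Measurable (gridCoef θ u) := by
  have h := measurable_gridLimit θ u
  refine Measurable.prodMk ?_ (h 0)
  refine measurable_pi_lambda _ fun i => measurable_pi_lambda _ fun j => ?_
  exact ((measurable_pi_apply i).comp (h _)).sub ((measurable_pi_apply i).comp (h _))

end Grid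

section GridConvergence

attribute [local instance] Matrix.linftyOpNormedRing Matrix.linftyOpNormedAlgebra

variable {Ω : Type*} [MeasurableSpace Ω] {P : Measure Ω} {S : SimpleSemiLevy P}
  {p q : ℕ} (θ : Params p q)

theorem norm_flow_sub_gridState_le {ω : Ω} (hω : S.SimpleJumps ω) (s δ : ℝ≥0) (y : Fin q → ℝ)
    {n : ℕ} (hn : ∀ i < n, S.N (s + (i + 1 : ℕ) * δ) ω ≤ S.N (s + i * δ) ω + 1) {R : ℝ}
    (hR : ∀ i < n, ‖flow S θ s (s + i * δ) ω y‖ + 1 ≤ R) {i : ℕ} (hi : i ≤ n) :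
    ‖flow S θ s (s + i * δ) ω y -
        gridState θ δ (fun v => S.pureJump (s + v) ω - S.pureJump s ω) y i‖ ≤
      Real.exp (‖θ.B‖ * (i * δ) + θ.growth *
        ∑ k ∈ Finset.Ico (S.N s ω) (S.N (s + i * δ) ω), S.mark k ω ^ 2) *
      (2 * θ.growth * (Real.exp (‖θ.B‖ * δ) - 1) * (Real.exp (‖θ.B‖ * δ) * R) *
        ∑ k ∈ Finset.Ico (S.N s ω) (S.N (s + i * δ) ω), S.mark k ω ^ 2) := by
  set b := ‖θ.B‖ with hb
  set c := θ.growth with hc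
  have hb0 : 0 ≤ b := norm_nonneg _
  have hc0 : 0 < c := θ.growth_pos
  have hδ0 : (0 : ℝ) ≤ δ := δ.2
  set η := Real.exp (b * δ) - 1 with hη
  have hη0 : 0 ≤ η := sub_nonneg.2 (Real.one_le_exp (by positivity))
  set C := 2 * c * η * (Real.exp (b * δ) * R) with hC
  induction i with
  | zero => simp [gridState, flow_of_N_eq]
  | succ i ih =>
    have hi' : i < n := hi
    have ih := ih hi'.le
    have hR0 : 0 ≤ R := le_trans (by positivity) (hR i hi')
    have hC0 : 0 ≤ C := by positivity
    set t := s + i * δ with ht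
    set t' := s + (i + 1 : ℕ) * δ with ht'
    have htt' : t' = t + δ := by
      rw [ht, ht']
      push_cast
      ring
    have hst : s ≤ t := le_self_add
    have hle : t ≤ t' := by rw [htt']; exact le_self_add
    have hNst : S.N s ω ≤ S.N t ω := S.N_mono ω hst
    have hNtt : S.N t ω ≤ S.N t' ω := S.N_mono ω hle
    set yi := flow S θ s t ω y with hyi
    have hflow : flow S θ s t' ω y = flow S θ t t' ω yi := (flow_flow S θ hst hle ω y).symm
    set x : ℝ≥0 → ℝ := fun v => S.pureJump (s + v) ω - S.pureJump s ω with hx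
    have hxi : x ((i + 1 : ℕ) * δ) - x (i * δ) =
        ∑ k ∈ Finset.Ico (S.N t ω) (S.N t' ω), S.mark k ω := by
      rw [htt', ← S.pureJump_add_sub, ← htt']
      simp only [hx, ← ht, ← ht']
      ring
    set gi := gridState θ δ x y i with hgi
    set Q := ∑ k ∈ Finset.Ico (S.N s ω) (S.N t ω), S.mark k ω ^ 2 with hQ
    have hQ0 : 0 ≤ Q := Finset.sum_nonneg fun _ _ => sq_nonneg _
    have hgrid : gridState θ δ x y (i + 1) =
        jumpMap θ (x ((i + 1 : ℕ) * δ) - x (i * δ)) (NormedSpace.exp ((δ : ℝ) • θ.B) *ᵥ gi) := rfl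
    have hsub : ‖NormedSpace.exp ((δ : ℝ) • θ.B) *ᵥ yi - NormedSpace.exp ((δ : ℝ) • θ.B) *ᵥ gi‖ ≤
        Real.exp (b * δ) * ‖yi - gi‖ := by
      rw [← mulVec_sub]
      exact norm_exp_smul_mulVec_le θ.B hδ0 _
    have hcast : ((i + 1 : ℕ) : ℝ) * δ = δ + i * δ := by push_cast; ring
    rcases Nat.lt_or_ge (S.N t ω) (S.N t' ω) with hlt | hge
    · have hN' : S.N t' ω = S.N t ω + 1 := le_antisymm (hn i hi') hlt
      set a := S.arrival (S.N t ω + 1) ω with ha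
      have hNa : S.N a ω = S.N t ω + 1 := hω.N_arrival hlt
      have hat' : a ≤ t' := S.arrival_le_of_le hlt
      have hta : t ≤ a := by
        by_contra hc
        have := S.N_mono ω (not_le.1 hc).le
        simp only at this
        omega
      set z := S.mark (S.N t ω) ω with hz
      have hxz : x ((i + 1 : ℕ) * δ) - x (i * δ) = z := by
        rw [hxi, hN', Finset.sum_Ico_succ_top le_rfl, Finset.Ico_self]
        simp [hz]
      have hQ' : ∑ k ∈ Finset.Ico (S.N s ω) (S.N t' ω), S.mark k ω ^ 2 = Q + z ^ 2 := by
        rw [hN', Finset.sum_Ico_succ_top hNst]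
      have hta' : (t : ℝ) ≤ a := hta
      have hat'' : (a : ℝ) ≤ t + δ := by
        have h : a ≤ t + δ := htt' ▸ hat'
        exact_mod_cast h
      have ht'' : (t' : ℝ) = t + δ := by rw [htt']; push_cast; rfl
      set w := NormedSpace.exp (((a : ℝ) - t) • θ.B) *ᵥ yi with hw
      set E := NormedSpace.exp (((t' : ℝ) - a) • θ.B) with hE
      have hEw : E *ᵥ w = NormedSpace.exp ((δ : ℝ) • θ.B) *ᵥ yi := by
        rw [hE, hw, exp_smul_mulVec_exp_smul_mulVec, ht'']
        congr 3
        ring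
      have hf : flow S θ t t' ω yi = E *ᵥ jumpMap θ z w := by
        rw [← flow_flow S θ hta hat', flow_arrival S θ ha hNa, flow_of_N_eq S θ (hN'.trans hNa.symm)]
      have hEn : ‖E - 1‖ ≤ η := by
        have h1 := norm_exp_smul_sub_one_add_one_le θ.B (a := (t' : ℝ) - a) (by linarith)
        have h2 : Real.exp (b * ((t' : ℝ) - a)) ≤ Real.exp (b * δ) := by
          gcongr
          linarith
        linarith
      have hwn : ‖w‖ + 1 ≤ Real.exp (b * δ) * R := by
        have h1 := norm_exp_smul_mulVec_le θ.B (a := (a : ℝ) - t) (by linarith) yi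
        have h2 : Real.exp (b * ((a : ℝ) - t)) ≤ Real.exp (b * δ) := by
          gcongr
          linarith
        have h3 : 1 ≤ Real.exp (b * δ) := Real.one_le_exp (by positivity)
        have h4 := hR i hi'
        have h5 := norm_nonneg yi
        calc ‖w‖ + 1 ≤ Real.exp (b * δ) * ‖yi‖ + Real.exp (b * δ) := by
              gcongr
              exact h1.trans (by gcongr)
          _ = Real.exp (b * δ) * (‖yi‖ + 1) := by ring
          _ ≤ _ := by gcongr
      rw [hflow, hf, hgrid, hxz, hQ', hcast]
      have h1 := norm_mulVec_jumpMap_sub_le θ z E w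
      have h2 := norm_jumpMap_sub_le θ z (E *ᵥ w) (NormedSpace.exp ((δ : ℝ) • θ.B) *ᵥ gi)
      rw [hEw] at h2
      have h3 := norm_sub_le_norm_sub_add_norm_sub (E *ᵥ jumpMap θ z w)
        (jumpMap θ z (NormedSpace.exp ((δ : ℝ) • θ.B) *ᵥ yi))
        (jumpMap θ z (NormedSpace.exp ((δ : ℝ) • θ.B) *ᵥ gi))
      rw [hEw] at h1
      have h4 : z ^ 2 * (2 * c * ‖E - 1‖ * (‖w‖ + 1)) ≤ z ^ 2 * C := by
        rw [hC]
        gcongr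
      have h5 : 1 + c * z ^ 2 ≤ Real.exp (c * z ^ 2) := by
        rw [add_comm]
        exact Real.add_one_le_exp _
      have h6 : (1 + c * z ^ 2) * ‖NormedSpace.exp ((δ : ℝ) • θ.B) *ᵥ yi -
          NormedSpace.exp ((δ : ℝ) • θ.B) *ᵥ gi‖ ≤
          Real.exp (c * z ^ 2) * (Real.exp (b * δ) * (Real.exp (b * (i * δ) + c * Q) * (C * Q))) := by
        refine mul_le_mul h5 (hsub.trans ?_) (norm_nonneg _) (Real.exp_pos _).le
        gcongr
      have e : Real.exp (b * (δ + i * δ) + c * (Q + z ^ 2)) =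
          Real.exp (c * z ^ 2) * (Real.exp (b * δ) * Real.exp (b * (i * δ) + c * Q)) := by
        rw [← Real.exp_add, ← Real.exp_add]
        ring_nf
      have h7 : 1 ≤ Real.exp (b * (δ + i * δ) + c * (Q + z ^ 2)) :=
        Real.one_le_exp (by positivity)
      calc _ ≤ z ^ 2 * C +
            Real.exp (c * z ^ 2) * (Real.exp (b * δ) * (Real.exp (b * (i * δ) + c * Q) * (C * Q))) :=
            h3.trans (add_le_add (h1.trans h4) (h2.trans h6))
        _ = 1 * (z ^ 2 * C) + Real.exp (b * (δ + i * δ) + c * (Q + z ^ 2)) * (C * Q) := by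
            rw [e]
            ring
        _ ≤ Real.exp (b * (δ + i * δ) + c * (Q + z ^ 2)) * (z ^ 2 * C) +
            Real.exp (b * (δ + i * δ) + c * (Q + z ^ 2)) * (C * Q) := by gcongr
        _ = _ := by ring
    · have hN' : S.N t' ω = S.N t ω := le_antisymm hge hNtt
      have hx0 : x ((i + 1 : ℕ) * δ) - x (i * δ) = 0 := by
        rw [hxi, hN', Finset.Ico_self, Finset.sum_empty]
      have hj0 : ∀ v, jumpMap θ 0 v = v := fun v => by simp [jumpMap]
      have htd : (t' : ℝ) - t = δ := by rw [htt']; push_cast; ring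
      rw [hflow, flow_of_N_eq S θ hN', hgrid, hx0, hj0, hN', htd, hcast]
      refine hsub.trans ((mul_le_mul_of_nonneg_left ih (Real.exp_pos _).le).trans_eq ?_)
      rw [← mul_assoc, ← Real.exp_add, ← hQ]
      ring_nf

theorem SimpleSemiLevy.SimpleJumps.exists_separation {ω : Ω} (hω : S.SimpleJumps ω) (T : ℝ≥0) :
    ∃ δ : ℝ≥0, 0 < δ ∧ ∀ a b, b ≤ T → b < a + δ → S.N b ω ≤ S.N a ω + 1 := by
  have h : ∀ K, K ≤ S.N T ω → ∃ δ : ℝ≥0, 0 < δ ∧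
      ∀ k, k + 2 ≤ K → S.arrival (k + 1) ω + δ ≤ S.arrival (k + 2) ω := by
    intro K
    induction K with
    | zero => exact fun _ => ⟨1, one_pos, fun k hk => by omega⟩
    | succ K ih =>
      intro hK
      obtain ⟨δ, hδ, h⟩ := ih (by omega)
      rcases K with _ | K
      · exact ⟨1, one_pos, fun k hk => by omega⟩
      · have hlt := hω K T hK
        refine ⟨δ ⊓ (S.arrival (K + 2) ω - S.arrival (K + 1) ω),
          lt_inf_iff.2 ⟨hδ, tsub_pos_of_lt hlt⟩, fun k hk => ?_⟩
        rcases Nat.lt_or_ge k K with hkK | hkK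
        · exact (by gcongr; exact inf_le_left : _ ≤ _).trans (h k (by omega))
        · have : k = K := by omega
          subst this
          calc _ ≤ S.arrival (k + 1) ω + (S.arrival (k + 2) ω - S.arrival (k + 1) ω) := by
                gcongr
                exact inf_le_right
            _ = _ := add_tsub_cancel_of_le hlt.le
  obtain ⟨δ, hδ, h⟩ := h _ le_rfl
  refine ⟨δ, hδ, fun a b hb hab => ?_⟩
  by_contra hc
  have h1 : S.N a ω + 2 ≤ S.N b ω := by omega
  have h2 := h (S.N a ω) (h1.trans (S.N_mono ω hb))
  have h3 : S.arrival (S.N a ω + 2) ω ≤ b := S.arrival_le_of_le h1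
  have h4 : a < S.arrival (S.N a ω + 1) ω := by
    by_contra hc'
    have := (S.arrival_le_iff (by omega : S.N a ω + 1 ≤ S.N b ω)).1 (not_lt.1 hc')
    omega
  exact absurd (h2.trans h3) (not_le.2 (hab.trans_le (by gcongr)))

theorem tendsto_gridState {ω : Ω} (hω : S.SimpleJumps ω) (s u : ℝ≥0) (y : Fin q → ℝ) :
    Tendsto (fun n : ℕ => gridState θ (u / (n + 1 : ℕ))
      (fun v => S.pureJump (s + v) ω - S.pureJump s ω) y (n + 1)) atTop
      (𝓝 (flow S θ s (s + u) ω y)) := by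
  set R := flowBound S θ s (s + u) ω * (‖y‖ + 1) with hR
  set Q := ∑ k ∈ Finset.Ico (S.N s ω) (S.N (s + u) ω), S.mark k ω ^ 2 with hQ
  obtain ⟨δ₀, hδ₀, hsep⟩ := hω.exists_separation (s + u)
  have hlim : Tendsto (fun n : ℕ => u / (n + 1 : ℕ)) atTop (𝓝 0) := by
    have := (tendsto_const_div_atTop_nhds_zero_nat (u : ℝ)).comp (tendsto_add_atTop_nat 1)
    rw [← NNReal.tendsto_coe]
    simpa [Function.comp_def] using this
  have hdiv : ∀ n : ℕ, ((n + 1 : ℕ) : ℝ≥0) * (u / (n + 1 : ℕ)) = u := fun n => by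
    field_simp
  rw [tendsto_iff_norm_sub_tendsto_zero]
  have hbound : ∀ᶠ n : ℕ in atTop, ‖gridState θ (u / (n + 1 : ℕ))
      (fun v => S.pureJump (s + v) ω - S.pureJump s ω) y (n + 1) - flow S θ s (s + u) ω y‖ ≤
      Real.exp (‖θ.B‖ * u + θ.growth * Q) *
        (2 * θ.growth * (Real.exp (‖θ.B‖ * (u / (n + 1 : ℕ) : ℝ≥0)) - 1) *
          (Real.exp (‖θ.B‖ * (u / (n + 1 : ℕ) : ℝ≥0)) * R) * Q) := by
    filter_upwards [hlim.eventually (Iio_mem_nhds hδ₀)] with n hn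
    set δ := u / (n + 1 : ℕ) with hδ
    have hle : ∀ i ≤ n + 1, s + i * δ ≤ s + u := by
      intro i hi
      rw [← hdiv n]
      gcongr
    have h := norm_flow_sub_gridState_le θ hω s δ y (n := n + 1) (R := R) ?_ ?_ le_rfl
    · rw [hdiv n] at h
      rw [norm_sub_rev]
      have hcast : ((n + 1 : ℕ) : ℝ) * δ = u := by exact_mod_cast congrArg NNReal.toReal (hdiv n)
      rw [hcast] at h
      exact h
    · intro i hi
      refine hsep _ _ (hle _ hi) ?_
      have : s + ((i + 1 : ℕ) : ℝ≥0) * δ = s + i * δ + δ := by push_cast; ring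
      rw [this]
      gcongr
    · intro i hi
      refine (norm_flow_add_one_le S θ le_self_add ω y).trans ?_
      rw [hR]
      gcongr
      exact flowBound_mono S θ le_self_add (hle i hi.le) ω
  have hz : Tendsto (fun n : ℕ => Real.exp (‖θ.B‖ * u + θ.growth * Q) *
        (2 * θ.growth * (Real.exp (‖θ.B‖ * (u / (n + 1 : ℕ) : ℝ≥0)) - 1) *
          (Real.exp (‖θ.B‖ * (u / (n + 1 : ℕ) : ℝ≥0)) * R) * Q)) atTop (𝓝 0) := by
    have hc : Continuous fun δ : ℝ≥0 => Real.exp (‖θ.B‖ * u + θ.growth * Q) *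
        (2 * θ.growth * (Real.exp (‖θ.B‖ * δ) - 1) * (Real.exp (‖θ.B‖ * δ) * R) * Q) := by
      fun_prop
    have := (hc.tendsto 0).comp hlim
    simpa [Function.comp_def] using this
  exact tendsto_of_tendsto_of_tendsto_of_le_of_le' tendsto_const_nhds hz
    (Eventually.of_forall fun _ => norm_nonneg _) hbound

theorem gridLimit_eq_flow {ω : Ω} (hω : S.SimpleJumps ω) (s u : ℝ≥0) (y : Fin q → ℝ) :
    gridLimit θ u y (fun v => S.pureJump (s + v) ω - S.pureJump s ω) = flow S θ s (s + u) ω y := by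
  funext i
  exact (((tendsto_pi_nhds.1 (tendsto_gridState θ hω s u y)) i)).limsup_eq

theorem gridCoef_eq {ω : Ω} (hω : S.SimpleJumps ω) (s u : ℝ≥0) :
    gridCoef θ u (fun v => S.pureJump (s + v) ω - S.pureJump s ω) =
      ((fun i j => coefJ S θ s (s + u) ω i j), coefK S θ s (s + u) ω) := by
  rw [gridCoef]
  simp only [gridLimit_eq_flow θ hω]
  refine Prod.ext ?_ ?_
  · funext i j
    simp [flow]
  · simp [flow]

end GridConvergence

/-! ### Independence and periodicity of the coefficients -/

section Coefficients

variable {Ω : Type*} [MeasurableSpace Ω] {P : Measure Ω} (S : SimpleSemiLevy P)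
  {p q : ℕ} (θ : Params p q)

/-- The affine map with the given linear part and translation part. -/
def affineApply (c : (Fin q → Fin q → ℝ) × (Fin q → ℝ)) (y : Fin q → ℝ) : Fin q → ℝ :=
  fun i => ∑ j, c.1 i j * y j + c.2 i

theorem measurable_affineApply :
    Measurable fun x : ((Fin q → Fin q → ℝ) × (Fin q → ℝ)) × (Fin q → ℝ) =>
      affineApply x.1 x.2 := by
  unfold affineApply
  fun_prop

/-- The pair of the coefficients of the flow. -/
def coefPair (s t : ℝ≥0) (ω : Ω) : (Fin q → Fin q → ℝ) × (Fin q → ℝ) :=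
  ((fun i j => coefJ S θ s t ω i j), coefK S θ s t ω)

theorem gridState_congr {δ : ℝ≥0} {x x' : ℝ≥0 → ℝ} (y : Fin q → ℝ) {n : ℕ}
    (h : ∀ v ≤ n * δ, x v = x' v) : gridState θ δ x y n = gridState θ δ x' y n := by
  induction n with
  | zero => rfl
  | succ n ih =>
    have hn : (n : ℝ≥0) * δ ≤ (n + 1 : ℕ) * δ := by
      gcongr
      exact Nat.le_succ n
    rw [gridState, gridState, ih fun v hv => h v (hv.trans hn), h _ le_rfl, h _ hn]

theorem gridCoef_stop (u : ℝ≥0) (x : ℝ≥0 → ℝ) :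
    gridCoef θ u (fun v => x (v ⊓ u)) = gridCoef θ u x := by
  have h : ∀ y, gridLimit θ u y (fun v => x (v ⊓ u)) = gridLimit θ u y x := by
    intro y
    funext i
    rw [gridLimit, gridLimit]
    congr 1
    funext n
    rw [gridState_congr θ y (x' := x)]
    intro v hv
    have hdiv : ((n + 1 : ℕ) : ℝ≥0) * (u / (n + 1 : ℕ)) = u := by field_simp
    rw [hdiv] at hv
    rw [inf_eq_left.2 hv]
  rw [gridCoef, gridCoef]
  simp only [h]

theorem ae_coefPair_eq (s : ℝ≥0) : ∀ᵐ ω ∂P, ∀ u, coefPair S θ s (s + u) ω =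
    gridCoef θ u (fun v => S.pureJump (s + v) ω - S.pureJump s ω) := by
  filter_upwards [S.ae_simpleJumps] with ω hω u
  exact (gridCoef_eq θ hω s u).symm

theorem ae_coefPair_zero_eq : ∀ᵐ ω ∂P, ∀ u, coefPair S θ 0 u ω =
    gridCoef θ u (fun v => S.pureJump v ω) := by
  filter_upwards [ae_coefPair_eq S θ 0] with ω hω u
  have := hω u
  simpa [S.pureJump_zero] using this

variable [IsProbabilityMeasure P]

theorem aemeasurable_pureJump_path : AEMeasurable (fun ω (v : ℝ≥0) => S.pureJump v ω) P :=
  (S.identDistrib_pureJump 0).aemeasurable_snd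

theorem aemeasurable_pureJump_increments (s : ℝ≥0) :
    AEMeasurable (fun ω (v : ℝ≥0) => S.pureJump (s + v) ω - S.pureJump s ω) P := by
  have hg : Measurable fun x : ℝ≥0 → ℝ => fun v : ℝ≥0 => x (s + v) - x s := by fun_prop
  exact hg.comp_aemeasurable (aemeasurable_pureJump_path S)

theorem aemeasurable_pureJump_stopped (s : ℝ≥0) :
    AEMeasurable (fun ω (v : ℝ≥0) => S.pureJump (v ⊓ s) ω) P := by
  have hg : Measurable fun x : ℝ≥0 → ℝ => fun v : ℝ≥0 => x (v ⊓ s) := by fun_prop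
  exact hg.comp_aemeasurable (aemeasurable_pureJump_path S)

theorem aemeasurable_coefPair (s u : ℝ≥0) : AEMeasurable (coefPair S θ s (s + u)) P := by
  refine ((measurable_gridCoef θ u).comp_aemeasurable (aemeasurable_pureJump_increments S s)).congr ?_
  filter_upwards [ae_coefPair_eq S θ s] with ω hω
  exact (hω u).symm

theorem identDistrib_coefPair (m : ℕ) (u : ℝ≥0) :
    IdentDistrib (coefPair S θ (m * S.period) (m * S.period + u)) (coefPair S θ 0 u) P P := by
  have h := (S.identDistrib_pureJump m).comp (measurable_gridCoef θ u)
  have e1 : coefPair S θ (m * S.period) (m * S.period + u) =ᵐ[P]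
      gridCoef θ u ∘ fun ω v => S.pureJump (m * S.period + v) ω - S.pureJump (m * S.period) ω := by
    filter_upwards [ae_coefPair_eq S θ (m * S.period)] with ω hω using hω u
  have e2 : coefPair S θ 0 u =ᵐ[P] gridCoef θ u ∘ fun ω v => S.pureJump v ω := by
    filter_upwards [ae_coefPair_zero_eq S θ] with ω hω using hω u
  exact ⟨h.aemeasurable_fst.congr e1.symm, h.aemeasurable_snd.congr e2.symm,
    (Measure.map_congr e1).trans (h.map_eq.trans (Measure.map_congr e2).symm)⟩

theorem indepFun_coefPair (s u : ℝ≥0) :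
    IndepFun (coefPair S θ 0 s) (coefPair S θ s (s + u)) P := by
  have h := (S.indepFun_pureJump s).comp (measurable_gridCoef θ s) (measurable_gridCoef θ u)
  refine h.congr ?_ ?_
  · filter_upwards [ae_coefPair_zero_eq S θ] with ω hω
    rw [hω s]
    exact gridCoef_stop θ s fun v => S.pureJump v ω
  · filter_upwards [ae_coefPair_eq S θ s] with ω hω using (hω u).symm

variable {S θ} {Y : ℝ≥0 → Ω → Fin q → ℝ}

namespace IsStateProcess

theorem indepFun_pureJump_path (hY : IsStateProcess S θ Y) :
    IndepFun (Y 0) (fun ω (v : ℝ≥0) => S.pureJump v ω) P := by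
  have hg : Measurable fun x : ℝ≥0 → ℝ => fun v : ℝ≥0 => x v - S.D v := by fun_prop
  convert! hY.indep_zero.comp measurable_id hg using 1
  funext ω v
  simp [SimpleSemiLevy.proc, SimpleSemiLevy.pureJump]

theorem indepFun_coefPair_zero (hY : IsStateProcess S θ Y) (u u' : ℝ≥0) :
    IndepFun (Y 0) (fun ω => (coefPair S θ 0 u ω, coefPair S θ 0 u' ω)) P := by
  have h := hY.indepFun_pureJump_path.comp measurable_id
    ((measurable_gridCoef θ u).prodMk (measurable_gridCoef θ u'))
  refine h.congr (ae_eq_refl _) ?_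
  filter_upwards [ae_coefPair_zero_eq S θ] with ω hω
  simp [hω u, hω u']

theorem ae_eq_affineApply (hY : IsStateProcess S θ Y) :
    ∀ᵐ ω ∂P, ∀ s u : ℝ≥0, Y (s + u) ω = affineApply (coefPair S θ s (s + u) ω) (Y s ω) := by
  filter_upwards [hY.ae_eq_flow] with ω hω s u
  exact hω s (s + u) le_self_add

theorem aemeasurable (hY : IsStateProcess S θ Y) (t : ℝ≥0) : AEMeasurable (Y t) P := by
  have h := measurable_affineApply.comp_aemeasurable
    ((aemeasurable_coefPair S θ 0 t).prodMk hY.measurable_zero.aemeasurable)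
  refine h.congr ?_
  filter_upwards [hY.ae_eq_affineApply] with ω hω
  have := hω 0 t
  rw [zero_add] at this
  simp [this]

/-- The state at time `s` is independent of the coefficients of the flow after `s`. -/
theorem indepFun_coefPair (hY : IsStateProcess S θ Y) (s u : ℝ≥0) :
    IndepFun (Y s) (coefPair S θ s (s + u)) P := by
  have hg : Measurable fun x : ℝ≥0 → ℝ => ((fun v : ℝ≥0 => x (v ⊓ s)),
      fun v : ℝ≥0 => x (s + v) - x s) := by fun_prop
  have h1 := hY.indepFun_pureJump_path.comp measurable_id hg
  have h2 := indepFun_prodMk_of_indepFun hY.measurable_zero.aemeasurable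
    (aemeasurable_pureJump_stopped S s) (aemeasurable_pureJump_increments S s) h1
    (S.indepFun_pureJump s)
  have hφ : Measurable fun x : (Fin q → ℝ) × (ℝ≥0 → ℝ) =>
      affineApply (gridCoef θ s x.2) x.1 :=
    measurable_affineApply.comp (((measurable_gridCoef θ s).comp measurable_snd).prodMk
      measurable_fst)
  refine (h2.comp hφ (measurable_gridCoef θ u)).congr ?_ ?_
  · filter_upwards [hY.ae_eq_affineApply, ae_coefPair_zero_eq S θ] with ω h3 h4
    have := h3 0 s
    rw [zero_add, h4 s, ← gridCoef_stop] at this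
    exact this.symm
  · filter_upwards [ae_coefPair_eq S θ s] with ω hω using (hω u).symm

/-- If the initial law is invariant under the flow over one period, then so is the law of the state
at multiples of the period. -/
theorem hasLaw_mul_period (hY : IsStateProcess S θ Y) {μ : Measure (Fin q → ℝ)}
    [IsProbabilityMeasure μ] (hμ : IsRecurrenceLaw S θ μ) (h0 : HasLaw (Y 0) μ P) (m : ℕ) :
    HasLaw (Y (m * S.period)) μ P := by
  induction m with
  | zero => simpa using h0
  | succ m ih =>
    have e : ((m + 1 : ℕ) : ℝ≥0) * S.period = m * S.period + S.period := by push_cast; ring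
    rw [e]
    have hind := hY.indepFun_coefPair (m * S.period) S.period
    have hc := identDistrib_coefPair S θ m S.period
    have hmeas : Measurable fun x : (Fin q → ℝ) × ((Fin q → Fin q → ℝ) × (Fin q → ℝ)) =>
        affineApply x.2 x.1 := measurable_affineApply.comp measurable_swap
    refine ⟨hY.aemeasurable _, ?_⟩
    have e1 : Y (m * S.period + S.period) =ᵐ[P] (fun x : (Fin q → ℝ) ×
        ((Fin q → Fin q → ℝ) × (Fin q → ℝ)) => affineApply x.2 x.1) ∘
        fun ω => (Y (m * S.period) ω, coefPair S θ (m * S.period) (m * S.period + S.period) ω) := by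
      filter_upwards [hY.ae_eq_affineApply] with ω hω using hω _ _
    have hcz : AEMeasurable (coefPair S θ 0 S.period) P := hc.aemeasurable_snd
    rw [Measure.map_congr e1, ← AEMeasurable.map_map_of_aemeasurable hmeas.aemeasurable
      (ih.aemeasurable.prodMk hc.aemeasurable_fst),
      (indepFun_iff_map_prod_eq_prod_map_map ih.aemeasurable hc.aemeasurable_fst).1 hind,
      ih.map_eq, hc.map_eq]
    have h2 : (fun x : (Fin q → ℝ) × Ω =>
        coefJ S θ 0 S.period x.2 *ᵥ x.1 + coefK S θ 0 S.period x.2) =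
        (fun x : (Fin q → ℝ) × ((Fin q → Fin q → ℝ) × (Fin q → ℝ)) => affineApply x.2 x.1) ∘
        Prod.map id (coefPair S θ 0 S.period) := rfl
    have h3 := hμ.map_eq
    rw [h2, ← AEMeasurable.map_map_of_aemeasurable hmeas.aemeasurable] at h3
    · have h4 : Measure.map (Prod.map id (coefPair S θ 0 S.period)) (μ.prod P) =
          μ.prod (Measure.map (coefPair S θ 0 S.period) P) := by
        have h5 : Prod.map id (coefPair S θ 0 S.period) =ᵐ[μ.prod P]
            Prod.map id (hcz.mk _) := by
          have := Measure.quasiMeasurePreserving_snd (μ := μ) (ν := P) |>.ae_eq hcz.ae_eq_mk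
          filter_upwards [this] with x hx
          exact Prod.ext rfl hx
        have := Measure.isProbabilityMeasure_map (μ := P) hcz
        rw [Measure.map_congr h5, ← Measure.map_prod_map μ P measurable_id hcz.measurable_mk,
          Measure.map_id, Measure.map_congr hcz.ae_eq_mk.symm]
      rw [h4] at h3
      exact h3
    · exact (measurable_fst.aemeasurable).prodMk
        (hcz.comp_quasiMeasurePreserving Measure.quasiMeasurePreserving_snd)

/-- The law of the state is periodic if the initial law is invariant. -/
theorem identDistrib_add_mul_period (hY : IsStateProcess S θ Y) {μ : Measure (Fin q → ℝ)}
    [IsProbabilityMeasure μ] (hμ : IsRecurrenceLaw S θ μ) (h0 : HasLaw (Y 0) μ P) (m : ℕ)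
    (u : ℝ≥0) : IdentDistrib (Y (m * S.period + u)) (Y u) P P := by
  have hm := hY.hasLaw_mul_period hμ h0 m
  have h1 : IdentDistrib (Y (m * S.period)) (Y 0) P P :=
    ⟨hm.aemeasurable, h0.aemeasurable, hm.map_eq.trans h0.map_eq.symm⟩
  have hind0 := hY.indepFun_coefPair 0 u
  rw [zero_add] at hind0
  have h2 := (h1.prodMk (identDistrib_coefPair S θ m u)
    (hY.indepFun_coefPair (m * S.period) u) hind0).comp
    (measurable_affineApply.comp measurable_swap)
  have e1 : Y (m * S.period + u) =ᵐ[P] fun ω =>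
      affineApply (coefPair S θ (m * S.period) (m * S.period + u) ω) (Y (m * S.period) ω) := by
    filter_upwards [hY.ae_eq_affineApply] with ω hω using hω _ _
  have e2 : Y u =ᵐ[P] fun ω => affineApply (coefPair S θ 0 u ω) (Y 0 ω) := by
    filter_upwards [hY.ae_eq_affineApply] with ω hω
    have := hω 0 u
    rwa [zero_add] at this
  exact ⟨hY.aemeasurable _, hY.aemeasurable _,
    (Measure.map_congr e1).trans (h2.map_eq.trans (Measure.map_congr e2).symm)⟩

end IsStateProcess

end Coefficients

/-! ### Products of independent weights over the points of the counting process -/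

theorem lintegral_pow_poissonMeasure (r : ℝ≥0) {m : ℝ} (hm : 0 ≤ m) :
    ∫⁻ n, ENNReal.ofReal m ^ n ∂poissonMeasure r = ENNReal.ofReal (Real.exp (r * (m - 1))) := by
  have h1 : HasSum (fun n : ℕ => Real.exp (-r) * r ^ n / (n.factorial : ℝ) * m ^ n)
      (Real.exp (r * (m - 1))) := by
    have h := (NormedSpace.expSeries_div_hasSum_exp ((r : ℝ) * m)).mul_left (Real.exp (-r))
    rw [← Real.exp_eq_exp_ℝ, ← Real.exp_add] at h
    convert! h using 2
    · rw [mul_pow]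
      ring
    · ring
  rw [poissonMeasure, lintegral_sum_measure, ← h1.tsum_eq, ENNReal.ofReal_tsum_of_nonneg
    (fun n => by positivity) h1.summable]
  refine tsum_congr fun n => ?_
  rw [lintegral_smul_measure, lintegral_dirac, smul_eq_mul, ENNReal.ofReal_mul (by positivity),
    ENNReal.ofReal_pow hm]

theorem measurable_prod_Ico {ι R : Type*} [CommMonoid R] [MeasurableSpace R] [MeasurableMul₂ R]
    {w : (ι → ℝ) → R} (hw : Measurable w) : Measurable fun x : (ℕ × ℕ) × (ℕ × ι → ℝ) =>
      ∏ k ∈ Finset.Ico x.1.1 x.1.2, w fun r => x.2 (k, r) :=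
  measurable_from_prod_countable_right fun n => Finset.measurable_fun_prod (Finset.Ico n.1 n.2)
    fun k _ => hw.comp (measurable_pi_lambda (fun (x : ℕ × ι → ℝ) r => x (k, r)) fun r =>
      measurable_pi_apply (k, r))

section RowProducts

variable {Ω : Type*} [MeasurableSpace Ω] {P : Measure Ω} (S : SimpleSemiLevy P)
  [IsProbabilityMeasure P]

namespace SimpleSemiLevy

/-- The candidate sizes of the `(k+1)`-st jump. -/
def row (k : ℕ) (ω : Ω) : Fin S.l → ℝ := fun r => S.Z k r ω

theorem measurable_row (k : ℕ) : Measurable (S.row k) :=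
  measurable_pi_lambda _ fun r => S.Z_measurable k r

theorem identDistrib_row (k : ℕ) : IdentDistrib (S.row k) (S.row 0) P P := by
  have hinj : ∀ k : ℕ, Function.Injective fun r : Fin S.l => (k, r) := fun k a b h =>
    (Prod.mk.inj h).2
  exact IdentDistrib.pi (fun r => ⟨(S.Z_measurable k r).aemeasurable,
    (S.Z_measurable 0 r).aemeasurable, (S.Z_law _ _).map_eq.trans (S.Z_law _ _).map_eq.symm⟩)
    (S.Z_indep.precomp (hinj k)) (S.Z_indep.precomp (hinj 0))

theorem lintegral_prod_row {w : (Fin S.l → ℝ) → ℝ≥0∞} (hw : Measurable w) {a b : ℕ} (hab : a ≤ b) :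
    ∫⁻ ω, ∏ k ∈ Finset.Ico a b, w (S.row k ω) ∂P = (∫⁻ ω, w (S.row 0 ω) ∂P) ^ (b - a) := by
  induction b, hab using Nat.le_induction with
  | base => simp
  | succ b hab ih =>
    have h := (indepFun_truncMarks_shiftMarks S.measurable_marks S.Z_indep b).comp
      (φ := fun z => ∏ k ∈ Finset.Ico a b, w fun r => z (k, r)) (ψ := fun z => w fun r => z (0, r))
      (by fun_prop) (by fun_prop)
    have e : ∀ ω, ∏ k ∈ Finset.Ico a b, w (S.row k ω) =
        ((fun z : ℕ × Fin S.l → ℝ => ∏ k ∈ Finset.Ico a b, w fun r => z (k, r)) ∘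
          fun ω => truncMarks b fun i => S.Z i.1 i.2 ω) ω := by
      intro ω
      refine Finset.prod_congr rfl fun k hk => ?_
      have := (Finset.mem_Ico.1 hk).2
      simp only [truncMarks, this, if_true]
      rfl
    simp_rw [Finset.prod_Ico_succ_top hab]
    have hbd : ∫⁻ ω, w (S.row b ω) ∂P = ∫⁻ ω, w (S.row 0 ω) ∂P :=
      ((S.identDistrib_row b).comp hw).lintegral_eq
    have hp : AEMeasurable ((fun z : ℕ × Fin S.l → ℝ => ∏ k ∈ Finset.Ico a b, w fun r => z (k, r)) ∘
        fun ω => truncMarks b fun i => S.Z i.1 i.2 ω) P :=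
      (Measurable.comp (by fun_prop) ((measurable_truncMarks b).comp
        S.measurable_marks)).aemeasurable
    have hq : AEMeasurable (fun ω => w (S.row b ω)) P := (hw.comp (S.measurable_row b)).aemeasurable
    rw [Nat.sub_add_comm hab, pow_succ, ← ih, ← hbd]
    simp_rw [e]
    exact lintegral_mul_eq_lintegral_mul_lintegral_of_indepFun'' hp hq h

theorem lintegral_prod_row_N {w : (Fin S.l → ℝ) → ℝ≥0∞} (hw : Measurable w) {s t : ℝ≥0}
    (hst : s ≤ t) : ∫⁻ ω, ∏ k ∈ Finset.Ico (S.N s ω) (S.N t ω), w (S.row k ω) ∂P =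
      ∫⁻ ω, (∫⁻ ω, w (S.row 0 ω) ∂P) ^ (S.N t ω - S.N s ω) ∂P := by
  have hg : Measurable fun n : ℝ≥0 → ℕ => (n s, n t) := by fun_prop
  have hind := (S.Z_indep_N.comp measurable_id hg).symm
  have hN : Measurable fun ω => (S.N s ω, S.N t ω) := (S.N_measurable s).prodMk (S.N_measurable t)
  have hG : Measurable fun x : (ℕ × ℕ) × (ℕ × Fin S.l → ℝ) =>
      ∏ k ∈ Finset.Ico x.1.1 x.1.2, w fun r => x.2 (k, r) :=
    measurable_prod_Ico hw
  have hlaw := (indepFun_iff_map_prod_eq_prod_map_map hN.aemeasurable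
    S.measurable_marks.aemeasurable).1 hind
  have e1 : ∫⁻ ω, ∏ k ∈ Finset.Ico (S.N s ω) (S.N t ω), w (S.row k ω) ∂P =
      ∫⁻ x, ∏ k ∈ Finset.Ico x.1.1 x.1.2, w (fun r => x.2 (k, r))
        ∂(P.map fun ω => ((S.N s ω, S.N t ω), fun i : ℕ × Fin S.l => S.Z i.1 i.2 ω)) := by
    rw [lintegral_map hG (hN.prodMk S.measurable_marks)]
    rfl
  have : IsProbabilityMeasure (P.map fun ω => (fun i : ℕ × Fin S.l => S.Z i.1 i.2 ω)) :=
    Measure.isProbabilityMeasure_map S.measurable_marks.aemeasurable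
  have e3 := congrArg (fun ν => ∫⁻ x, ∏ k ∈ Finset.Ico x.1.1 x.1.2, w (fun r => x.2 (k, r)) ∂ν) hlaw
  refine e1.trans (e3.trans ?_)
  rw [lintegral_prod _ hG.aemeasurable, lintegral_map hG.lintegral_prod_right' hN]
  refine lintegral_congr fun ω => ?_
  rw [← S.lintegral_prod_row hw (S.N_mono ω hst)]
  exact lintegral_map (hG.comp measurable_prodMk_left) S.measurable_marks

theorem lintegral_prod_row_N_eq {w : (Fin S.l → ℝ) → ℝ} (hw : Measurable w) (hw0 : ∀ x, 0 ≤ w x)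
    (hint : Integrable (fun ω => w (S.row 0 ω)) P) {s t : ℝ≥0} (hst : s ≤ t) :
    ∫⁻ ω, ENNReal.ofReal (∏ k ∈ Finset.Ico (S.N s ω) (S.N t ω), w (S.row k ω)) ∂P =
      ENNReal.ofReal (Real.exp ((S.cum t - S.cum s) * (∫ ω, w (S.row 0 ω) ∂P - 1))) := by
  simp_rw [ENNReal.ofReal_prod_of_nonneg fun k _ => hw0 _]
  rw [S.lintegral_prod_row_N (w := fun x => ENNReal.ofReal (w x)) (by fun_prop) hst,
    ← ofReal_integral_eq_lintegral_ofReal hint (ae_of_all _ fun ω => hw0 _)]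
  have h := (S.hasLaw_increment hst).lintegral_comp
    (f := fun n => ENNReal.ofReal (∫ ω, w (S.row 0 ω) ∂P) ^ n) (by fun_prop)
  rw [h, lintegral_pow_poissonMeasure _ (integral_nonneg fun ω => hw0 _),
    Real.coe_toNNReal _ (sub_nonneg.2 (S.cum_mono hst))]

theorem measurable_prod_row_N {w : (Fin S.l → ℝ) → ℝ} (hw : Measurable w) (s t : ℝ≥0) :
    Measurable fun ω => ∏ k ∈ Finset.Ico (S.N s ω) (S.N t ω), w (S.row k ω) := by
  have hG : Measurable fun x : (ℕ × ℕ) × (ℕ × Fin S.l → ℝ) =>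
      ∏ k ∈ Finset.Ico x.1.1 x.1.2, w fun r => x.2 (k, r) :=
    measurable_prod_Ico hw
  exact hG.comp (((S.N_measurable s).prodMk (S.N_measurable t)).prodMk S.measurable_marks)

theorem integrable_prod_row_N {w : (Fin S.l → ℝ) → ℝ} (hw : Measurable w) (hw0 : ∀ x, 0 ≤ w x)
    (hint : Integrable (fun ω => w (S.row 0 ω)) P) {s t : ℝ≥0} (hst : s ≤ t) :
    Integrable (fun ω => ∏ k ∈ Finset.Ico (S.N s ω) (S.N t ω), w (S.row k ω)) P := by
  refine ⟨(S.measurable_prod_row_N hw s t).aestronglyMeasurable, ?_⟩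
  rw [hasFiniteIntegral_iff_ofReal (ae_of_all _ fun ω => Finset.prod_nonneg fun k _ => hw0 _),
    S.lintegral_prod_row_N_eq hw hw0 hint hst]
  exact ENNReal.ofReal_lt_top

theorem integral_prod_row_N {w : (Fin S.l → ℝ) → ℝ} (hw : Measurable w) (hw0 : ∀ x, 0 ≤ w x)
    (hint : Integrable (fun ω => w (S.row 0 ω)) P) {s t : ℝ≥0} (hst : s ≤ t) :
    ∫ ω, ∏ k ∈ Finset.Ico (S.N s ω) (S.N t ω), w (S.row k ω) ∂P =
      Real.exp ((S.cum t - S.cum s) * (∫ ω, w (S.row 0 ω) ∂P - 1)) := by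
  rw [integral_eq_lintegral_of_nonneg_ae
    (ae_of_all _ fun ω => Finset.prod_nonneg fun k _ => hw0 _)
    (S.measurable_prod_row_N hw s t).aestronglyMeasurable,
    S.lintegral_prod_row_N_eq hw hw0 hint hst, ENNReal.toReal_ofReal (Real.exp_pos _).le]

end SimpleSemiLevy

end RowProducts

/-! ### Moments of the jump sizes that occur -/

section ActiveMoments

variable {Ω : Type*} [MeasurableSpace Ω] {P : Measure Ω} (S : SimpleSemiLevy P)

namespace SimpleSemiLevy

/-- The counting process charges the `(r+1)`-st cell of the period. -/
def Active (r : Fin S.l) : Prop := S.cum (S.part r) < S.cum (S.part (r + 1))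

open scoped Classical in
/-- The sum of the squares of the candidate jump sizes for the cells that are charged. -/
def activeSq (x : Fin S.l → ℝ) : ℝ := ∑ r, if S.Active r then x r ^ 2 else 0

theorem activeSq_nonneg (x : Fin S.l → ℝ) : 0 ≤ S.activeSq x :=
  Finset.sum_nonneg fun r _ => by split_ifs <;> positivity

theorem sq_le_activeSq {r : Fin S.l} (hr : S.Active r) (x : Fin S.l → ℝ) :
    x r ^ 2 ≤ S.activeSq x := by
  classical
  have := Finset.single_le_sum (f := fun r => if S.Active r then x r ^ 2 else 0)
    (fun r _ => by split_ifs <;> positivity) (Finset.mem_univ r)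
  simpa [hr, activeSq] using this

theorem measurable_activeSq : Measurable S.activeSq := by
  refine Finset.measurable_fun_sum _ fun r _ => ?_
  split_ifs <;> fun_prop

theorem active_cellIndex {j : ℕ} (hj : S.cum (S.part j) < S.cum (S.part (j + 1))) :
    S.Active (S.cellIndex j) := by
  have e : j = S.cellIndex j + j / S.l * S.l := by
    rw [mul_comm]
    exact (Nat.mod_add_div j S.l).symm
  have e1 : S.part j = (j / S.l : ℕ) * S.period + S.part (S.cellIndex j) := by
    rw [add_comm, ← S.part_add_mul, ← e]
  have e2 : S.part (j + 1) = (j / S.l : ℕ) * S.period + S.part (S.cellIndex j + 1) := by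
    rw [add_comm (((j / S.l : ℕ) : ℝ≥0) * _), ← S.part_add_mul, add_right_comm, ← e]
  have h := S.cum_periodic (j / S.l)
    (S.part_strictMono.monotone (Nat.le_succ (S.cellIndex j : ℕ)))
  rw [← sub_pos, e1, e2] at hj
  rw [Active, ← sub_pos, ← h]
  exact hj

theorem ae_sq_mark_le : ∀ᵐ ω ∂P, ∀ k t, k < S.N t ω →
    S.mark k ω ^ 2 ≤ S.activeSq (S.row k ω) := by
  have h : ∀ᵐ ω ∂P, ∀ j, S.cum (S.part (j + 1)) = S.cum (S.part j) →
      S.N (S.part (j + 1)) ω = S.N (S.part j) ω := by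
    refine ae_all_iff.2 fun j => ?_
    by_cases hj : S.cum (S.part (j + 1)) = S.cum (S.part j)
    · filter_upwards [S.ae_N_eq (S.part_strictMono.monotone (Nat.le_succ j)) hj] with ω hω _
        using hω
    · exact ae_of_all _ fun ω h => absurd h hj
  filter_upwards [h, S.ae_mark_eq] with ω h1 h2 k t hk
  classical
  have hex : ∃ j, k < S.N (S.part j) ω := by
    obtain ⟨j, hj⟩ := S.exists_le_part t
    exact ⟨j, hk.trans_le (S.N_mono ω hj)⟩
  obtain ⟨j, hj⟩ : ∃ j, Nat.find hex = j + 1 := by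
    refine Nat.exists_eq_succ_of_ne_zero fun h0 => ?_
    have := Nat.find_spec hex
    rw [h0, S.part_zero, S.N_zero] at this
    omega
  have hspec := Nat.find_spec hex
  have hmin := Nat.find_min hex (m := j) (by omega)
  rw [hj] at hspec
  rw [h2 j k (not_lt.1 hmin) hspec]
  refine S.sq_le_activeSq (S.active_cellIndex (lt_of_le_of_ne
    (S.cum_mono (S.part_strictMono.monotone (Nat.le_succ j))) fun hc => ?_)) (S.row k ω)
  have := h1 j hc.symm
  omega

theorem integrable_Z_sq (k : ℕ) (r : Fin S.l) : Integrable (fun ω => S.Z k r ω ^ 2) P := by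
  have h := S.F_sq r
  rw [← (S.Z_law k r).map_eq] at h
  exact h.comp_aemeasurable (S.Z_measurable k r).aemeasurable

theorem integrable_activeSq : Integrable (fun ω => S.activeSq (S.row 0 ω)) P := by
  refine integrable_finsetSum _ fun r _ => ?_
  split_ifs
  · exact S.integrable_Z_sq 0 r
  · exact integrable_zero _ _ _

variable [IsProbabilityMeasure P]

theorem measure_first_point_pos {r : Fin S.l} (hr : S.Active r) :
    0 < P {ω | S.N (S.part r) ω = 0 ∧ S.N (S.part (r + 1)) ω - S.N (S.part r) ω = 1} := by
  have hle : S.part r ≤ S.part (r + 1) := S.part_strictMono.monotone (Nat.le_succ _)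
  have hind := (S.indepFun_N_past_future (S.part r)).comp
    (measurable_pi_apply (S.part r)) (measurable_pi_apply (S.part (r + 1) - S.part r))
  have h := hind.measure_inter_preimage_eq_mul {0} {1} (measurableSet_singleton _)
    (measurableSet_singleton _)
  have e : {ω | S.N (S.part r) ω = 0 ∧ S.N (S.part (r + 1)) ω - S.N (S.part r) ω = 1} =
      {ω | S.N (S.part r) ω - S.N 0 ω ∈ ({0} : Set ℕ)} ∩
      {ω | S.N (S.part (r + 1)) ω - S.N (S.part r) ω ∈ ({1} : Set ℕ)} := by
    ext ω
    simp [S.N_zero]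
  have h' : P ({ω | S.N (S.part r) ω - S.N 0 ω ∈ ({0} : Set ℕ)} ∩
      {ω | S.N (S.part (r + 1)) ω - S.N (S.part r) ω ∈ ({1} : Set ℕ)}) =
      P {ω | S.N (S.part r) ω - S.N 0 ω ∈ ({0} : Set ℕ)} *
      P {ω | S.N (S.part (r + 1)) ω - S.N (S.part r) ω ∈ ({1} : Set ℕ)} := by
    convert! h using 3 <;>
    · ext ω
      simp [S.N_zero, add_tsub_cancel_of_le hle]
  have h0 := (S.hasLaw_increment (zero_le (a := S.part r))).measure_eq (p := fun n => n ∈ ({0} : Set ℕ))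
    (measurableSet_singleton _)
  have h1 := (S.hasLaw_increment hle).measure_eq (p := fun n => n ∈ ({1} : Set ℕ))
    (measurableSet_singleton _)
  rw [e, h', h0, h1]
  have hpos : 0 < (S.cum (S.part (r + 1)) - S.cum (S.part r)).toNNReal :=
    Real.toNNReal_pos.2 (sub_pos.2 hr)
  refine ENNReal.mul_pos ?_ ?_
  · change poissonMeasure _ {0} ≠ 0
    rw [poissonMeasure_singleton]
    have : (0 : ℝ) < Real.exp (-(S.cum (S.part r) - S.cum 0).toNNReal) := Real.exp_pos _
    simpa using this
  · change poissonMeasure _ {1} ≠ 0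
    rw [poissonMeasure_singleton]
    have h2 := Real.exp_pos (-(S.cum (S.part (r + 1)) - S.cum (S.part r)).toNNReal : ℝ)
    have h3 : (0 : ℝ) < (S.cum (S.part (r + 1)) - S.cum (S.part r)).toNNReal := by exact_mod_cast hpos
    have h4 := mul_pos h2 h3
    rw [ne_eq, ENNReal.ofReal_eq_zero, not_le]
    simpa using h4

/-- Fourth moments of the process are passed on to the jump sizes that occur. -/
theorem integrable_Z_pow_four (h4 : ∀ t, Integrable (fun ω => S.proc t ω ^ 4) P) {r : Fin S.l}
    (hr : S.Active r) : Integrable (fun ω => S.Z 0 r ω ^ 4) P := by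
  set d := S.D (S.part (r + 1)) with hd
  set A : Set (ℕ × ℕ) := {x | x.1 = 0 ∧ x.2 - x.1 = 1} with hA
  have hg : Measurable fun n : ℝ≥0 → ℕ => A.indicator (fun _ => (1 : ℝ))
      (n (S.part r), n (S.part (r + 1))) :=
    (measurable_const.indicator .of_discrete).comp (by fun_prop)
  have hN : Measurable fun ω (t : ℝ≥0) => S.N t ω := measurable_pi_lambda _ S.N_measurable
  have hf : Measurable fun z : ℕ × Fin S.l → ℝ => (d + z (0, r)) ^ 4 := by fun_prop
  have hind := S.Z_indep_N.symm.comp hg hf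
  have hX := (hg.comp hN).aestronglyMeasurable (μ := P)
  have hY := (hf.comp S.measurable_marks).aestronglyMeasurable (μ := P)
  have h1 : Integrable (fun ω => (d + S.Z 0 r ω) ^ 4) P := by
    refine hind.integrable_right_of_integrable_op (fun x y : ℝ => x * y) 1 one_ne_zero
      (fun x y => by simp [enorm_mul]) ?_ hX hY ?_
    · refine (h4 (S.part (r + 1))).mono (hX.mul hY) ?_
      filter_upwards [S.ae_mark_eq] with ω hω
      simp only [Function.comp]
      by_cases h : (S.N (S.part r) ω, S.N (S.part (r + 1)) ω) ∈ A
      · have h' : S.N (S.part r) ω = 0 ∧ S.N (S.part (r + 1)) ω - S.N (S.part r) ω = 1 := h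
        have hN1 : S.N (S.part (r + 1)) ω = 1 := by omega
        have hm := hω r 0 (by omega) (by omega)
        have hc : S.cellIndex r = r := by
          ext
          simp [cellIndex, Nat.mod_eq_of_lt r.2]
        rw [hc] at hm
        rw [indicator_of_mem h, one_mul, proc, hN1, Finset.sum_range_one, hm]
      · rw [indicator_of_notMem h, zero_mul, norm_zero]
        exact norm_nonneg _
    · intro h0
      have hpos := S.measure_first_point_pos hr
      refine hpos.ne' (measure_mono_null ?_ (ae_iff.1 h0))
      intro ω hω
      have : (S.N (S.part r) ω, S.N (S.part (r + 1)) ω) ∈ A := hω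
      simp [this]
  refine ((h1.add (integrable_const (d ^ 4))).const_mul 8).mono
    ((S.Z_measurable 0 r).pow_const 4).aestronglyMeasurable (ae_of_all _ fun ω => ?_)
  rw [Real.norm_of_nonneg (by positivity), Pi.add_apply, Real.norm_of_nonneg (by positivity)]
  have e1 : S.Z 0 r ω ^ 2 ≤ 2 * ((d + S.Z 0 r ω) ^ 2 + d ^ 2) := by
    nlinarith [sq_nonneg (2 * d + S.Z 0 r ω)]
  have e2 : (S.Z 0 r ω ^ 2) ^ 2 ≤ (2 * ((d + S.Z 0 r ω) ^ 2 + d ^ 2)) ^ 2 :=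
    pow_le_pow_left₀ (sq_nonneg _) e1 2
  nlinarith [sq_nonneg ((d + S.Z 0 r ω) ^ 2 - d ^ 2)]

theorem memLp_activeSq (h4 : ∀ t, Integrable (fun ω => S.proc t ω ^ 4) P) :
    MemLp (fun ω => S.activeSq (S.row 0 ω)) 2 P := by
  refine memLp_finsetSum _ fun r _ => ?_
  split_ifs with hr
  · refine (memLp_two_iff_integrable_sq
      ((S.Z_measurable 0 r).pow_const 2).aestronglyMeasurable).2 ?_
    simpa [← pow_mul] using S.integrable_Z_pow_four h4 hr
  · exact MemLp.zero

end SimpleSemiLevy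

end ActiveMoments

/-! ### Moments of the coefficients and of the state -/

theorem memLp_mul_of_indepFun {Ω : Type*} [MeasurableSpace Ω]
    {P : Measure Ω} {X Y : Ω → ℝ} {r : ℝ≥0∞} (hr0 : r ≠ 0) (hr : r ≠ ∞) (h : IndepFun X Y P)
    (hX : MemLp X r P) (hY : MemLp Y r P) : MemLp (fun ω => X ω * Y ω) r P := by
  refine (integrable_norm_rpow_iff (f := fun ω => X ω * Y ω) (hX.1.mul hY.1) hr0 hr).1 ?_
  have hX' := (integrable_norm_rpow_iff hX.1 hr0 hr).2 hX
  have hY' := (integrable_norm_rpow_iff hY.1 hr0 hr).2 hY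
  have hm : Measurable fun x : ℝ => ‖x‖ ^ r.toReal := by fun_prop
  refine ((h.comp hm hm).integrable_mul hX' hY').congr (ae_of_all _ fun ω => ?_)
  simp [Real.mul_rpow]

section CoefficientMoments

attribute [local instance] Matrix.linftyOpNormedRing Matrix.linftyOpNormedAlgebra

theorem sum_abs_le_linfty_opNorm {q : ℕ} (M : Matrix (Fin q) (Fin q) ℝ) (i : Fin q) :
    ∑ j, |M i j| ≤ ‖M‖ := by
  rw [Matrix.linfty_opNorm_def]
  have h := Finset.le_sup (f := fun i => ∑ j, ‖M i j‖₊) (Finset.mem_univ i)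
  have h' : ((∑ j, ‖M i j‖₊ : ℝ≥0) : ℝ) ≤ (Finset.univ.sup fun i => ∑ j, ‖M i j‖₊ : ℝ≥0) := by
    exact_mod_cast h
  simpa using h'

variable {Ω : Type*} [MeasurableSpace Ω] {P : Measure Ω} (S : SimpleSemiLevy P)
  {p q : ℕ} (θ : Params p q)

/-- A bound for the growth factor of a jump, in terms of the candidate jump sizes. -/
def rowWeight (x : Fin S.l → ℝ) : ℝ := 1 + θ.growth * S.activeSq x

theorem rowWeight_nonneg (x : Fin S.l → ℝ) : 0 ≤ rowWeight S θ x :=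
  add_nonneg zero_le_one (mul_nonneg θ.growth_pos.le (S.activeSq_nonneg x))

theorem measurable_rowWeight : Measurable (rowWeight S θ) :=
  (S.measurable_activeSq.const_mul _).const_add _

/-- A bound for the growth of the flow, in terms of the candidate jump sizes. -/
def rowBound (s t : ℝ≥0) (ω : Ω) : ℝ :=
  Real.exp (‖θ.B‖ * ((t : ℝ) - s)) *
    ∏ k ∈ Finset.Ico (S.N s ω) (S.N t ω), rowWeight S θ (S.row k ω)

theorem ae_flowBound_le : ∀ᵐ ω ∂P, ∀ s t, flowBound S θ s t ω ≤ rowBound S θ s t ω := by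
  filter_upwards [S.ae_sq_mark_le] with ω hω s t
  refine mul_le_mul_of_nonneg_left (Finset.prod_le_prod
    (fun k _ => zero_le_one.trans (one_le_jumpWeight S θ k ω)) fun k hk => ?_) (Real.exp_pos _).le
  have := mul_le_mul_of_nonneg_left (hω k t (Finset.mem_Ico.1 hk).2) θ.growth_pos.le
  rw [jumpWeight, rowWeight]
  linarith

variable [IsProbabilityMeasure P]

theorem measurable_rowBound (s t : ℝ≥0) : Measurable (rowBound S θ s t) :=
  (S.measurable_prod_row_N (measurable_rowWeight S θ) s t).const_mul _

/-- The mean growth exponent of the flow over the time interval from zero. -/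
def growthExponent (t : ℝ≥0) : ℝ :=
  ‖θ.B‖ * t + S.cum t * (∫ ω, rowWeight S θ (S.row 0 ω) ∂P - 1)

theorem continuous_growthExponent : Continuous (growthExponent S θ) :=
  (NNReal.continuous_coe.const_mul _).add (S.cum_continuous.mul_const _)

theorem integrable_rowWeight : Integrable (fun ω => rowWeight S θ (S.row 0 ω)) P :=
  (integrable_const 1).add (S.integrable_activeSq.const_mul _)

theorem integrable_rowBound {s t : ℝ≥0} (hst : s ≤ t) : Integrable (rowBound S θ s t) P :=
  (S.integrable_prod_row_N (measurable_rowWeight S θ) (rowWeight_nonneg S θ)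
    (integrable_rowWeight S θ) hst).const_mul _

theorem integral_rowBound {s t : ℝ≥0} (hst : s ≤ t) : ∫ ω, rowBound S θ s t ω ∂P =
    Real.exp (growthExponent S θ t - growthExponent S θ s) := by
  unfold rowBound
  rw [integral_const_mul, S.integral_prod_row_N (measurable_rowWeight S θ) (rowWeight_nonneg S θ)
    (integrable_rowWeight S θ) hst, ← Real.exp_add, growthExponent, growthExponent]
  ring_nf

theorem memLp_two_rowBound (h4 : ∀ t, Integrable (fun ω => S.proc t ω ^ 4) P) {s t : ℝ≥0}
    (hst : s ≤ t) : MemLp (rowBound S θ s t) 2 P := by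
  have hw : MemLp (fun ω => rowWeight S θ (S.row 0 ω)) 2 P := by
    have h1 : MemLp (fun ω => θ.growth * S.activeSq (S.row 0 ω)) 2 P :=
      (S.memLp_activeSq h4).const_mul _
    exact (memLp_const (1 : ℝ)).add h1
  have hw2 : Integrable (fun ω => rowWeight S θ (S.row 0 ω) ^ 2) P := hw.integrable_sq
  have h := S.integrable_prod_row_N (w := fun x => rowWeight S θ x ^ 2)
    ((measurable_rowWeight S θ).pow_const 2) (fun x => sq_nonneg _) hw2 hst
  replace h := h.const_mul (Real.exp (‖θ.B‖ * ((t : ℝ) - s)) ^ 2)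
  rw [memLp_two_iff_integrable_sq (measurable_rowBound S θ s t).aestronglyMeasurable]
  refine h.congr (ae_of_all _ fun ω => ?_)
  simp only [rowBound]
  rw [mul_pow, Finset.prod_pow]

theorem aemeasurable_coefJ (s u : ℝ≥0) (i j : Fin q) :
    AEMeasurable (fun ω => coefJ S θ s (s + u) ω i j) P :=
  (show Measurable fun x : (Fin q → Fin q → ℝ) × (Fin q → ℝ) => x.1 i j by fun_prop).comp_aemeasurable
    (aemeasurable_coefPair S θ s u)

theorem aemeasurable_coefK (s u : ℝ≥0) : AEMeasurable (coefK S θ s (s + u)) P :=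
  measurable_snd.comp_aemeasurable (aemeasurable_coefPair S θ s u)

theorem ae_sum_abs_coefJ_sub_one_le (s u : ℝ≥0) : ∀ᵐ ω ∂P, ∀ i,
    ∑ j, |coefJ S θ s (s + u) ω i j - (1 : Matrix (Fin q) (Fin q) ℝ) i j| + 1 ≤
      rowBound S θ s (s + u) ω := by
  filter_upwards [ae_flowBound_le S θ] with ω hω i
  have h1 := sum_abs_le_linfty_opNorm (coefJ S θ s (s + u) ω - 1) i
  have h2 := norm_coefJ_sub_one_add_one_le S θ (le_self_add (a := s) (b := u)) ω
  have h3 := hω s (s + u)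
  simp only [Matrix.sub_apply] at h1
  linarith

theorem memLp_coefJ {r : ℝ≥0∞} {s u : ℝ≥0} (h : MemLp (rowBound S θ s (s + u)) r P)
    (i j : Fin q) : MemLp (fun ω => coefJ S θ s (s + u) ω i j) r P := by
  refine h.mono (aemeasurable_coefJ S θ s u i j).aestronglyMeasurable ?_
  filter_upwards [ae_sum_abs_coefJ_sub_one_le S θ s u] with ω hω
  have h1 := hω i
  have h2 : |coefJ S θ s (s + u) ω i j - (1 : Matrix (Fin q) (Fin q) ℝ) i j| ≤
      ∑ j, |coefJ S θ s (s + u) ω i j - (1 : Matrix (Fin q) (Fin q) ℝ) i j| :=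
    Finset.single_le_sum (f := fun j =>
      |coefJ S θ s (s + u) ω i j - (1 : Matrix (Fin q) (Fin q) ℝ) i j|)
      (fun j _ => abs_nonneg _) (Finset.mem_univ j)
  have h3 : |(1 : Matrix (Fin q) (Fin q) ℝ) i j| ≤ 1 := by
    rw [Matrix.one_apply]
    split_ifs <;> simp
  have h4 := abs_sub_abs_le_abs_sub (coefJ S θ s (s + u) ω i j) ((1 : Matrix (Fin q) (Fin q) ℝ) i j)
  rw [Real.norm_eq_abs, Real.norm_eq_abs]
  refine le_trans ?_ (le_abs_self _)
  linarith

theorem memLp_coefK {r : ℝ≥0∞} {s u : ℝ≥0} (h : MemLp (rowBound S θ s (s + u)) r P) :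
    MemLp (coefK S θ s (s + u)) r P := by
  refine h.mono (aemeasurable_coefK S θ s u).aestronglyMeasurable ?_
  filter_upwards [ae_flowBound_le S θ] with ω hω
  have h1 := norm_flow_add_one_le S θ (le_self_add (a := s) (b := u)) ω 0
  have h2 := hω s (s + u)
  rw [flow, mulVec_zero, zero_add, norm_zero, zero_add, mul_one] at h1
  rw [Real.norm_eq_abs]
  refine le_trans ?_ (le_abs_self _)
  linarith

theorem integrable_coefJ (s u : ℝ≥0) (i j : Fin q) :
    Integrable (fun ω => coefJ S θ s (s + u) ω i j) P :=
  memLp_one_iff_integrable.1 (memLp_coefJ S θ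
    (memLp_one_iff_integrable.2 (integrable_rowBound S θ le_self_add)) i j)

theorem integrable_coefK (s u : ℝ≥0) : Integrable (coefK S θ s (s + u)) P :=
  memLp_one_iff_integrable.1 (memLp_coefK S θ
    (memLp_one_iff_integrable.2 (integrable_rowBound S θ le_self_add)))

namespace IsStateProcess

variable {S θ} {Y : ℝ≥0 → Ω → Fin q → ℝ}

theorem memLp (hY : IsStateProcess S θ Y) {r : ℝ≥0∞} (hr0 : r ≠ 0) (hr : r ≠ ∞)
    (h0 : MemLp (Y 0) r P) {t : ℝ≥0} (h : MemLp (rowBound S θ 0 t) r P) : MemLp (Y t) r P := by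
  rw [← zero_add t] at h
  refine MemLp.of_eval fun i => ?_
  have h1 : MemLp (fun ω => ∑ j, coefJ S θ 0 (0 + t) ω i j * Y 0 ω j + coefK S θ 0 (0 + t) ω i)
      r P := by
    refine MemLp.add (memLp_finsetSum _ fun j _ => ?_) ((memLp_coefK S θ h).eval i)
    have hind := (hY.indepFun_coefPair 0 t).comp (measurable_pi_apply j)
      (show Measurable fun x : (Fin q → Fin q → ℝ) × (Fin q → ℝ) => x.1 i j by fun_prop)
    exact memLp_mul_of_indepFun hr0 hr hind.symm (memLp_coefJ S θ h i j) (h0.eval j)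
  refine h1.ae_eq ?_
  filter_upwards [hY.ae_eq_affineApply] with ω hω
  have := congrFun (hω 0 t) i
  rw [zero_add] at this
  rw [this, zero_add]
  rfl

theorem integrable (hY : IsStateProcess S θ Y) (h0 : Integrable (Y 0) P) (t : ℝ≥0) :
    Integrable (Y t) P :=
  memLp_one_iff_integrable.1 (hY.memLp one_ne_zero ENNReal.one_ne_top
    (memLp_one_iff_integrable.2 h0) (memLp_one_iff_integrable.2 (integrable_rowBound S θ zero_le)))

theorem memLp_two (hY : IsStateProcess S θ Y) (h0 : MemLp (Y 0) 2 P)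
    (h4 : ∀ t, Integrable (fun ω => S.proc t ω ^ 4) P) (t : ℝ≥0) : MemLp (Y t) 2 P :=
  hY.memLp two_ne_zero ENNReal.ofNat_ne_top h0 (memLp_two_rowBound S θ h4 zero_le)

end IsStateProcess

end CoefficientMoments

/-! ### The mean matrices of the flow -/

section MeanFlow

variable {Ω : Type*} [MeasurableSpace Ω] {P : Measure Ω} (S : SimpleSemiLevy P)
  {p q : ℕ} (θ : Params p q)

theorem coefJ_mul_coefJ {s t u : ℝ≥0} (hst : s ≤ t) (htu : t ≤ u) (ω : Ω) :
    coefJ S θ t u ω * coefJ S θ s t ω = coefJ S θ s u ω := by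
  refine Matrix.mulVec_injective (funext fun y => ?_)
  have h1 := flow_flow S θ hst htu ω y
  have h0 := flow_flow S θ hst htu ω 0
  simp only [flow, mulVec_zero, zero_add] at h1 h0
  rw [← h0, mulVec_add, add_assoc] at h1
  rw [← mulVec_mulVec]
  exact add_right_cancel h1

variable [IsProbabilityMeasure P]

theorem meanMat_coefJ_mul (s u : ℝ≥0) :
    meanMat P (coefJ S θ s (s + u)) * meanMat P (coefJ S θ 0 s) =
      meanMat P (coefJ S θ 0 (s + u)) := by
  have hint : ∀ s u i j, Integrable (fun ω => coefJ S θ s (s + u) ω i j) P :=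
    integrable_coefJ S θ
  have h0 : ∀ j k, Integrable (fun ω => coefJ S θ 0 s ω j k) P := fun j k => by
    simpa using hint 0 s j k
  have hind : ∀ i j k, IndepFun (fun ω => coefJ S θ s (s + u) ω i j)
      (fun ω => coefJ S θ 0 s ω j k) P := fun i j k =>
    ((indepFun_coefPair S θ s u).comp
      (show Measurable fun x : (Fin q → Fin q → ℝ) × (Fin q → ℝ) => x.1 j k by fun_prop)
      (show Measurable fun x : (Fin q → Fin q → ℝ) × (Fin q → ℝ) => x.1 i j by fun_prop)).symm
  ext i k
  simp only [meanMat, Matrix.mul_apply, Matrix.of_apply]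
  simp_rw [← coefJ_mul_coefJ S θ (zero_le (a := s)) (le_self_add (a := s) (b := u)),
    Matrix.mul_apply]
  have hmul : ∀ j, Integrable (fun ω => coefJ S θ s (s + u) ω i j * coefJ S θ 0 s ω j k) P :=
    fun j => (hind i j k).integrable_mul (hint s u i j) (h0 j k)
  rw [integral_finsetSum _ fun j _ => hmul j]
  exact Finset.sum_congr rfl fun j _ => ((hind i j k).integral_fun_mul_eq_mul_integral
    (hint s u i j).1 (h0 j k).1).symm

theorem meanMat_coefJ_mul_of_le {s t : ℝ≥0} (hst : s ≤ t) :
    meanMat P (coefJ S θ s t) * meanMat P (coefJ S θ 0 s) = meanMat P (coefJ S θ 0 t) := by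
  have h := meanMat_coefJ_mul S θ s (t - s)
  rwa [add_tsub_cancel_of_le hst] at h

theorem meanMat_coefJ_periodic (m : ℕ) (u : ℝ≥0) :
    meanMat P (coefJ S θ (m * S.period) (m * S.period + u)) = meanMat P (coefJ S θ 0 u) := by
  ext i j
  exact ((identDistrib_coefPair S θ m u).comp
    (show Measurable fun x : (Fin q → Fin q → ℝ) × (Fin q → ℝ) => x.1 i j by fun_prop)).integral_eq

theorem det_meanMat_coefJ_ne_zero_of_lt {s u : ℝ≥0}
    (h : growthExponent S θ (s + u) - growthExponent S θ s < Real.log 2) :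
    (meanMat P (coefJ S θ s (s + u))).det ≠ 0 := by
  refine det_ne_zero_of_sum_row_lt_diag fun k => ?_
  have hint : ∀ j, Integrable (fun ω => coefJ S θ s (s + u) ω k j -
      (1 : Matrix (Fin q) (Fin q) ℝ) k j) P := fun j =>
    (integrable_coefJ S θ s u k j).sub (integrable_const _)
  have h1 : ∀ j, |meanMat P (coefJ S θ s (s + u)) k j - (1 : Matrix (Fin q) (Fin q) ℝ) k j| ≤
      ∫ ω, |coefJ S θ s (s + u) ω k j - (1 : Matrix (Fin q) (Fin q) ℝ) k j| ∂P := by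
    intro j
    have := abs_integral_le_integral_abs (μ := P) (f := fun ω => coefJ S θ s (s + u) ω k j -
      (1 : Matrix (Fin q) (Fin q) ℝ) k j)
    rwa [integral_sub (integrable_coefJ S θ s u k j) (integrable_const _), integral_const,
      probReal_univ, one_smul] at this
  have h2 : ∑ j, |meanMat P (coefJ S θ s (s + u)) k j - (1 : Matrix (Fin q) (Fin q) ℝ) k j| < 1 := by
    refine (Finset.sum_le_sum fun j _ => h1 j).trans_lt ?_
    rw [← integral_finsetSum _ fun j _ => (hint j).abs]
    have h3 : ∫ ω, ∑ j, |coefJ S θ s (s + u) ω k j - (1 : Matrix (Fin q) (Fin q) ℝ) k j| ∂P ≤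
        ∫ ω, (rowBound S θ s (s + u) ω - 1) ∂P := by
      refine integral_mono_ae (integrable_finsetSum _ fun j _ => (hint j).abs)
        ((integrable_rowBound S θ le_self_add).sub (integrable_const _)) ?_
      filter_upwards [ae_sum_abs_coefJ_sub_one_le S θ s u] with ω hω
      exact le_sub_iff_add_le.2 (hω k)
    rw [integral_sub (integrable_rowBound S θ le_self_add) (integrable_const _),
      integral_rowBound S θ le_self_add, integral_const, probReal_univ, one_smul] at h3
    have h4 := Real.exp_lt_exp.2 h
    rw [Real.exp_log two_pos] at h4
    linarith
  rw [← Finset.add_sum_erase _ _ (Finset.mem_univ k), Matrix.one_apply_eq] at h2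
  have h5 : ∑ j ∈ Finset.univ.erase k,
      |meanMat P (coefJ S θ s (s + u)) k j - (1 : Matrix (Fin q) (Fin q) ℝ) k j| =
      ∑ j ∈ Finset.univ.erase k, ‖meanMat P (coefJ S θ s (s + u)) k j‖ := by
    refine Finset.sum_congr rfl fun j hj => ?_
    rw [Matrix.one_apply_ne (Finset.ne_of_mem_erase hj).symm, sub_zero, Real.norm_eq_abs]
  rw [h5] at h2
  have h6 := abs_sub_abs_le_abs_sub 1 (meanMat P (coefJ S θ s (s + u)) k k)
  rw [abs_one, abs_sub_comm] at h6
  rw [Real.norm_eq_abs (meanMat P (coefJ S θ s (s + u)) k k)]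
  linarith

/-- The mean matrices of the flow are invertible. -/
theorem isUnit_det_meanMat_coefJ (t : ℝ≥0) : IsUnit (meanMat P (coefJ S θ 0 t)).det := by
  rw [isUnit_iff_ne_zero]
  obtain ⟨n, hn, hgrid⟩ := exists_grid (continuous_growthExponent S θ) t (Real.log_pos one_lt_two)
  have key : ∀ i ≤ n, (meanMat P (coefJ S θ 0 ((i : ℝ≥0) * t / n))).det ≠ 0 := by
    intro i
    induction i with
    | zero =>
      intro _
      have h := det_meanMat_coefJ_ne_zero_of_lt S θ (s := 0) (u := 0) (by simp [Real.log_pos])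
      simpa using h
    | succ i ih =>
      intro hi
      have hle : (i : ℝ≥0) * t / n ≤ ((i + 1 : ℕ) : ℝ≥0) * t / n := by
        gcongr
        exact Nat.le_succ i
      have h1 := hgrid i hi
      rw [← add_tsub_cancel_of_le hle] at h1 ⊢
      rw [← meanMat_coefJ_mul, det_mul]
      exact mul_ne_zero (det_meanMat_coefJ_ne_zero_of_lt S θ h1) (ih (by omega))
  have h := key n le_rfl
  rwa [mul_div_cancel_left₀ _ (by exact_mod_cast hn.ne')] at h

theorem meanMat_coefJ_add_mul_period (m : ℕ) (u : ℝ≥0) :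
    meanMat P (coefJ S θ 0 (u + m * S.period)) =
      meanMat P (coefJ S θ 0 u) * meanMat P (coefJ S θ 0 S.period) ^ m := by
  have h0 : ∀ m : ℕ, meanMat P (coefJ S θ 0 (m * S.period + u)) =
      meanMat P (coefJ S θ 0 u) * meanMat P (coefJ S θ 0 (m * S.period)) := fun m => by
    rw [← meanMat_coefJ_mul, meanMat_coefJ_periodic]
  have h1 : ∀ m : ℕ, meanMat P (coefJ S θ 0 (m * S.period)) =
      meanMat P (coefJ S θ 0 S.period) ^ m := by
    intro m
    induction m with
    | zero =>
      have h := meanMat_coefJ_mul S θ 0 S.period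
      rw [zero_add] at h
      have hu : IsUnit (meanMat P (coefJ S θ 0 S.period)) :=
        (Matrix.isUnit_iff_isUnit_det _).2 (isUnit_det_meanMat_coefJ S θ _)
      simpa using hu.mul_left_cancel (h.trans (mul_one _).symm)
    | succ m ih =>
      have e : ((m + 1 : ℕ) : ℝ≥0) * S.period = m * S.period + S.period := by push_cast; ring
      rw [e, ← meanMat_coefJ_mul, meanMat_coefJ_periodic, ih, pow_succ']
  rw [add_comm, h0, h1]

/-- The mean matrix between two times in terms of the times modulo the period. -/
theorem meanMat_coefJ_eq_zpow {t h t₁ t₂ : ℝ≥0} {m n : ℕ} (ht₁ : t₁ ≤ S.period)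
    (ht : t = t₁ + m * S.period) (hth : t + h = t₂ + n * S.period) :
    meanMat P (coefJ S θ t (t + h)) = meanMat P (coefJ S θ 0 t₂) *
      meanMat P (coefJ S θ 0 S.period) ^ ((n : ℤ) - m - 1) *
      meanMat P (coefJ S θ t₁ S.period) := by
  have hA := isUnit_det_meanMat_coefJ S θ S.period
  have h1 := meanMat_coefJ_mul S θ t h
  have hu : IsUnit (meanMat P (coefJ S θ 0 t)) :=
    (Matrix.isUnit_iff_isUnit_det _).2 (isUnit_det_meanMat_coefJ S θ t)
  have e1 : meanMat P (coefJ S θ 0 t) = meanMat P (coefJ S θ 0 t₁) *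
      meanMat P (coefJ S θ 0 S.period) ^ m := by rw [ht, meanMat_coefJ_add_mul_period]
  have e2 : meanMat P (coefJ S θ 0 (t + h)) = meanMat P (coefJ S θ 0 t₂) *
      meanMat P (coefJ S θ 0 S.period) ^ n := by rw [hth, meanMat_coefJ_add_mul_period]
  refine hu.mul_right_cancel (h1.trans ?_)
  rw [e1, e2, Matrix.mul_assoc, ← Matrix.mul_assoc (meanMat P (coefJ S θ t₁ S.period)),
    meanMat_coefJ_mul_of_le S θ ht₁, Matrix.mul_assoc]
  congr 1
  rw [← pow_succ', ← zpow_natCast, ← zpow_natCast, ← Matrix.zpow_add hA]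
  congr 1
  push_cast
  ring

end MeanFlow

/-! ### Mean and covariance of the state -/

theorem covariance_congr_ae {Ω : Type*} [MeasurableSpace Ω] {P : Measure Ω} {X X' U U' : Ω → ℝ}
    (hX : X =ᵐ[P] X') (hU : U =ᵐ[P] U') : covariance X U P = covariance X' U' P := by
  rw [covariance, covariance, integral_congr_ae hX, integral_congr_ae hU]
  refine integral_congr_ae ?_
  filter_upwards [hX, hU] with ω h1 h2
  rw [h1, h2]

/-- The covariance of products of independent pairs. -/
theorem covariance_mul_mul {Ω : Type*} [MeasurableSpace Ω] {P : Measure Ω} [IsProbabilityMeasure P]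
    {X X' U U' : Ω → ℝ} (h : IndepFun (fun ω => (X ω, X' ω)) (fun ω => (U ω, U' ω)) P)
    (hX : MemLp X 2 P) (hX' : MemLp X' 2 P) (hU : MemLp U 2 P) (hU' : MemLp U' 2 P) :
    covariance (fun ω => X ω * U ω) (fun ω => X' ω * U' ω) P =
      (∫ ω, X ω * X' ω ∂P) * (∫ ω, U ω * U' ω ∂P) -
        (∫ ω, X ω ∂P) * (∫ ω, U ω ∂P) * ((∫ ω, X' ω ∂P) * ∫ ω, U' ω ∂P) := by
  have h1 : IndepFun X U P := h.comp measurable_fst measurable_fst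
  have h2 : IndepFun X' U' P := h.comp measurable_snd measurable_snd
  have hm : Measurable fun x : ℝ × ℝ => x.1 * x.2 := by fun_prop
  have h3 : IndepFun (fun ω => X ω * X' ω) (fun ω => U ω * U' ω) P := h.comp hm hm
  have e : ∫ ω, X ω * U ω * (X' ω * U' ω) ∂P =
      (∫ ω, X ω * X' ω ∂P) * (∫ ω, U ω * U' ω ∂P) := by
    rw [← h3.integral_fun_mul_eq_mul_integral (hX.1.mul hX'.1) (hU.1.mul hU'.1)]
    exact integral_congr_ae (ae_of_all _ fun ω => mul_mul_mul_comm _ _ _ _)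
  rw [covariance_eq_sub (memLp_mul_of_indepFun two_ne_zero ENNReal.ofNat_ne_top h1 hX hU)
    (memLp_mul_of_indepFun two_ne_zero ENNReal.ofNat_ne_top h2 hX' hU'),
    h1.integral_fun_mul_eq_mul_integral hX.1 hU.1, h2.integral_fun_mul_eq_mul_integral hX'.1 hU'.1]
  congr 1

section StateMoments

variable {Ω : Type*} [MeasurableSpace Ω] {P : Measure Ω} {S : SimpleSemiLevy P}
  {p q : ℕ} {θ : Params p q} {Y : ℝ≥0 → Ω → Fin q → ℝ}

/-- The `i`-th row of the coefficients of an affine map, with the translation part at `none`. -/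
def affineRow (c : (Fin q → Fin q → ℝ) × (Fin q → ℝ)) (i : Fin q) : Option (Fin q) → ℝ
  | none => c.2 i
  | some j => c.1 i j

/-- A vector extended by the coordinate `1` at `none`. -/
def extendOne (y : Fin q → ℝ) : Option (Fin q) → ℝ
  | none => 1
  | some j => y j

theorem affineApply_eq_sum (c : (Fin q → Fin q → ℝ) × (Fin q → ℝ)) (y : Fin q → ℝ) (i : Fin q) :
    affineApply c y i = ∑ o, affineRow c i o * extendOne y o := by
  simp [affineApply, Fintype.sum_option, affineRow, extendOne, add_comm]

theorem measurable_affineRow (i : Fin q) (o : Option (Fin q)) :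
    Measurable fun c : (Fin q → Fin q → ℝ) × (Fin q → ℝ) => affineRow c i o := by
  cases o <;> simp only [affineRow] <;> fun_prop

theorem measurable_extendOne (o : Option (Fin q)) :
    Measurable fun y : Fin q → ℝ => extendOne y o := by
  cases o <;> simp only [extendOne] <;> fun_prop

variable [IsProbabilityMeasure P]

theorem memLp_extendOne {r : ℝ≥0∞} {X : Ω → Fin q → ℝ} (h : MemLp X r P) (o : Option (Fin q)) :
    MemLp (fun ω => extendOne (X ω) o) r P := by
  cases o
  · exact memLp_const 1
  · exact h.eval _

variable (S θ) in
theorem memLp_affineRow {r : ℝ≥0∞} {s u : ℝ≥0} (h : MemLp (rowBound S θ s (s + u)) r P) (i : Fin q)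
    (o : Option (Fin q)) : MemLp (fun ω => affineRow (coefPair S θ s (s + u) ω) i o) r P := by
  cases o
  · exact (memLp_coefK S θ h).eval i
  · exact memLp_coefJ S θ h i _

namespace IsStateProcess

theorem ae_eq_sum (hY : IsStateProcess S θ Y) (s u : ℝ≥0) (i : Fin q) :
    (fun ω => Y (s + u) ω i) =ᵐ[P]
      fun ω => ∑ o, affineRow (coefPair S θ s (s + u) ω) i o * extendOne (Y s ω) o := by
  filter_upwards [hY.ae_eq_affineApply] with ω hω
  rw [← affineApply_eq_sum, hω]

theorem meanVec_eq (hY : IsStateProcess S θ Y) (h0 : Integrable (Y 0) P) (u : ℝ≥0) :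
    meanVec P (Y u) = meanMat P (coefJ S θ 0 u) *ᵥ meanVec P (Y 0) + meanVec P (coefK S θ 0 u) := by
  funext i
  have h := hY.ae_eq_sum 0 u i
  have hc : ∀ o, Integrable (fun ω => affineRow (coefPair S θ 0 (0 + u) ω) i o) P := fun o =>
    memLp_one_iff_integrable.1 (memLp_affineRow S θ (memLp_one_iff_integrable.2
      (integrable_rowBound S θ le_self_add)) i o)
  have hy : ∀ o, Integrable (fun ω => extendOne (Y 0 ω) o) P := fun o =>
    memLp_one_iff_integrable.1 (memLp_extendOne (memLp_one_iff_integrable.2 h0) o)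
  have hind : ∀ o, IndepFun (fun ω => affineRow (coefPair S θ 0 (0 + u) ω) i o)
      (fun ω => extendOne (Y 0 ω) o) P := fun o =>
    ((hY.indepFun_coefPair 0 u).comp (measurable_extendOne o) (measurable_affineRow i o)).symm
  have hmul : ∀ o, Integrable (fun ω => affineRow (coefPair S θ 0 (0 + u) ω) i o *
      extendOne (Y 0 ω) o) P := fun o => (hind o).integrable_mul (hc o) (hy o)
  have e := integral_congr_ae h
  rw [integral_finsetSum _ fun o _ => hmul o] at e
  simp_rw [fun o => (hind o).integral_fun_mul_eq_mul_integral (hc o).1 (hy o).1] at e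
  rw [Fintype.sum_option] at e
  simp only [zero_add, affineRow, extendOne, integral_const, probReal_univ, one_smul, mul_one] at e
  rw [meanVec, e, add_comm]
  rfl

theorem covMat_add_self (hY : IsStateProcess S θ Y) (h0 : MemLp (Y 0) 2 P)
    (h4 : ∀ t, Integrable (fun ω => S.proc t ω ^ 4) P) (s u : ℝ≥0) :
    covMat P (Y (s + u)) (Y s) = meanMat P (coefJ S θ s (s + u)) * covMat P (Y s) (Y s) := by
  ext i k
  have hYs := hY.memLp_two h0 h4 s
  have hc := memLp_affineRow S θ (memLp_two_rowBound S θ h4 (le_self_add (a := s) (b := u))) i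
  have hy := memLp_extendOne hYs
  have hind : ∀ o, IndepFun (fun ω => (affineRow (coefPair S θ s (s + u) ω) i o, (1 : ℝ)))
      (fun ω => (extendOne (Y s ω) o, Y s ω k)) P := fun o =>
    ((hY.indepFun_coefPair s u).comp ((measurable_extendOne o).prodMk (measurable_pi_apply k))
      ((measurable_affineRow i o).prodMk measurable_const)).symm
  have hmul : ∀ o, MemLp (fun ω => affineRow (coefPair S θ s (s + u) ω) i o *
      extendOne (Y s ω) o) 2 P := fun o =>
    memLp_mul_of_indepFun two_ne_zero ENNReal.ofNat_ne_top
      ((hind o).comp measurable_fst measurable_fst) (hc o) (hy o)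
  have hterm := fun o => covariance_mul_mul (hind o) (hc o) (memLp_const 1) (hy o) (hYs.eval k)
  simp only [mul_one, one_mul, integral_const, probReal_univ, smul_eq_mul] at hterm
  have e : covariance (fun ω => Y (s + u) ω i) (fun ω => Y s ω k) P =
      covariance (fun ω => ∑ o, affineRow (coefPair S θ s (s + u) ω) i o * extendOne (Y s ω) o)
        (fun ω => Y s ω k) P := 
    covariance_congr_ae (hY.ae_eq_sum s u i) (ae_eq_refl _)
  rw [covMat, Matrix.of_apply, e, covariance_fun_sum_left hmul (hYs.eval k)]
  simp_rw [hterm]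
  rw [Fintype.sum_option]
  simp only [affineRow, extendOne, one_mul, integral_const, probReal_univ, one_smul, mul_one,
    sub_self, zero_add]
  rw [Matrix.mul_apply]
  refine Finset.sum_congr rfl fun j _ => ?_
  change _ = (∫ ω, coefJ S θ s (s + u) ω i j ∂P) *
    covariance (fun ω => Y s ω j) (fun ω => Y s ω k) P
  rw [covariance_eq_sub (hYs.eval j) (hYs.eval k), mul_sub, ← mul_assoc]
  rfl

theorem covMat_period_eq (hY : IsStateProcess S θ Y) {μ : Measure (Fin q → ℝ)}
    (hμ : HasLaw (Y 0) μ P) (h0 : MemLp (Y 0) 2 P)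
    (h4 : ∀ t, Integrable (fun ω => S.proc t ω ^ 4) P) (s : ℝ≥0) :
    covMat P (Y S.period) (Y s) = oneperiodCov S θ μ s := by
  have hc : ∀ t i o, MemLp (fun ω => affineRow (coefPair S θ 0 t ω) i o) 2 P := fun t i o => by
    have h := memLp_affineRow S θ (memLp_two_rowBound S θ h4 (le_self_add (a := 0) (b := t))) i o
    rwa [zero_add] at h
  have hy := memLp_extendOne h0
  have hJ : ∀ t i j, MemLp (fun ω => coefJ S θ 0 t ω i j) 2 P := fun t i j => hc t i (some j)
  have hK : ∀ t i, MemLp (fun ω => coefK S θ 0 t ω i) 2 P := fun t i => hc t i none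
  have hU : ∀ i, ∫ x, x i ∂μ = ∫ ω, Y 0 ω i ∂P := fun i =>
    (hμ.integral_comp (f := fun x => x i) (measurable_pi_apply i).aestronglyMeasurable).symm
  have hUU : ∀ i j, ∫ x, x i * x j ∂μ = ∫ ω, Y 0 ω i * Y 0 ω j ∂P := fun i j =>
    (hμ.integral_comp (f := fun x => x i * x j) (by fun_prop)).symm
  ext i k
  have hind : ∀ o o', IndepFun (fun ω => (affineRow (coefPair S θ 0 S.period ω) i o,
      affineRow (coefPair S θ 0 s ω) k o')) (fun ω => (extendOne (Y 0 ω) o, extendOne (Y 0 ω) o'))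
      P := fun o o' =>
    ((hY.indepFun_coefPair_zero S.period s).comp
      ((measurable_extendOne o).prodMk (measurable_extendOne o'))
      (((measurable_affineRow i o).comp measurable_fst).prodMk
        ((measurable_affineRow k o').comp measurable_snd))).symm
  have hmul : ∀ o, MemLp (fun ω => affineRow (coefPair S θ 0 S.period ω) i o *
      extendOne (Y 0 ω) o) 2 P := fun o =>
    memLp_mul_of_indepFun two_ne_zero ENNReal.ofNat_ne_top
      ((hind o o).comp measurable_fst measurable_fst) (hc _ _ o) (hy o)
  have hmul' : ∀ o, MemLp (fun ω => affineRow (coefPair S θ 0 s ω) k o *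
      extendOne (Y 0 ω) o) 2 P := fun o =>
    memLp_mul_of_indepFun two_ne_zero ENNReal.ofNat_ne_top
      ((hind o o).comp measurable_snd measurable_snd) (hc _ _ o) (hy o)
  have hterm := fun o o' => covariance_mul_mul (hind o o') (hc _ _ o) (hc _ _ o') (hy o) (hy o')
  have e1 := hY.ae_eq_sum 0 S.period i
  have e2 := hY.ae_eq_sum 0 s k
  rw [zero_add] at e1 e2
  have e : covariance (fun ω => Y S.period ω i) (fun ω => Y s ω k) P =
      covariance (fun ω => ∑ o, affineRow (coefPair S θ 0 S.period ω) i o * extendOne (Y 0 ω) o)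
        (fun ω => ∑ o, affineRow (coefPair S θ 0 s ω) k o * extendOne (Y 0 ω) o) P :=
    covariance_congr_ae e1 e2
  rw [covMat, Matrix.of_apply, e, covariance_fun_sum_fun_sum hmul hmul']
  simp_rw [hterm]
  simp only [Fintype.sum_option, affineRow, extendOne, one_mul, integral_const, probReal_univ,
    one_smul, mul_one, coefPair]
  have t1 : ∫ ω, (coefJ S θ 0 S.period ω * meanMat μ (fun u => vecMulVec u u) *
      (coefJ S θ 0 s ω)ᵀ) i k ∂P = ∑ j, ∑ l, (∫ ω, coefJ S θ 0 S.period ω i j *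
        coefJ S θ 0 s ω k l ∂P) * ∫ ω, Y 0 ω j * Y 0 ω l ∂P := by
    have hint : ∀ j l, Integrable (fun ω => coefJ S θ 0 S.period ω i j * coefJ S θ 0 s ω k l *
        ∫ ω, Y 0 ω j * Y 0 ω l ∂P) P := fun j l =>
      ((hJ _ i j).integrable_mul (hJ _ k l)).mul_const _
    simp_rw [← integral_mul_const]
    simp_rw [fun j => (integral_finsetSum Finset.univ fun l _ => hint j l).symm]
    rw [← integral_finsetSum _ fun j _ => integrable_finsetSum _ fun l _ => hint j l]
    refine integral_congr_ae (ae_of_all _ fun ω => ?_)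
    simp only [Matrix.mul_apply, transpose_apply, meanMat, Matrix.of_apply, vecMulVec_apply, hUU,
      Finset.sum_mul]
    rw [Finset.sum_comm]
    exact Finset.sum_congr rfl fun j _ => Finset.sum_congr rfl fun l _ => mul_right_comm _ _ _
  have t2 : ∫ ω, (coefJ S θ 0 S.period ω * vecMulVec (meanVec μ id) (coefK S θ 0 s ω)) i k ∂P =
      ∑ j, (∫ ω, coefJ S θ 0 S.period ω i j * coefK S θ 0 s ω k ∂P) * ∫ ω, Y 0 ω j ∂P := by
    have hint : ∀ j, Integrable (fun ω => coefJ S θ 0 S.period ω i j * coefK S θ 0 s ω k *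
        ∫ ω, Y 0 ω j ∂P) P := fun j => ((hJ _ i j).integrable_mul (hK _ k)).mul_const _
    simp_rw [← integral_mul_const]
    rw [← integral_finsetSum _ fun j _ => hint j]
    refine integral_congr_ae (ae_of_all _ fun ω => ?_)
    simp only [Matrix.mul_apply, vecMulVec_apply, meanVec, id, hU]
    exact Finset.sum_congr rfl fun j _ => by ring
  have t3 : ∫ ω, (vecMulVec (coefK S θ 0 S.period ω) (meanVec μ id) * (coefJ S θ 0 s ω)ᵀ) i k ∂P =
      ∑ l, (∫ ω, coefK S θ 0 S.period ω i * coefJ S θ 0 s ω k l ∂P) * ∫ ω, Y 0 ω l ∂P := by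
    have hint : ∀ l, Integrable (fun ω => coefK S θ 0 S.period ω i * coefJ S θ 0 s ω k l *
        ∫ ω, Y 0 ω l ∂P) P := fun l => ((hK _ i).integrable_mul (hJ _ k l)).mul_const _
    simp_rw [← integral_mul_const]
    rw [← integral_finsetSum _ fun l _ => hint l]
    refine integral_congr_ae (ae_of_all _ fun ω => ?_)
    simp only [Matrix.mul_apply, vecMulVec_apply, transpose_apply, meanVec, id, hU]
    exact Finset.sum_congr rfl fun j _ => by ring
  simp only [oneperiodCov]
  rw [Matrix.sub_apply, Matrix.add_apply, Matrix.sub_apply, Matrix.add_apply, Matrix.sub_apply,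
    Matrix.add_apply, Matrix.sub_apply]
  have u1 : meanMat P (fun ω => coefJ S θ 0 S.period ω * meanMat μ (fun u => vecMulVec u u) *
      (coefJ S θ 0 s ω)ᵀ) i k = _ := t1
  have u2 : meanMat P (fun ω => coefJ S θ 0 S.period ω *
      vecMulVec (meanVec μ id) (coefK S θ 0 s ω)) i k = _ := t2
  have u3 : meanMat P (fun ω => vecMulVec (coefK S θ 0 S.period ω) (meanVec μ id) *
      (coefJ S θ 0 s ω)ᵀ) i k = _ := t3
  have u4 : meanMat P (fun ω => vecMulVec (coefK S θ 0 S.period ω) (coefK S θ 0 s ω)) i k =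
    ∫ ω, coefK S θ 0 S.period ω i * coefK S θ 0 s ω k ∂P := rfl
  rw [u1, u2, u3, u4]
  simp only [Matrix.mul_apply, vecMulVec_apply, transpose_apply, meanVec, meanMat, Matrix.of_apply,
    id, hU, Finset.sum_mul]
  rw [Finset.sum_comm (s := Finset.univ) (t := Finset.univ) (f := fun l j =>
    (∫ ω, coefJ S θ 0 S.period ω i j ∂P) * _ * _)]
  simp only [Finset.sum_sub_distrib, Finset.sum_add_distrib]
  simp only [mul_assoc, mul_comm, mul_left_comm]
  ring

end IsStateProcess

end StateMoments

/-! ### Moments of the volatility -/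

section Volatility

variable {Ω : Type*} [MeasurableSpace Ω] {P : Measure Ω} {S : SimpleSemiLevy P}
  {p q : ℕ} {θ : Params p q} {Y : ℝ≥0 → Ω → Fin q → ℝ}

theorem covMat_comm (X X' : Ω → Fin q → ℝ) : covMat P X' X = (covMat P X X')ᵀ := by
  ext i j
  exact covariance_comm _ _

theorem dotProduct_transpose_mulVec_self (C : Matrix (Fin q) (Fin q) ℝ) (a : Fin q → ℝ) :
    a ⬝ᵥ (Cᵀ *ᵥ a) = a ⬝ᵥ (C *ᵥ a) := by
  rw [mulVec_transpose, dotProduct_comm, dotProduct_mulVec]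

theorem covMat_self_congr {X X' : Ω → Fin q → ℝ} (h : IdentDistrib X X' P P) :
    covMat P X X = covMat P X' X' := by
  have hm : ∀ i, ∫ ω, X ω i ∂P = ∫ ω, X' ω i ∂P := fun i =>
    (h.comp (measurable_pi_apply i)).integral_eq
  ext i j
  have hg : Measurable fun x : Fin q → ℝ =>
      (x i - ∫ ω, X' ω i ∂P) * (x j - ∫ ω, X' ω j ∂P) := by fun_prop
  change ∫ ω, (X ω i - ∫ ω, X ω i ∂P) * (X ω j - ∫ ω, X ω j ∂P) ∂P = _
  rw [hm, hm]
  exact (h.comp hg).integral_eq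

theorem SimpleSemiLevy.exists_eq_add_mul_period (S : SimpleSemiLevy P) (t : ℝ≥0) :
    ∃ (m : ℕ) (u : ℝ≥0), u < S.period ∧ t = u + m * S.period := by
  have hle : (⌊t / S.period⌋₊ : ℝ≥0) * S.period ≤ t :=
    (le_div_iff₀ S.period_pos).1 (Nat.floor_le zero_le)
  refine ⟨⌊t / S.period⌋₊, t - ⌊t / S.period⌋₊ * S.period, ?_, (tsub_add_cancel_of_le hle).symm⟩
  rw [tsub_lt_iff_left hle]
  have h := (div_lt_iff₀ S.period_pos).1 (Nat.lt_floor_add_one (t / S.period))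
  rwa [add_mul, one_mul] at h

namespace IsStateProcess

variable [IsProbabilityMeasure P]

theorem ae_volatility_eq (hY : IsStateProcess S θ Y) (t : ℝ≥0) :
    volatility θ Y t =ᵐ[P] fun ω => θ.α₀ + ∑ i, θ.α i * Y t ω i := by
  filter_upwards [hY.ae_leftLim_eq t] with ω hω
  rw [volatility, hω, dotProduct]

theorem memLp_volatility (hY : IsStateProcess S θ Y) {r : ℝ≥0∞} {t : ℝ≥0} (h : MemLp (Y t) r P) :
    MemLp (volatility θ Y t) r P := by
  refine MemLp.ae_eq (hY.ae_volatility_eq t).symm ?_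
  exact (memLp_const θ.α₀).add (memLp_finsetSum _ fun i _ => (h.eval i).const_mul (θ.α i))

theorem integral_volatility (hY : IsStateProcess S θ Y) {t : ℝ≥0} (h : Integrable (Y t) P) :
    ∫ ω, volatility θ Y t ω ∂P = θ.α₀ + θ.α ⬝ᵥ meanVec P (Y t) := by
  have hi : ∀ i, Integrable (fun ω => θ.α i * Y t ω i) P := fun i => (h.eval i).const_mul _
  rw [integral_congr_ae (hY.ae_volatility_eq t),
    integral_add (integrable_const _) (integrable_finsetSum _ fun i _ => hi i),
    integral_finsetSum _ fun i _ => hi i, integral_const, probReal_univ, one_smul]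
  simp_rw [integral_const_mul]
  rfl

theorem covariance_volatility (hY : IsStateProcess S θ Y) {s t : ℝ≥0} (hs : MemLp (Y s) 2 P)
    (ht : MemLp (Y t) 2 P) : covariance (volatility θ Y s) (volatility θ Y t) P =
      θ.α ⬝ᵥ (covMat P (Y s) (Y t) *ᵥ θ.α) := by
  have hs' : ∀ i, MemLp (fun ω => θ.α i * Y s ω i) 2 P := fun i => (hs.eval i).const_mul _
  have ht' : ∀ i, MemLp (fun ω => θ.α i * Y t ω i) 2 P := fun i => (ht.eval i).const_mul _
  have hsum : ∀ {X : Fin q → Ω → ℝ}, (∀ i, MemLp (X i) 2 P) →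
      Integrable (fun ω => ∑ i, X i ω) P := fun h =>
    (memLp_finsetSum _ fun i _ => h i).integrable one_le_two
  rw [covariance_congr_ae (hY.ae_volatility_eq s) (hY.ae_volatility_eq t),
    covariance_const_add_left (hsum hs'), covariance_const_add_right (hsum ht'),
    covariance_fun_sum_fun_sum hs' ht']
  simp_rw [covariance_const_mul_left, covariance_const_mul_right]
  simp only [dotProduct, mulVec, Finset.mul_sum, covMat, Matrix.of_apply]
  exact Finset.sum_congr rfl fun i _ => Finset.sum_congr rfl fun j _ => by ring

theorem meanVec_add_mul_period (hY : IsStateProcess S θ Y) (h0 : Integrable (Y 0) P)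
    {μ : Measure (Fin q → ℝ)} [IsProbabilityMeasure μ] (hμ : IsRecurrenceLaw S θ μ)
    (hlaw : HasLaw (Y 0) μ P) (m : ℕ) (u : ℝ≥0) :
    meanVec P (Y (u + m * S.period)) =
      meanMat P (coefJ S θ 0 u) *ᵥ meanVec μ id + meanVec P (coefK S θ 0 u) := by
  have h1 : meanVec P (Y 0) = meanVec μ id := funext fun i =>
    hlaw.integral_comp (f := fun x => x i) (measurable_pi_apply i).aestronglyMeasurable
  have h2 : meanVec P (Y (u + m * S.period)) = meanVec P (Y u) := funext fun i => by
    rw [add_comm]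
    exact ((hY.identDistrib_add_mul_period hμ hlaw m u).comp (measurable_pi_apply i)).integral_eq
  rw [h2, hY.meanVec_eq h0, h1]

theorem covMat_add_mul_period (hY : IsStateProcess S θ Y) (h0 : MemLp (Y 0) 2 P)
    (h4 : ∀ t, Integrable (fun ω => S.proc t ω ^ 4) P) {μ : Measure (Fin q → ℝ)}
    [IsProbabilityMeasure μ] (hμ : IsRecurrenceLaw S θ μ) (hlaw : HasLaw (Y 0) μ P)
    {t h t₁ t₂ : ℝ≥0} {m n : ℕ} (ht₁ : t₁ ≤ S.period) (ht : t = t₁ + m * S.period)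
    (hth : t + h = t₂ + n * S.period) : covMat P (Y (t + h)) (Y t) =
      meanMat P (coefJ S θ 0 t₂) * meanMat P (coefJ S θ 0 S.period) ^ ((n : ℤ) - m - 1) *
        oneperiodCov S θ μ t₁ := by
  have h1 := hY.covMat_add_self h0 h4 t₁ (S.period - t₁)
  rw [add_tsub_cancel_of_le ht₁, hY.covMat_period_eq hlaw h0 h4] at h1
  have h2 : covMat P (Y t) (Y t) = covMat P (Y t₁) (Y t₁) := by
    rw [ht, add_comm]
    exact covMat_self_congr (hY.identDistrib_add_mul_period hμ hlaw m t₁)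
  rw [hY.covMat_add_self h0 h4, meanMat_coefJ_eq_zpow S θ ht₁ ht hth, h2, h1, Matrix.mul_assoc]

end IsStateProcess

end Volatility

end

end SSCogarch

theorem corollary4p3 {Ω : Type*} [MeasurableSpace Ω] (P : Measure Ω) [IsProbabilityMeasure P]
    (S : SimpleSemiLevy P) {p q : ℕ} (θ : Params p q)
    (Y : ℝ≥0 → Ω → Fin q → ℝ) (hY : IsStateProcess S θ Y)
    (hY0 : Integrable (Y 0) P) :
    -- mean of the volatility
    (∀ t : ℝ≥0, Integrable (Y t) P ∧ Integrable (volatility θ Y t) P ∧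
      ∫ ω, volatility θ Y t ω ∂P = θ.α₀ + θ.α ⬝ᵥ meanVec P (Y t)) ∧
    -- covariance function of the volatility
    (MemLp (Y 0) 2 P → (∀ t : ℝ≥0, Integrable (fun ω => S.proc t ω ^ 4) P) →
      (∀ t : ℝ≥0, MemLp (Y t) 2 P ∧ MemLp (volatility θ Y t) 2 P) ∧
      ∀ t h : ℝ≥0, covariance (volatility θ Y t) (volatility θ Y (t + h)) P =
        θ.α ⬝ᵥ (covMat P (Y t) (Y (t + h)) *ᵥ θ.α)) ∧
    -- explicit form when the initial value has the law of `U`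
    (∀ μ : Measure (Fin q → ℝ), IsProbabilityMeasure μ → IsRecurrenceLaw S θ μ →
      HasLaw (Y 0) μ P →
      ((∀ t : ℝ≥0, (∀ i j, Integrable (fun ω => coefJ S θ 0 t ω i j) P) ∧
          Integrable (coefK S θ 0 t) P) ∧
        ∀ t : ℝ≥0, ∃ (m : ℕ) (t₁ : ℝ≥0), t₁ < S.period ∧ t = t₁ + m * S.period ∧
          ∫ ω, volatility θ Y t ω ∂P = θ.α₀ + θ.α ⬝ᵥ
            (meanMat P (coefJ S θ 0 t₁) *ᵥ meanVec μ id + meanVec P (coefK S θ 0 t₁))) ∧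
      (MemLp (Y 0) 2 P → (∀ t : ℝ≥0, Integrable (fun ω => S.proc t ω ^ 4) P) →
        (∀ t : ℝ≥0, (∀ i j, MemLp (fun ω => coefJ S θ 0 t ω i j) 2 P) ∧
          MemLp (coefK S θ 0 t) 2 P) ∧
        IsUnit (meanMat P (coefJ S θ 0 S.period)).det ∧
        ∀ t h : ℝ≥0, ∃ (m n : ℕ) (t₁ t₂ : ℝ≥0), t₁ < S.period ∧ t₂ < S.period ∧
          t = t₁ + m * S.period ∧ t + h = t₂ + n * S.period ∧
          covariance (volatility θ Y t) (volatility θ Y (t + h)) P =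
            θ.α ⬝ᵥ ((meanMat P (coefJ S θ 0 t₂) *
              meanMat P (coefJ S θ 0 S.period) ^ ((n : ℤ) - m - 1) *
              oneperiodCov S θ μ t₁) *ᵥ θ.α))) := by

  refine ⟨fun t => ?_, fun h0 h4 => ⟨fun t => ?_, fun t h => ?_⟩, fun μ _ hμ hlaw =>
    ⟨⟨fun t => ⟨fun i j => ?_, ?_⟩, fun t => ?_⟩, fun h0 h4 =>
      ⟨fun t => ⟨fun i j => ?_, ?_⟩, isUnit_det_meanMat_coefJ S θ S.period, fun t h => ?_⟩⟩⟩
  · have ht := hY.integrable hY0 t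
    exact ⟨ht, memLp_one_iff_integrable.1 (hY.memLp_volatility (memLp_one_iff_integrable.2 ht)),
      hY.integral_volatility ht⟩
  · have ht := hY.memLp_two h0 h4 t
    exact ⟨ht, hY.memLp_volatility ht⟩
  · exact hY.covariance_volatility (hY.memLp_two h0 h4 t) (hY.memLp_two h0 h4 _)
  · simpa using integrable_coefJ S θ 0 t i j
  · simpa using integrable_coefK S θ 0 t
  · obtain ⟨m, t₁, ht₁, ht⟩ := S.exists_eq_add_mul_period t
    refine ⟨m, t₁, ht₁, ht, ?_⟩
    rw [hY.integral_volatility (hY.integrable hY0 t), ht,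
      hY.meanVec_add_mul_period hY0 hμ hlaw]
  · have h := memLp_coefJ S θ (memLp_two_rowBound S θ h4 (le_self_add (a := 0) (b := t))) i j
    rwa [zero_add] at h
  · have h := memLp_coefK S θ (memLp_two_rowBound S θ h4 (le_self_add (a := 0) (b := t)))
    rwa [zero_add] at h
  · obtain ⟨m, t₁, ht₁, ht⟩ := S.exists_eq_add_mul_period t
    obtain ⟨n, t₂, ht₂, hth⟩ := S.exists_eq_add_mul_period (t + h)
    refine ⟨m, n, t₁, t₂, ht₁, ht₂, ht, hth, ?_⟩
    rw [hY.covariance_volatility (hY.memLp_two h0 h4 t) (hY.memLp_two h0 h4 _),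
      covMat_comm (Y (t + h)) (Y t), dotProduct_transpose_mulVec_self,
      hY.covMat_add_mul_period h0 h4 hμ hlaw ht₁.le ht hth]
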